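/- **Setting.** Fix $k$. For each $n$ let $p=p(n)$, let $\{1,\dots,n\}$ be partitioned into $k$ classes $\mathcal C_1,\dots,\mathcal C_k$ of sizes $n_1,\dots,n_k$, let $\mu_1,\dots,\mu_k\in\mathbb R^p$ and let $C_1,\dots,C_k\in\mathbb R^{p\times p}$ be symmetric nonnegative definite (all depending on $n$). Let $x_i=\mu_a+\sqrt p\,w_i$ for $i\in\mathcal C_a$, where $w_1,\dots,w_n$ are independent, $w_i\sim\mathcal N(0,p^{-1}C_a)$; nothing is assumed on the joint law for different $n$. Put $c_0=p/n$, $c_a=n_a/n$, $\mu^\circ=\sum_a c_a\mu_a$, $\mu_a^\circ=\mu_a-\mu^\circ$, $C^\circ=\sum_a c_aC_a$, $C_a^\circ=C_a-C^\circ$, $\tau=\frac2p\operatorname{tr}C^\circ$, $t_a=\frac1{\sqrt p}\operatorname{tr}C_a^\circ$. Assume, as $n\to\infty$, that $0<\liminf c_0\le\limsup c_0<\infty$, $\liminf c_a>0$ for each $a$, $\limsup\max_a\|\mu_a^\circ\|<\infty$, $\limsup\max_a\|C_a\|<\infty$ (operator norm) and $\limsup\max_a\frac1{\sqrt n}\operatorname{tr}C_a^\circ<\infty$.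 Let $f:[0,\infty)\to[0,\infty)$ be independent of $n$, with $\liminf_n f(\tau)>0$, and $C^3$ on a neighbourhood in $[0,\infty)$, of some radius $\varepsilon>0$ not depending on $n$, of the values taken by $\tau=\tau_n$ for $n$ large (one-sided derivatives at $0$). Let $K=\{f(\frac1p\|x_i-x_j\|^2)\}_{i,j=1}^n$, $D=\operatorname{diag}(K1_n)$, and $\psi=\{\|w_i\|^2-\mathrm E\|w_i\|^2\}_{i=1}^n$. For random $v_n\in\mathbb R^n$, write $v_n=o(n^{-1})$ entrywise if both (i) there is $\alpha>0$ such that for all $\eta,d>0$, $n^{d}\,\mathbb P\big(\max_i|(v_n)_i|\ge n^{\eta-\alpha-1}\big)\to0$, and (ii) $n\max_i|(v_n)_i|\to0$ almost surely. **Proposition (Eigenvector $D^{1/2}1_n$).** Under these assumptions, $$\frac{D^{1/2}1_n}{\sqrt{1_n^{\mathsf T}D1_n}}=\frac{1_n}{\sqrt n}+\frac1{n\sqrt{c_0}}\,\frac{f'(\tau)}{2f(\tau)}\Big[\{t_a1_{n_a}\}_{a=1}^k+\sqrt p\,\psi\Big]+o(n^{-1})$$ entrywise. Moreover, on a suitable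 extension of the probability space (that is, a probability space with a measure-preserving map to the original one) there are random vectors $\varphi=\varphi_n\sim\mathcal N(0,I_n)$ such that $$\frac{D^{1/2}1_n}{\sqrt{1_n^{\mathsf T}D1_n}}=\frac{1_n}{\sqrt n}+\frac1{n\sqrt{c_0}}\,\frac{f'(\tau)}{2f(\tau)}\Big[\{t_a1_{n_a}\}_{a=1}^k+\operatorname{diag}\Big\{\sqrt{\tfrac2p\operatorname{tr}(C_a^2)}\,1_{n_a}\Big\}_{a=1}^k\varphi\Big]+o(n^{-1})$$ entrywise. Here $\{v_a1_{n_a}\}_{a=1}^k$ denotes the vector of $\mathbb R^n$ whose $i$-th entry is $v_a$ for $i\in\mathcal C_a$. -/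

import Mathlib

universe u

open MeasureTheory ProbabilityTheory Filter Topology Set

noncomputable section

/-- Deterministic data of a `k`-class Gaussian mixture, for each sample size `n`: the dimension
`p n`, the class of each of the `n` samples, the class means and the class covariances. -/
structure MixtureModel (k : ℕ) where
  p : ℕ → ℕ
  cls : (n : ℕ) → Fin n → Fin k
  mean : (n : ℕ) → Fin k → EuclideanSpace ℝ (Fin (p n))
  cov : (n : ℕ) → Fin k → Matrix (Fin (p n)) (Fin (p n)) ℝ
  posSemidef_cov : ∀ n a, (cov n a).PosSemidef

namespace MixtureModel

variable {k : ℕ} (m : MixtureModel k)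

/-- `c₀ = p / n`. -/
def c₀ (n : ℕ) : ℝ := (m.p n : ℝ) / n

/-- `n_a`, the number of samples in class `a`. -/
def classSize (n : ℕ) (a : Fin k) : ℕ := (Finset.univ.filter fun i => m.cls n i = a).card

/-- `c_a = n_a / n`. -/
def c (n : ℕ) (a : Fin k) : ℝ := (m.classSize n a : ℝ) / n

/-- `μ° = ∑ₐ (n_a / n) μ_a`. -/
def meanAvg (n : ℕ) : EuclideanSpace ℝ (Fin (m.p n)) := ∑ a, m.c n a • m.mean n a

/-- `μ_a° = μ_a - μ°`. -/
def meanCentered (n : ℕ) (a : Fin k) : EuclideanSpace ℝ (Fin (m.p n)) :=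
  m.mean n a - m.meanAvg n

/-- `C° = ∑ₐ (n_a / n) C_a`. -/
def covAvg (n : ℕ) : Matrix (Fin (m.p n)) (Fin (m.p n)) ℝ := ∑ a, m.c n a • m.cov n a

/-- `C_a° = C_a - C°`. -/
def covCentered (n : ℕ) (a : Fin k) : Matrix (Fin (m.p n)) (Fin (m.p n)) ℝ :=
  m.cov n a - m.covAvg n

/-- `τ = (2 / p) tr C°`. -/
def τ (n : ℕ) : ℝ := 2 / (m.p n : ℝ) * (m.covAvg n).trace

/-- `t_a = (1 / √p) tr C_a°`. -/
def t (n : ℕ) (a : Fin k) : ℝ := 1 / √(m.p n : ℝ) * (m.covCentered n a).trace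

/-- The growth rate assumption. Conditions `0 < liminf` and `limsup < ∞` are written as eventual
bounds by constants; `c_a ≤ 1` always holds. -/
structure GrowthRate : Prop where
  data_scaling : ∃ l > 0, ∃ u, ∀ᶠ n in atTop, l ≤ m.c₀ n ∧ m.c₀ n ≤ u
  class_scaling : ∀ a, ∃ l > 0, ∀ᶠ n in atTop, l ≤ m.c n a
  mean_scaling : ∃ B, ∀ᶠ n in atTop, ∀ a, ‖m.meanCentered n a‖ ≤ B
  cov_norm_scaling : ∃ B, ∀ᶠ n in atTop, ∀ a,
    ‖Matrix.toEuclideanCLM (n := Fin (m.p n)) (𝕜 := ℝ) (m.cov n a)‖ ≤ B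
  cov_trace_scaling : ∃ B, ∀ᶠ n : ℕ in atTop, ∀ a,
    1 / √(n : ℝ) * (m.covCentered n a).trace ≤ B

/-- The noise vectors: for every `n`, `w_1, …, w_n` are independent and `w_i ∼ N(0, p⁻¹ C_a)` when
sample `i` is in class `a`. Nothing is assumed on the joint law for different `n`. -/
structure IsNoise {Ω : Type*} [MeasurableSpace Ω] (Pr : Measure Ω)
    (w : (n : ℕ) → Fin n → Ω → EuclideanSpace ℝ (Fin (m.p n))) : Prop where
  indep : ∀ n, iIndepFun (w n) Pr
  law : ∀ n i, HasLaw (w n i)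
    (multivariateGaussian 0 ((m.p n : ℝ)⁻¹ • m.cov n (m.cls n i))) Pr

/-- The samples `x_i = μ_a + √p w_i`, for `i` in class `a`, at noise values `w`. -/
def sample (n : ℕ) (w : Fin n → EuclideanSpace ℝ (Fin (m.p n))) (i : Fin n) :
    EuclideanSpace ℝ (Fin (m.p n)) :=
  m.mean n (m.cls n i) + √(m.p n : ℝ) • w i

/-- The kernel matrix `K = {f(‖x_i - x_j‖² / p)}`. -/
def K (f : ℝ → ℝ) (n : ℕ) (w : Fin n → EuclideanSpace ℝ (Fin (m.p n))) :
    Matrix (Fin n) (Fin n) ℝ :=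
  Matrix.of fun i j => f (1 / (m.p n : ℝ) * ‖m.sample n w i - m.sample n w j‖ ^ 2)

/-- The diagonal of the degree matrix `D = diag(K 1_n)`. -/
def degree (f : ℝ → ℝ) (n : ℕ) (w : Fin n → EuclideanSpace ℝ (Fin (m.p n))) : Fin n → ℝ :=
  Matrix.mulVec (m.K f n w) 1

/-- The vector `D^{1/2} 1_n / √(1_nᵀ D 1_n)`. -/
def eigvec (f : ℝ → ℝ) (n : ℕ) (w : Fin n → EuclideanSpace ℝ (Fin (m.p n))) : Fin n → ℝ :=
  (√(1 ⬝ᵥ Matrix.mulVec (Matrix.diagonal (m.degree f n w)) 1))⁻¹ •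
    Matrix.mulVec (Matrix.diagonal fun i => √(m.degree f n w i)) 1

/-- `ψ_i = ‖w_i‖² - E ‖w_i‖²`. -/
def ψ {Ω : Type*} [MeasurableSpace Ω] (Pr : Measure Ω)
    (w : (n : ℕ) → Fin n → Ω → EuclideanSpace ℝ (Fin (m.p n))) (n : ℕ) (ω : Ω) (i : Fin n) : ℝ :=
  ‖w n i ω‖ ^ 2 - ∫ ω', ‖w n i ω'‖ ^ 2 ∂Pr

/-- The candidate expansion, with fluctuation vector `v`:
`1_n / √n + (1 / (n √c₀)) (f'(τ) / (2 f(τ))) ({t_a 1_{n_a}} + v)`.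
The kernel function lives on `[0, ∞)`, so `f'` is the derivative within `[0, ∞)`. -/
def expansion (f : ℝ → ℝ) (n : ℕ) (v : Fin n → ℝ) (i : Fin n) : ℝ :=
  1 / √(n : ℝ) + 1 / (n * √(m.c₀ n)) *
    (derivWithin f (Ici 0) (m.τ n) / (2 * f (m.τ n))) * (m.t n (m.cls n i) + v i)

/-- `√((2 / p) tr C_a²)`. -/
def stdDev (n : ℕ) (a : Fin k) : ℝ :=
  √(2 / (m.p n : ℝ) * (m.cov n a * m.cov n a).trace)

end MixtureModel

/-- Assumption on the kernel function `f : [0, ∞) → [0, ∞)` along the sequence `τ` (values of `f`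
at negative reals are irrelevant): `f` is `C³` on a neighbourhood in `[0, ∞)`, of some uniform
radius, of the values `τ n` (`n` large), and `liminf f(τ n) > 0`. -/
structure KernelAssumption (f : ℝ → ℝ) (τ : ℕ → ℝ) : Prop where
  nonneg : ∀ x, 0 ≤ x → 0 ≤ f x
  smooth : ∃ ε > 0, ∃ N : ℕ, ContDiffOn ℝ 3 f (Ici 0 ∩ Metric.thickening ε (τ '' Ici N))
  lower : ∃ δ > 0, ∀ᶠ n in atTop, δ ≤ f (τ n)

/-- `v = O(u_n)` for random vectors `v n` of size `n`: for all `η, d > 0`,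
`n^d Pr(max_i |v_i| ≥ n^η u_n) → 0`. The norm of `Fin n → ℝ` is the maximum of the moduli. -/
def IsBigOEntrywise {Ω : Type*} [MeasurableSpace Ω] (Pr : Measure Ω)
    (v : (n : ℕ) → Ω → Fin n → ℝ) (u : ℕ → ℝ) : Prop :=
  ∀ η > (0 : ℝ), ∀ d > (0 : ℝ),
    Tendsto (fun n : ℕ => (n : ℝ) ^ d * Pr.real {ω | (n : ℝ) ^ η * u n ≤ ‖v n ω‖}) atTop (𝓝 0)

/-- `v = o(u_n)` with overwhelming probability: `v = O(n^{-α} u_n)` for some `α > 0`. -/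
def IsLittleOEntrywise {Ω : Type*} [MeasurableSpace Ω] (Pr : Measure Ω)
    (v : (n : ℕ) → Ω → Fin n → ℝ) (u : ℕ → ℝ) : Prop :=
  ∃ α > (0 : ℝ), IsBigOEntrywise Pr v fun n => (n : ℝ) ^ (-α) * u n

/-- `max_i |v_i| = o(u_n)` almost surely. -/
def IsLittleOEntrywiseAS {Ω : Type*} [MeasurableSpace Ω] (Pr : Measure Ω)
    (v : (n : ℕ) → Ω → Fin n → ℝ) (u : ℕ → ℝ) : Prop :=
  ∀ᵐ ω ∂Pr, (fun n => ‖v n ω‖) =o[atTop] u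

end

/-!
Off the diagonal, `‖x_i - x_j‖² / p = τ + s_i + s_j - 2 ⟨w_i, w_j⟩ + O(1 / n)` with
`s_i = ‖w_i‖² - τ / 2 = t_a / √p + ψ_i`. Up to factors `n^η`, each of `s_i` and `⟨w_i, w_j⟩` is
`O(n^{-1/2})`, so a Taylor expansion of `f` at `τ` to first order has remainders that add up to
`O(1)` along a row of `K`. By independence the sums `∑_{j ≠ i} ⟨w_i, w_j⟩` and `∑_j ψ_j` are also
`O(1)`, and `∑_j t_{a(j)} = 0`. Hence `D_ii = n f(τ) + n f'(τ) s_i + O(1)`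
(`abs_row_sum_sub_le`), and expanding the square root gives the first formula with an error of
order `n^{-3/2}` (`abs_normalized_sqrt_sub_le`). This is a deterministic statement on the event
`NoiseBounds` (`BoundedBy.norm_eigvec_sub_expansion_le`). The event fails with probability at most
`C n² exp(-c n^η)`, since all the random quantities in it are linear or quadratic in Gaussian
vectors and have exponential moments (`lintegral_exp_quadraticForm_le`,
`BoundedBy.measure_not_noiseBounds_le`); the almost sure statement is then Borel–Cantelli.

For the second formula, `√p ψ_i` has to be replaced by a Gaussian variable with an error `n^{-α}`
that has very small probability of being exceeded, so that convergence in law is not enough. It is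
a centred quadratic form `⟨g, T g⟩ - tr T` of a standard Gaussian vector `g`, for which an explicit
coupling is available. Write `g = (g₀ + ⋯ + g_{m-1}) / √m` with independent standard Gaussian `g_r`,
and let `s_r = g₀ + ⋯ + g_{r-1}`. The increment of `⟨s_r, T s_r⟩` is
`2 ⟨T s_r, g_r⟩ + ⟨g_r, T g_r⟩`. The terms `⟨g_r, T g_r⟩` add up to nearly `m tr T`. Given the past,
`⟨T s_r, g_r⟩` is `‖T s_r‖` times a standard Gaussian variable, and `‖T s_r‖²` concentrates at
`r tr T²`; replacing `‖T s_r‖` by `√(r tr T²)` therefore costs little, and turns the sum into an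
exactly Gaussian variable (`coupledWalk_deviation_tail`, `exists_coupling_quadraticForm`). For
`√p ψ_i` the error is of order `m^{-1/2} + m^{1/2} p^{-1/4}`, which is `n^{-1/8}` when `m ∼ n^{1/4}`
(`BoundedBy.exists_coupling`). Only the laws of the pairs `(w_i, φ_i)` are constructed in this way;
they are realised over the given `w_i` with the help of independent uniform variables
(`exists_extension_of_couplings`).
-/

/-! ### Exponential moments of Gaussian quadratic forms -/

lemma exp_neg_sub_sq_le_one_sub {y : ℝ} (hy : |y| ≤ 1 / 5) :
    Real.exp (-y - 2 * y ^ 2) ≤ 1 - y := by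
  obtain ⟨h1, h2⟩ := abs_le.1 hy
  have hu : |-y - 2 * y ^ 2| ≤ 1 := by rw [abs_le]; constructor <;> nlinarith
  have h := (abs_le.1 (Real.abs_exp_sub_one_sub_id_le hu)).2
  nlinarith [sq_nonneg y, mul_nonneg (sq_nonneg y) (sub_nonneg.2 h2)]

/-- The integral is `e^{-s} / √(1 - 2 s)`, which is at most `e^{4 s²}` for small `s`. -/
lemma lintegral_exp_sq_gaussianReal_le {s : ℝ} (hs : |s| ≤ 1 / 10) :
    ∫⁻ x, ENNReal.ofReal (Real.exp (s * (x ^ 2 - 1))) ∂(gaussianReal 0 1) ≤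
      ENNReal.ofReal (Real.exp (4 * s ^ 2)) := by
  obtain ⟨h1, h2⟩ := abs_le.1 hs
  have hb : 0 < 1 / 2 - s := by linarith
  rw [gaussianReal_of_var_ne_zero _ one_ne_zero,
    lintegral_withDensity_eq_lintegral_mul _ (measurable_gaussianPDF 0 1) (by fun_prop)]
  have key : ∀ x : ℝ, (gaussianPDF 0 1 * fun x ↦ ENNReal.ofReal (Real.exp (s * (x ^ 2 - 1)))) x =
      ENNReal.ofReal ((√(2 * Real.pi))⁻¹ * Real.exp (-s) * Real.exp (-(1 / 2 - s) * x ^ 2)) := by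
    intro x
    simp only [Pi.mul_apply, gaussianPDF, gaussianPDFReal]
    rw [← ENNReal.ofReal_mul (by positivity)]
    congr 1
    simp only [NNReal.coe_one, mul_one, sub_zero]
    rw [mul_assoc, mul_assoc, ← Real.exp_add, ← Real.exp_add]
    congr 2; ring
  simp_rw [key]
  rw [← ofReal_integral_eq_lintegral_ofReal ((integrable_exp_neg_mul_sq hb).const_mul _)
    (ae_of_all _ fun x ↦ by positivity), integral_const_mul, integral_gaussian]
  apply ENNReal.ofReal_le_ofReal
  have hpi := Real.pi_pos
  have e1 : (√(2 * Real.pi))⁻¹ * Real.exp (-s) * √(Real.pi / (1 / 2 - s)) =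
      √(Real.exp (-(2 * s)) / (1 - 2 * s)) := by
    have : Real.exp (-s) = √(Real.exp (-(2 * s))) := by
      rw [← Real.exp_half]; congr 1; ring
    rw [this, ← Real.sqrt_inv, ← Real.sqrt_mul (by positivity), ← Real.sqrt_mul (by positivity)]
    congr 1
    have : 1 - 2 * s ≠ 0 := by linarith
    have : 1 / 2 - s ≠ 0 := hb.ne'
    field_simp
  have e2 : Real.exp (4 * s ^ 2) = √(Real.exp (8 * s ^ 2)) := by
    rw [← Real.exp_half]; congr 1; ring
  rw [e1, e2]
  apply Real.sqrt_le_sqrt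
  rw [div_le_iff₀ (by linarith)]
  have h := exp_neg_sub_sq_le_one_sub (y := 2 * s) (by rw [abs_mul]; norm_num; linarith)
  calc Real.exp (-(2 * s)) = Real.exp (8 * s ^ 2) * Real.exp (-(2 * s) - 2 * (2 * s) ^ 2) := by
        rw [← Real.exp_add]; congr 1; ring
    _ ≤ _ := by gcongr

section QuadraticForm

variable {E : Type*} [NormedAddCommGroup E] [InnerProductSpace ℝ E] [FiniteDimensional ℝ E]

lemma LinearMap.IsSymmetric.abs_eigenvalues_le_norm {T : E →L[ℝ] E}
    (hT : (T : E →ₗ[ℝ] E).IsSymmetric) {n : ℕ} (hn : Module.finrank ℝ E = n) (i : Fin n) :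
    |hT.eigenvalues hn i| ≤ ‖T‖ := by
  have h := T.le_opNorm (hT.eigenvectorBasis hn i)
  have h2 := hT.apply_eigenvectorBasis hn i
  simp only [ContinuousLinearMap.coe_coe] at h2
  rw [h2, norm_smul, (hT.eigenvectorBasis hn).orthonormal.1 i] at h
  simpa using h

lemma LinearMap.IsSymmetric.inner_self_apply_eq_sum {T : E →ₗ[ℝ] E} (hT : T.IsSymmetric)
    {n : ℕ} (hn : Module.finrank ℝ E = n) (x : Fin n → ℝ) :
    inner ℝ (∑ i, x i • hT.eigenvectorBasis hn i) (T (∑ i, x i • hT.eigenvectorBasis hn i)) =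
      ∑ i, hT.eigenvalues hn i * x i ^ 2 := by
  rw [map_sum, sum_inner]
  refine Finset.sum_congr rfl fun i _ ↦ ?_
  simp [hT.apply_eigenvectorBasis, inner_sum, inner_smul_left, inner_smul_right,
    orthonormal_iff_ite.1 (hT.eigenvectorBasis hn).orthonormal]
  ring

variable [MeasurableSpace E] [BorelSpace E]

/-- Exponential moments of a centred quadratic form of a standard Gaussian vector: diagonalising
the form turns it into a weighted sum of independent centred `χ²₁` variables. -/
lemma lintegral_exp_quadraticForm_le {T : E →L[ℝ] E} (hT : (T : E →ₗ[ℝ] E).IsSymmetric) {b s : ℝ}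
    (hb : ‖T‖ ≤ b) (hs : |s| * b ≤ 1 / 10) :
    ∫⁻ g, ENNReal.ofReal (Real.exp (s * (inner ℝ g (T g) - LinearMap.trace ℝ E T)))
      ∂(stdGaussian E) ≤ ENNReal.ofReal (Real.exp (4 * s ^ 2 * b ^ 2 * Module.finrank ℝ E)) := by
  set N := Module.finrank ℝ E with hN
  set lam := hT.eigenvalues hN.symm
  rw [stdGaussian_eq_map_pi_orthonormalBasis (hT.eigenvectorBasis hN.symm),
    lintegral_map (by fun_prop) (by fun_prop)]
  have h1 : ∀ x : Fin N → ℝ, ENNReal.ofReal (Real.exp (s * (inner ℝ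
      (∑ i, x i • hT.eigenvectorBasis hN.symm i) (T (∑ i, x i • hT.eigenvectorBasis hN.symm i)) -
        LinearMap.trace ℝ E T))) =
      ∏ i, ENNReal.ofReal (Real.exp (s * lam i * (x i ^ 2 - 1))) := by
    intro x
    rw [← ENNReal.ofReal_prod_of_nonneg (fun i _ ↦ by positivity), ← Real.exp_sum]
    have e := hT.inner_self_apply_eq_sum hN.symm x
    simp only [ContinuousLinearMap.coe_coe] at e
    rw [e, hT.trace_eq_sum_eigenvalues hN.symm]
    simp only [RCLike.ofReal_real_eq_id, id]
    rw [← Finset.sum_sub_distrib, Finset.mul_sum]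
    congr 2
    exact Finset.sum_congr rfl fun i _ ↦ by simp only [lam]; ring
  simp_rw [h1]
  have hind : iIndepFun (fun (i : Fin N) (x : Fin N → ℝ) ↦
      ENNReal.ofReal (Real.exp (s * lam i * (x i ^ 2 - 1))))
      (Measure.pi fun _ : Fin N ↦ gaussianReal 0 1) :=
    iIndepFun_pi (X := fun (i : Fin N) (x : ℝ) ↦
      ENNReal.ofReal (Real.exp (s * lam i * (x ^ 2 - 1)))) (fun i ↦ by fun_prop)
  have h2 := lintegral_prod_eq_prod_lintegral_of_indepFun Finset.univ _ hind (fun i ↦ by fun_prop)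
  rw [h2]
  have h3 : ∀ i : Fin N, ∫⁻ x : Fin N → ℝ, ENNReal.ofReal (Real.exp (s * lam i * (x i ^ 2 - 1)))
      ∂(Measure.pi fun _ : Fin N ↦ gaussianReal 0 1) ≤
      ENNReal.ofReal (Real.exp (4 * s ^ 2 * b ^ 2)) := by
    intro i
    have hl : |lam i| ≤ b := (hT.abs_eigenvalues_le_norm hN.symm i).trans hb
    have hb0 : 0 ≤ b := (norm_nonneg T).trans hb
    have := (measurePreserving_eval (fun _ : Fin N ↦ gaussianReal 0 1) i).lintegral_comp
      (f := fun x ↦ ENNReal.ofReal (Real.exp (s * lam i * (x ^ 2 - 1)))) (by fun_prop)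
    simp only [Function.eval] at this
    rw [this]
    refine (lintegral_exp_sq_gaussianReal_le ?_).trans ?_
    · rw [abs_mul]
      exact (mul_le_mul_of_nonneg_left hl (abs_nonneg s)).trans hs
    · apply ENNReal.ofReal_le_ofReal
      apply Real.exp_le_exp.2
      have : lam i ^ 2 ≤ b ^ 2 := sq_le_sq' (abs_le.1 hl).1 (abs_le.1 hl).2
      nlinarith [mul_le_mul_of_nonneg_left this (sq_nonneg s)]
  refine (Finset.prod_le_prod' fun i _ ↦ h3 i).trans ?_
  rw [Finset.prod_const, ← ENNReal.ofReal_pow (by positivity), ← Real.exp_nat_mul]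
  apply ENNReal.ofReal_le_ofReal
  apply Real.exp_le_exp.2
  simp
  apply le_of_eq; ring

end QuadraticForm

/-- Two-sided Chernoff bound, from the exponential moments at `s` and `-s`. -/
lemma measure_lt_abs_le_of_lintegral_exp_le {α : Type*} {mα : MeasurableSpace α} {μ : Measure α}
    {X : α → ℝ} (hX : AEMeasurable X μ) {K s : ℝ} (hs : 0 < s) (hK : 0 ≤ K)
    (h1 : ∫⁻ a, ENNReal.ofReal (Real.exp (s * X a)) ∂μ ≤ ENNReal.ofReal K)
    (h2 : ∫⁻ a, ENNReal.ofReal (Real.exp (-s * X a)) ∂μ ≤ ENNReal.ofReal K) (L : ℝ) :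
    μ {a | L < |X a|} ≤ ENNReal.ofReal (2 * K * Real.exp (-(s * L))) := by
  have key : ∀ r : ℝ, ∫⁻ a, ENNReal.ofReal (Real.exp (r * X a)) ∂μ ≤ ENNReal.ofReal K →
      μ {a | s * L ≤ r * X a} ≤ ENNReal.ofReal (K * Real.exp (-(s * L))) := by
    intro r hr
    have h := mul_meas_ge_le_lintegral₀ (μ := μ)
      (f := fun a ↦ ENNReal.ofReal (Real.exp (r * X a))) (by fun_prop)
      (ENNReal.ofReal (Real.exp (s * L)))
    have hset : {a | s * L ≤ r * X a} =
        {a | ENNReal.ofReal (Real.exp (s * L)) ≤ ENNReal.ofReal (Real.exp (r * X a))} := by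
      ext a
      simp [ENNReal.ofReal_le_ofReal_iff (Real.exp_pos _).le]
    rw [← hset] at h
    have h' := h.trans hr
    rw [mul_comm] at h'
    have h4 := ENNReal.le_div_iff_mul_le (a := μ {a | s * L ≤ r * X a})
      (b := ENNReal.ofReal (Real.exp (s * L))) (c := ENNReal.ofReal K)
      (Or.inl (by simp [Real.exp_pos])) (Or.inl ENNReal.ofReal_ne_top) |>.2 h'
    rwa [← ENNReal.ofReal_div_of_pos (Real.exp_pos _), div_eq_mul_inv, ← Real.exp_neg] at h4
  have hsub : {a | L < |X a|} ⊆ {a | s * L ≤ s * X a} ∪ {a | s * L ≤ -s * X a} := by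
    intro a (ha : L < |X a|)
    rcases lt_abs.1 ha with h | h
    · exact Or.inl (mul_le_mul_of_nonneg_left h.le hs.le)
    · right
      simp only [mem_ofPred_eq]
      nlinarith
  refine (measure_mono hsub).trans ((measure_union_le _ _).trans
    ((add_le_add (key s h1) (key (-s) h2)).trans ?_))
  rw [← ENNReal.ofReal_add (by positivity) (by positivity)]
  apply ENNReal.ofReal_le_ofReal
  apply le_of_eq; ring

/-! ### The coupled walk -/

section Coupling

variable {E : Type*} [NormedAddCommGroup E] [InnerProductSpace ℝ E]

/-- The unit vector in the direction of `x`, and `e` when `x = 0`. -/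
noncomputable def directionOr (e x : E) : E := open Classical in if x = 0 then e else ‖x‖⁻¹ • x

lemma norm_directionOr {e : E} (he : ‖e‖ = 1) (x : E) : ‖directionOr e x‖ = 1 := by
  unfold directionOr
  split_ifs with h
  · exact he
  · rw [norm_smul, norm_inv, norm_norm, inv_mul_cancel₀ (norm_ne_zero_iff.2 h)]

lemma norm_smul_directionOr (e x : E) : ‖x‖ • directionOr e x = x := by
  unfold directionOr
  split_ifs with h
  · simp [h]
  · rw [smul_smul, mul_inv_cancel₀ (norm_ne_zero_iff.2 h), one_smul]

/-- One step of the coupled walk, from the state `q.1 = (s, y, t)` with the Gaussian vector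
`g = q.2`. The direction of `T s` has norm one, so that the increment of `y` has the same law
`N(0, k)` whatever the current state; the default direction `e` serves when `T s = 0`. -/
noncomputable def coupledStep (T : E →L[ℝ] E) (e : E) (k : ℕ) (q : (E × ℝ × ℝ) × E) : E × ℝ × ℝ :=
  (q.1.1 + q.2, q.1.2.1 + √k * inner ℝ (directionOr e (T q.1.1)) q.2,
    q.1.2.2 + inner ℝ q.2 (T q.2))

/-- The increment of `D = ⟨s, T s⟩ - t - 2 √v y` in one step is governed by the difference between
`‖T s‖` and `√(v k)`. -/
lemma coupledWalk_deviation_step {T : E →L[ℝ] E} (hT : (T : E →ₗ[ℝ] E).IsSymmetric) {e : E}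
    (v : ℝ) (k : ℕ) (hv : 0 ≤ v) (q : (E × ℝ × ℝ) × E) :
    let D : E × ℝ × ℝ → ℝ := fun x ↦ inner ℝ x.1 (T x.1) - x.2.2 - 2 * √v * x.2.1
    D (coupledStep T e k q) = D q.1 +
      2 * (‖T q.1.1‖ - √(v * k)) * inner ℝ (directionOr e (T q.1.1)) q.2 := by
  intro D
  obtain ⟨⟨s, y, t⟩, g⟩ := q
  simp only [D, coupledStep, map_add, inner_add_left, inner_add_right]
  have h1 : inner ℝ s (T g) = ‖T s‖ * inner ℝ (directionOr e (T s)) g := by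
    rw [← real_inner_smul_left, norm_smul_directionOr]
    exact (hT s g).symm
  have h2 : inner ℝ g (T s) = ‖T s‖ * inner ℝ (directionOr e (T s)) g := by
    rw [← real_inner_smul_left, norm_smul_directionOr, real_inner_comm]
  rw [h1, h2, Real.sqrt_mul hv]
  ring

variable [FiniteDimensional ℝ E] [MeasurableSpace E] [BorelSpace E]

@[fun_prop]
lemma measurable_directionOr (e : E) : Measurable (directionOr e) := by
  unfold directionOr
  exact Measurable.ite (measurableSet_singleton 0) measurable_const (by fun_prop)

@[fun_prop]
lemma measurable_coupledStep (T : E →L[ℝ] E) (e : E) (k : ℕ) :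
    Measurable (coupledStep T e k) := by
  unfold coupledStep
  fun_prop

/-- The law at time `k` of the coupled walk `(s, y, t)` driven by independent standard Gaussian
vectors `g₀, g₁, …`: `s` is their sum, `t` is the sum of the `⟨gᵣ, T gᵣ⟩`, and `y` is the sum of
`√r` times the component of `gᵣ` in the direction of `T (g₀ + ⋯ + gᵣ₋₁)`. -/
noncomputable def coupledWalk (T : E →L[ℝ] E) (e : E) : ℕ → Measure (E × ℝ × ℝ)
  | 0 => Measure.dirac 0
  | k + 1 => ((coupledWalk T e k).prod (stdGaussian E)).map (coupledStep T e k)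

instance isProbabilityMeasure_coupledWalk (T : E →L[ℝ] E) (e : E) (k : ℕ) :
    IsProbabilityMeasure (coupledWalk T e k) := by
  induction k with
  | zero => rw [coupledWalk]; infer_instance
  | succ k ih =>
    rw [coupledWalk]
    exact Measure.isProbabilityMeasure_map (by fun_prop)

lemma stdGaussian_map_mul_inner {x : E} {c : ℝ} :
    (stdGaussian E).map (fun g ↦ c * inner ℝ x g) =
      gaussianReal 0 ((c * ‖x‖) ^ 2).toNNReal := by
  have h := IsGaussian.map_eq_gaussianReal (μ := stdGaussian E) (c • innerSL ℝ x)
  rw [integral_strongDual_stdGaussian, variance_dual_stdGaussian] at h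
  rw [norm_smul, innerSL_apply_norm, Real.norm_eq_abs, mul_pow, sq_abs, ← mul_pow] at h
  rw [← h]
  rfl

lemma coupledWalk_map_fst (T : E →L[ℝ] E) (e : E) (k : ℕ) :
    (coupledWalk T e k).map Prod.fst = (stdGaussian E).map (fun g ↦ √(k : ℝ) • g) := by
  have h : ∀ t, charFun ((coupledWalk T e k).map Prod.fst) t =
      Complex.exp (-(k * ‖t‖ ^ 2) / 2) := by
    intro t
    induction k with
    | zero => rw [coupledWalk, Measure.map_dirac' (by fun_prop)]; simp
    | succ k ih =>
      have : (coupledWalk T e (k + 1)).map Prod.fst =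
          ((coupledWalk T e k).map Prod.fst) ∗ (stdGaussian E) := by
        rw [coupledWalk, Measure.map_map (by fun_prop) (by fun_prop), Measure.conv]
        conv_rhs => rw [← Measure.map_id (μ := stdGaussian E)]
        rw [Measure.map_prod_map _ _ (by fun_prop) (by fun_prop),
          Measure.map_map (by fun_prop) (by fun_prop)]
        rfl
      rw [this, charFun_conv, ih, charFun_stdGaussian, ← Complex.exp_add]
      congr 1; push_cast; ring
  have := Measure.isProbabilityMeasure_map (μ := coupledWalk T e k) (f := Prod.fst) (by fun_prop)
  have := Measure.isProbabilityMeasure_map (μ := stdGaussian E) (f := fun g ↦ √(k : ℝ) • g)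
    (by fun_prop)
  apply Measure.ext_of_charFun
  ext t
  rw [h, charFun_map_smul, charFun_stdGaussian, norm_smul, Real.norm_eq_abs,
    abs_of_nonneg (Real.sqrt_nonneg _)]
  congr 1
  have hk : ((√(k : ℝ) * ‖t‖ : ℝ) : ℂ) ^ 2 = k * ‖t‖ ^ 2 := by
    rw [← Complex.ofReal_pow, mul_pow, Real.sq_sqrt (Nat.cast_nonneg k)]
    push_cast
    rfl
  rw [hk]

lemma coupledWalk_map_snd (T : E →L[ℝ] E) {e : E} (he : ‖e‖ = 1) (k : ℕ) :
    (coupledWalk T e k).map (fun x ↦ x.2.1) =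
      gaussianReal 0 (∑ r ∈ Finset.range k, (r : NNReal)) := by
  induction k with
  | zero =>
    rw [coupledWalk, Measure.map_dirac' (by fun_prop)]
    simp
  | succ k ih =>
    have hmp : MeasurePreserving (fun x : E × ℝ × ℝ ↦ x.2.1) (coupledWalk T e k)
        (gaussianReal 0 (∑ r ∈ Finset.range k, (r : NNReal))) := ⟨by fun_prop, ih⟩
    -- the conditional law of the increment does not depend on the state, so the pair is independent
    have := hmp.skew_product (μc := stdGaussian E) (μd := gaussianReal 0 k)
      (g := fun x g ↦ √(k : ℝ) * inner ℝ (directionOr e (T x.1)) g) (by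
        simp only [Function.uncurry_def]; fun_prop)
      (ae_of_all _ fun x ↦ by
        rw [stdGaussian_map_mul_inner, norm_directionOr he]
        congr 1
        rw [mul_one, Real.sq_sqrt (Nat.cast_nonneg k)]
        exact Real.toNNReal_natCast k)
    rw [coupledWalk, Measure.map_map (by fun_prop) (by fun_prop), Finset.sum_range_succ,
      ← add_zero (0 : ℝ), ← gaussianReal_conv_gaussianReal, Measure.conv, ← this.map_eq,
      Measure.map_map (by fun_prop) this.measurable]
    rfl

lemma lintegral_exp_coupledWalk_le {T : E →L[ℝ] E} (hT : (T : E →ₗ[ℝ] E).IsSymmetric) (e : E)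
    {b s : ℝ} (hb : ‖T‖ ≤ b) (hs : |s| * b ≤ 1 / 10) (k : ℕ) :
    ∫⁻ x, ENNReal.ofReal (Real.exp (s * (x.2.2 - k * LinearMap.trace ℝ E T)))
        ∂(coupledWalk T e k) ≤
      ENNReal.ofReal (Real.exp (k * (4 * s ^ 2 * b ^ 2 * Module.finrank ℝ E))) := by
  induction k with
  | zero => rw [coupledWalk, lintegral_dirac' _ (by fun_prop)]; simp
  | succ k ih =>
    rw [coupledWalk, lintegral_map (by fun_prop) (by fun_prop)]
    have h : ∀ q : (E × ℝ × ℝ) × E, ENNReal.ofReal (Real.exp (s * ((coupledStep T e k q).2.2 -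
        (k + 1 : ℕ) * LinearMap.trace ℝ E T))) =
        ENNReal.ofReal (Real.exp (s * (q.1.2.2 - k * LinearMap.trace ℝ E T))) *
          ENNReal.ofReal (Real.exp (s * (inner ℝ q.2 (T q.2) - LinearMap.trace ℝ E T))) := by
      intro q
      rw [← ENNReal.ofReal_mul (by positivity), ← Real.exp_add]
      simp only [coupledStep]
      congr 2; push_cast; ring
    simp_rw [h]
    rw [lintegral_prod_mul (f := fun x : E × ℝ × ℝ ↦
      ENNReal.ofReal (Real.exp (s * (x.2.2 - k * LinearMap.trace ℝ E T))))
      (g := fun g : E ↦ ENNReal.ofReal (Real.exp (s * (inner ℝ g (T g) - LinearMap.trace ℝ E T))))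
      (by fun_prop) (by fun_prop)]
    refine (mul_le_mul' ih (lintegral_exp_quadraticForm_le hT hb hs)).trans ?_
    rw [← ENNReal.ofReal_mul (by positivity), ← Real.exp_add]
    apply ENNReal.ofReal_le_ofReal
    apply le_of_eq
    congr 1; push_cast; ring

end Coupling

/-! ### Tails, and the deviation of the coupled walk -/

section Tails

lemma Real.exp_le_two_of_le {x : ℝ} (hx : x ≤ 1 / 2) : Real.exp x ≤ 2 := by
  have h1 := Real.exp_one_lt_d9
  have h2 : Real.exp (1 / 2) ^ 2 = Real.exp 1 := by rw [← Real.exp_nat_mul]; norm_num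
  have h3 := Real.exp_le_exp.2 hx
  nlinarith [Real.exp_pos (1 / 2)]

lemma gaussianReal_lt_abs_le (L : ℝ) :
    gaussianReal 0 1 {x | L < |x|} ≤ ENNReal.ofReal (4 * Real.exp (-L)) := by
  have h : ∀ t : ℝ, ∫⁻ x, ENNReal.ofReal (Real.exp (t * x)) ∂(gaussianReal 0 1) =
      ENNReal.ofReal (Real.exp (t ^ 2 / 2)) := by
    intro t
    rw [← ofReal_integral_eq_lintegral_ofReal (integrable_exp_mul_gaussianReal t)
      (ae_of_all _ fun x ↦ by positivity)]
    have := congrFun (mgf_id_gaussianReal (μ := 0) (v := 1)) t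
    simp only [mgf, id] at this
    rw [this]
    simp
  have hexp : Real.exp (1 / 2) ≤ 2 := Real.exp_le_two_of_le le_rfl
  have := measure_lt_abs_le_of_lintegral_exp_le (μ := gaussianReal 0 1) (X := id)
    (by fun_prop) (K := 2) (s := 1) one_pos zero_le_two
    (by simp only [id]; rw [h]; exact ENNReal.ofReal_le_ofReal (by simpa using hexp))
    (by simp only [id]; rw [h]; exact ENNReal.ofReal_le_ofReal (by simpa using hexp)) L
  refine this.trans (ENNReal.ofReal_le_ofReal (le_of_eq ?_))
  norm_num

/-- A variable whose exponential moments are those of a sum of `N` centred quadratic forms of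
size `b` deviates from `0` on the scale `b √N`, with exponential tails. -/
lemma measure_lt_abs_le_of_subexponential {α : Type*} {mα : MeasurableSpace α} {μ : Measure α}
    {X : α → ℝ} (hX : AEMeasurable X μ) {b N : ℝ} (hb : 0 < b) (hN : 1 ≤ N)
    (h : ∀ s : ℝ, |s| * b ≤ 1 / 10 → ∫⁻ a, ENNReal.ofReal (Real.exp (s * X a)) ∂μ ≤
      ENNReal.ofReal (Real.exp (4 * s ^ 2 * b ^ 2 * N))) (L : ℝ) :
    μ {a | L * (b * √N) < |X a|} ≤ ENNReal.ofReal (4 * Real.exp (-(L / 10))) := by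
  have hN0 : 0 < √N := Real.sqrt_pos.2 (by linarith)
  have hN1 : 1 ≤ √N := Real.one_le_sqrt.2 hN
  -- the largest `s` allowed when `N = 1`; in general it makes the exponential moment `O(1)`
  set s := 1 / (10 * (b * √N)) with hs
  have hs0 : 0 < s := by positivity
  have hsb : |s| * b ≤ 1 / 10 := by
    rw [abs_of_pos hs0, hs, div_mul_eq_mul_div, div_le_div_iff₀ (by positivity) (by norm_num)]
    nlinarith
  have hval : 4 * s ^ 2 * b ^ 2 * N = 1 / 25 := by
    rw [hs]; field_simp; rw [Real.sq_sqrt (by linarith)]; ring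
  have h1 := h s hsb
  have h2 := h (-s) (by rwa [abs_neg])
  rw [neg_sq] at h2
  rw [hval] at h1 h2
  have hK : ENNReal.ofReal (Real.exp (1 / 25)) ≤ ENNReal.ofReal 2 :=
    ENNReal.ofReal_le_ofReal (Real.exp_le_two_of_le (by norm_num))
  refine (measure_lt_abs_le_of_lintegral_exp_le hX hs0 zero_le_two (h1.trans hK) (h2.trans hK)
    (L * (b * √N))).trans (ENNReal.ofReal_le_ofReal (le_of_eq ?_))
  rw [hs]
  have : 1 / (10 * (b * √N)) * (L * (b * √N)) = L / 10 := by field_simp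
  rw [this]; norm_num

variable {E : Type*} [NormedAddCommGroup E] [InnerProductSpace ℝ E]

lemma isSymmetric_comp_self {T : E →L[ℝ] E} (hT : (T : E →ₗ[ℝ] E).IsSymmetric) :
    ((T ∘L T : E →L[ℝ] E) : E →ₗ[ℝ] E).IsSymmetric := by
  intro x y
  simpa using (hT (T x) y).trans (hT x (T y))

lemma inner_apply_comp_self {T : E →L[ℝ] E} (hT : (T : E →ₗ[ℝ] E).IsSymmetric) (x : E) :
    inner ℝ x ((T ∘L T) x) = ‖T x‖ ^ 2 := by
  rw [← real_inner_self_eq_norm_sq]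
  exact (hT x (T x)).symm

variable [FiniteDimensional ℝ E]

lemma abs_trace_le_finrank_mul_norm {T : E →L[ℝ] E} (hT : (T : E →ₗ[ℝ] E).IsSymmetric) :
    |LinearMap.trace ℝ E T| ≤ Module.finrank ℝ E * ‖T‖ := by
  rw [hT.trace_eq_sum_eigenvalues rfl]
  simp only [RCLike.ofReal_real_eq_id, id]
  refine (Finset.abs_sum_le_sum_abs _ _).trans
    ((Finset.sum_le_sum fun i _ ↦ hT.abs_eigenvalues_le_norm rfl i).trans ?_)
  simp

variable [MeasurableSpace E] [BorelSpace E]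

lemma stdGaussian_quadraticForm_lt_abs_le {T : E →L[ℝ] E} (hT : (T : E →ₗ[ℝ] E).IsSymmetric)
    {b : ℝ} (hb0 : 0 < b) (hb : ‖T‖ ≤ b) (hN : 0 < Module.finrank ℝ E) (L : ℝ) :
    stdGaussian E {g | L * (b * √(Module.finrank ℝ E)) <
      |inner ℝ g (T g) - LinearMap.trace ℝ E T|} ≤ ENNReal.ofReal (4 * Real.exp (-(L / 10))) :=
  measure_lt_abs_le_of_subexponential (by fun_prop) hb0 (by exact_mod_cast hN)
    (fun _ hs ↦ lintegral_exp_quadraticForm_le hT hb hs) L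

end Tails

section Coupling

variable {E : Type*} [NormedAddCommGroup E] [InnerProductSpace ℝ E] [FiniteDimensional ℝ E]
  [MeasurableSpace E] [BorelSpace E]

lemma coupledWalk_norm_sq_tail {T : E →L[ℝ] E} (hT : (T : E →ₗ[ℝ] E).IsSymmetric) (e : E)
    {b : ℝ} (hb0 : 0 < b) (hb : ‖T‖ ≤ b) (hN : 0 < Module.finrank ℝ E) (k : ℕ) {L : ℝ} :
    coupledWalk T e k {x | k * (L * (b ^ 2 * √(Module.finrank ℝ E))) <
      |‖T x.1‖ ^ 2 - LinearMap.trace ℝ E ((T ∘L T : E →L[ℝ] E) : E →ₗ[ℝ] E) * k|} ≤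
      ENNReal.ofReal (4 * Real.exp (-(L / 10))) := by
  set v := LinearMap.trace ℝ E ((T ∘L T : E →L[ℝ] E) : E →ₗ[ℝ] E) with hv
  have hmeas : MeasurableSet {s : E | k * (L * (b ^ 2 * √(Module.finrank ℝ E))) <
      |‖T s‖ ^ 2 - v * k|} := measurableSet_lt (by fun_prop) (by fun_prop)
  have h1 := Measure.map_apply (μ := coupledWalk T e k) measurable_fst hmeas
  rw [coupledWalk_map_fst, Measure.map_apply (by fun_prop) hmeas] at h1
  refine (h1.symm.le.trans (measure_mono ?_)).trans (stdGaussian_quadraticForm_lt_abs_le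
    (isSymmetric_comp_self hT) (b := b ^ 2) (by positivity) ?_ hN L)
  · intro g hg
    simp only [mem_preimage, mem_ofPred_eq, inner_apply_comp_self hT] at hg ⊢
    rw [map_smul, norm_smul, mul_pow, Real.norm_eq_abs, sq_abs, Real.sq_sqrt (Nat.cast_nonneg k),
      mul_comm v, ← mul_sub, abs_mul, abs_of_nonneg (Nat.cast_nonneg k)] at hg
    exact lt_of_mul_lt_mul_left hg (Nat.cast_nonneg k)
  · refine (ContinuousLinearMap.opNorm_comp_le T T).trans ?_
    rw [sq]
    exact mul_le_mul hb hb (norm_nonneg _) hb0.le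

lemma abs_sub_le_sqrt_abs_sq_sub_sq {x y : ℝ} (hx : 0 ≤ x) (hy : 0 ≤ y) :
    |x - y| ≤ √|x ^ 2 - y ^ 2| := by
  apply Real.le_sqrt_of_sq_le
  rw [sq_sub_sq, abs_mul, abs_of_nonneg (add_nonneg hx hy), sq]
  exact mul_le_mul_of_nonneg_right (abs_sub_le_of_nonneg_of_le hx (by linarith) hy (by linarith))
    (abs_nonneg _)

/-- In the coupled walk `(s, y, t)`, the quadratic form `⟨s, T s⟩` minus `t` follows `2 √(tr T²) y`.
In the step from time `k`, the two move by `2 ‖T s‖` and `2 √(k tr T²)` times the same standard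
Gaussian variable, and `‖T s‖²` concentrates at `k tr T²`. -/
lemma coupledWalk_deviation_tail {T : E →L[ℝ] E} (hT : (T : E →ₗ[ℝ] E).IsSymmetric) {e : E}
    (he : ‖e‖ = 1) {b : ℝ} (hb0 : 0 < b) (hb : ‖T‖ ≤ b) (hN : 0 < Module.finrank ℝ E) {m k : ℕ}
    (hk : k ≤ m) {L : ℝ} (hL : 1 ≤ L) :
    coupledWalk T e k {x | k * (2 * L ^ 2 * b * √m * √(√(Module.finrank ℝ E))) <
      |inner ℝ x.1 (T x.1) - x.2.2 -
        2 * √(LinearMap.trace ℝ E ((T ∘L T : E →L[ℝ] E) : E →ₗ[ℝ] E)) * x.2.1|} ≤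
      ENNReal.ofReal (k * (8 * Real.exp (-(L / 10)))) := by
  set v := LinearMap.trace ℝ E ((T ∘L T : E →L[ℝ] E) : E →ₗ[ℝ] E) with hvdef
  have hv : 0 ≤ v := by
    rw [hvdef, (isSymmetric_comp_self hT).trace_eq_sum_eigenvalues rfl]
    simp only [RCLike.ofReal_real_eq_id, id]
    refine Finset.sum_nonneg fun i _ ↦ ?_
    refine eigenvalue_nonneg_of_nonneg
      ((isSymmetric_comp_self hT).hasEigenvalue_eigenvalues rfl i) fun x ↦ ?_
    have := inner_apply_comp_self hT x
    simp only [ContinuousLinearMap.coe_coe, RCLike.re_to_real]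
    rw [this]; positivity
  set r := √(√(Module.finrank ℝ E : ℝ)) with hr
  have hr2 : r ^ 2 = √(Module.finrank ℝ E : ℝ) := Real.sq_sqrt (Real.sqrt_nonneg _)
  set D : E × ℝ × ℝ → ℝ := fun x ↦ inner ℝ x.1 (T x.1) - x.2.2 - 2 * √v * x.2.1 with hD
  have hDm : Measurable D := by fun_prop
  set a := 2 * L ^ 2 * b * √m * r with ha
  change coupledWalk T e k {x | k * a < |D x|} ≤ _
  induction k with
  | zero =>
    rw [coupledWalk, Measure.dirac_apply' _ (measurableSet_lt (by fun_prop) (by fun_prop))]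
    simp [hD]
  | succ k ih =>
    specialize ih (by omega)
    set z : (E × ℝ × ℝ) × E → ℝ := fun q ↦ inner ℝ (directionOr e (T q.1.1)) q.2 with hz
    have hmeas1 : MeasurableSet {x : E × ℝ × ℝ | (k + 1 : ℕ) * a < |D x|} :=
      measurableSet_lt (by fun_prop) (by fun_prop)
    rw [coupledWalk, Measure.map_apply (by fun_prop) hmeas1]
    have hsub : (coupledStep T e k) ⁻¹' {x | (k + 1 : ℕ) * a < |D x|} ⊆
        (Prod.fst ⁻¹' {x | k * a < |D x|} ∪
          Prod.fst ⁻¹' {x | k * (L * (b ^ 2 * √(Module.finrank ℝ E))) < |‖T x.1‖ ^ 2 - v * k|}) ∪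
          {q | L < |z q|} := by
      intro q hq
      by_contra hcon
      simp only [mem_union, mem_preimage, mem_ofPred_eq, not_or, not_lt] at hcon hq
      obtain ⟨⟨h1, h2⟩, h3⟩ := hcon
      have h4 := coupledWalk_deviation_step hT (e := e) v k hv q
      simp only at h4
      rw [show D (coupledStep T e k q) = D q.1 + 2 * (‖T q.1.1‖ - √(v * k)) * z q from h4] at hq
      have h5 : |‖T q.1.1‖ - √(v * k)| ≤ L * b * √m * r := by
        refine (abs_sub_le_sqrt_abs_sq_sub_sq (norm_nonneg _) (Real.sqrt_nonneg _)).trans ?_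
        rw [Real.sq_sqrt (by positivity)]
        apply Real.sqrt_le_iff.2
        refine ⟨by positivity, h2.trans ?_⟩
        rw [mul_pow, mul_pow, mul_pow, hr2, Real.sq_sqrt (Nat.cast_nonneg m)]
        have h6 : (k : ℝ) ≤ m := by exact_mod_cast (by omega : k ≤ m)
        have h7 : L ≤ L ^ 2 := by nlinarith
        calc (k : ℝ) * (L * (b ^ 2 * √(Module.finrank ℝ E)))
            ≤ m * (L ^ 2 * (b ^ 2 * √(Module.finrank ℝ E))) := by gcongr
          _ = _ := by ring
      have h8 : |2 * (‖T q.1.1‖ - √(v * k)) * z q| ≤ a := by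
        rw [abs_mul, abs_mul, abs_two]
        calc 2 * |‖T q.1.1‖ - √(v * k)| * |z q| ≤ 2 * (L * b * √m * r) * L := by gcongr
          _ = a := by rw [ha]; ring
      have h9 := abs_add_le (D q.1) (2 * (‖T q.1.1‖ - √(v * k)) * z q)
      push_cast at hq
      linarith
    refine (measure_mono hsub).trans ((measure_union_le _ _).trans
      (add_le_add_left (measure_union_le _ _) _ |>.trans ?_))
    have hfst : ∀ A : Set (E × ℝ × ℝ),
        ((coupledWalk T e k).prod (stdGaussian E)) (Prod.fst ⁻¹' A) ≤ coupledWalk T e k A :=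
      fun A ↦ measurePreserving_fst.measure_preimage_le A
    have hzt : ((coupledWalk T e k).prod (stdGaussian E)) {q | L < |z q|} ≤
        ENNReal.ofReal (4 * Real.exp (-(L / 10))) := by
      have hmz : MeasurableSet {q | L < |z q|} := measurableSet_lt (by fun_prop) (by fun_prop)
      have hbd : ∀ x, (stdGaussian E) (Prod.mk x ⁻¹' {q | L < |z q|}) ≤
          ENNReal.ofReal (4 * Real.exp (-(L / 10))) := by
        intro x
        have hlaw := stdGaussian_map_mul_inner (x := directionOr e (T x.1)) (c := 1)
        rw [norm_directionOr he] at hlaw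
        simp only [mul_one, one_pow, one_mul, Real.toNNReal_one] at hlaw
        have := Measure.map_apply (μ := stdGaussian E)
          (f := fun g ↦ inner ℝ (directionOr e (T x.1)) g) (by fun_prop) (s := {y : ℝ | L < |y|})
          (measurableSet_lt (by fun_prop) (by fun_prop))
        rw [hlaw] at this
        refine (this.symm.le.trans (gaussianReal_lt_abs_le L)).trans ?_
        apply ENNReal.ofReal_le_ofReal
        gcongr; linarith
      rw [Measure.prod_apply hmz]
      refine (lintegral_mono hbd).trans ?_
      simp
    refine (add_le_add (add_le_add ((hfst _).trans ih)
      ((hfst _).trans (coupledWalk_norm_sq_tail hT e hb0 hb hN k))) hzt).trans ?_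
    rw [← ENNReal.ofReal_add (by positivity) (by positivity),
      ← ENNReal.ofReal_add (by positivity) (by positivity)]
    apply ENNReal.ofReal_le_ofReal
    apply le_of_eq
    push_cast; ring

end Coupling

/-! ### Coupling of a Gaussian quadratic form with a Gaussian variable -/

section Coupling

variable {E : Type*} [NormedAddCommGroup E] [InnerProductSpace ℝ E] [FiniteDimensional ℝ E]
  [MeasurableSpace E] [BorelSpace E]

lemma coupledWalk_trace_tail {T : E →L[ℝ] E} (hT : (T : E →ₗ[ℝ] E).IsSymmetric) (e : E)
    {b : ℝ} (hb0 : 0 < b) (hb : ‖T‖ ≤ b) (hN : 0 < Module.finrank ℝ E) {m : ℕ} (hm : 0 < m)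
    (L : ℝ) :
    coupledWalk T e m {x | L * (b * √(m * Module.finrank ℝ E)) <
      |x.2.2 - m * LinearMap.trace ℝ E T|} ≤ ENNReal.ofReal (4 * Real.exp (-(L / 10))) := by
  refine measure_lt_abs_le_of_subexponential (N := m * Module.finrank ℝ E) (by fun_prop) hb0
    (by exact_mod_cast Nat.mul_pos hm hN) (fun s hs ↦ ?_) L
  refine (lintegral_exp_coupledWalk_le hT e hb hs m).trans (le_of_eq ?_)
  congr 2; ring

/-- A centred quadratic form of a standard Gaussian vector can be coupled with a Gaussian variable
of the same variance `2 tr T²`; the number `m` of steps of the coupled walk is free. With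
`N = dim E`, the error is of order `b √N (m^{-1/2} + m^{1/2} N^{-1/4})`, up to logarithms. -/
theorem exists_coupling_quadraticForm {T : E →L[ℝ] E} (hT : (T : E →ₗ[ℝ] E).IsSymmetric)
    {b : ℝ} (hb0 : 0 < b) (hb : ‖T‖ ≤ b) (hN : 0 < Module.finrank ℝ E) {m : ℕ} (hm : 0 < m) :
    ∃ ρ : Measure (E × ℝ), ρ.map Prod.fst = stdGaussian E ∧ ρ.map Prod.snd = gaussianReal 0 1 ∧
      ∀ L : ℝ, 1 ≤ L → ρ {x | L ^ 2 * b * (3 * √(Module.finrank ℝ E) / √m +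
          2 * √m * √(√(Module.finrank ℝ E))) <
        |inner ℝ x.1 (T x.1) - LinearMap.trace ℝ E T -
          √(2 * LinearMap.trace ℝ E ((T ∘L T : E →L[ℝ] E) : E →ₗ[ℝ] E)) * x.2|} ≤
        ENNReal.ofReal (16 * m * Real.exp (-(L / 10))) := by
  obtain ⟨e, he⟩ : ∃ e : E, ‖e‖ = 1 := by
    have : Nontrivial E := Module.nontrivial_of_finrank_pos hN
    exact exists_norm_eq E zero_le_one
  set N : ℝ := (Module.finrank ℝ E : ℝ) with hNdef
  have hN0 : 0 < N := by rw [hNdef]; exact_mod_cast hN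
  set v := LinearMap.trace ℝ E ((T ∘L T : E →L[ℝ] E) : E →ₗ[ℝ] E) with hv
  have hvN : v ≤ N * b ^ 2 := by
    refine (le_abs_self v).trans
      ((abs_trace_le_finrank_mul_norm (isSymmetric_comp_self hT)).trans ?_)
    refine mul_le_mul_of_nonneg_left ?_ hN0.le
    refine (ContinuousLinearMap.opNorm_comp_le T T).trans ?_
    rw [sq]
    exact mul_le_mul hb hb (norm_nonneg _) hb0.le
  have hm0 : (0 : ℝ) < m := by exact_mod_cast hm
  have hsm : 0 < √(m : ℝ) := Real.sqrt_pos.2 hm0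
  have hsm2 : √(m : ℝ) ^ 2 = m := Real.sq_sqrt hm0.le
  -- `y` has variance `m (m - 1) / 2`, so `(√2 / m) y` has variance `1 - 1 / m`, which an
  -- independent Gaussian variable of variance `1 / m` completes to one
  set P := (coupledWalk T e m).prod (gaussianReal 0 1) with hP
  set F : (E × ℝ × ℝ) × ℝ → E × ℝ := fun q ↦
    ((√(m : ℝ))⁻¹ • q.1.1, √2 / m * q.1.2.1 + (√(m : ℝ))⁻¹ * q.2) with hF
  have hFm : Measurable F := by fun_prop
  refine ⟨P.map F, ?_, ?_, ?_⟩
  · rw [Measure.map_map (by fun_prop) hFm]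
    have : Prod.fst ∘ F = (fun s : E ↦ (√(m : ℝ))⁻¹ • s) ∘ Prod.fst ∘ Prod.fst := rfl
    rw [this, ← Measure.map_map (by fun_prop) (by fun_prop),
      ← Measure.map_map (by fun_prop) (by fun_prop), measurePreserving_fst.map_eq,
      coupledWalk_map_fst, Measure.map_map (by fun_prop) (by fun_prop)]
    have : (fun s : E ↦ (√(m : ℝ))⁻¹ • s) ∘ (fun g ↦ √(m : ℝ) • g) = id := by
      ext g
      simp [smul_smul, inv_mul_cancel₀ hsm.ne']
    rw [this, Measure.map_id]
  · rw [Measure.map_map (by fun_prop) hFm]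
    have h1 : (coupledWalk T e m).map (fun x ↦ √2 / m * x.2.1) =
        gaussianReal 0 (1 - (m : ℝ)⁻¹).toNNReal := by
      have : (fun x : E × ℝ × ℝ ↦ √2 / m * x.2.1) = (fun y ↦ √2 / m * y) ∘ fun x ↦ x.2.1 := rfl
      rw [this, ← Measure.map_map (by fun_prop) (by fun_prop), coupledWalk_map_snd T he,
        gaussianReal_map_const_mul, mul_zero]
      congr 1
      apply NNReal.coe_injective
      have hm1 : (m : ℝ)⁻¹ ≤ 1 := inv_le_one_of_one_le₀ (by exact_mod_cast hm)
      have hsum : (∑ r ∈ Finset.range m, (r : ℝ)) * 2 = m * (m - 1) := by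
        have := Finset.sum_range_id_mul_two m
        have h2 : ((∑ r ∈ Finset.range m, r : ℕ) : ℝ) * 2 = m * ((m - 1 : ℕ) : ℝ) := by
          exact_mod_cast this
        rw [Nat.cast_sub hm] at h2
        push_cast at h2
        exact h2
      rw [Real.coe_toNNReal _ (by linarith)]
      push_cast
      rw [div_pow, Real.sq_sqrt zero_le_two]
      field_simp
      linarith
    have h2 : (gaussianReal 0 1).map (fun x ↦ (√(m : ℝ))⁻¹ * x) =
        gaussianReal 0 ((m : ℝ)⁻¹).toNNReal := by
      rw [gaussianReal_map_const_mul, mul_zero]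
      congr 1
      apply NNReal.coe_injective
      rw [Real.coe_toNNReal _ (by positivity)]
      simp [hsm2]
    have : Prod.snd ∘ F = (fun z : ℝ × ℝ ↦ z.1 + z.2) ∘
        Prod.map (fun x : E × ℝ × ℝ ↦ √2 / m * x.2.1) (fun x ↦ (√(m : ℝ))⁻¹ * x) := rfl
    rw [this, ← Measure.map_map (by fun_prop) (by fun_prop),
      ← Measure.map_prod_map _ _ (by fun_prop) (by fun_prop), h1, h2]
    have := gaussianReal_conv_gaussianReal (m₁ := 0) (m₂ := 0) (v₁ := (1 - (m : ℝ)⁻¹).toNNReal)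
      (v₂ := ((m : ℝ)⁻¹).toNNReal)
    rw [Measure.conv] at this
    rw [this, add_zero, ← Real.toNNReal_add
      (sub_nonneg.2 (inv_le_one_of_one_le₀ (by exact_mod_cast hm))) (by positivity)]
    simp
  · intro L hL
    set D : E × ℝ × ℝ → ℝ := fun x ↦ inner ℝ x.1 (T x.1) - x.2.2 - 2 * √v * x.2.1 with hD
    rw [Measure.map_apply hFm (measurableSet_lt (by fun_prop) (by fun_prop))]
    have hsub : F ⁻¹' {x | L ^ 2 * b * (3 * √N / √m + 2 * √m * √(√N)) <
        |inner ℝ x.1 (T x.1) - LinearMap.trace ℝ E T - √(2 * v) * x.2|} ⊆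
        (Prod.fst ⁻¹' {x | m * (2 * L ^ 2 * b * √m * √(√N)) < |D x|} ∪
          Prod.fst ⁻¹' {x | L * (b * √(m * N)) < |x.2.2 - m * LinearMap.trace ℝ E T|}) ∪
          Prod.snd ⁻¹' {x | L < |x|} := by
      intro q hq
      by_contra hcon
      simp only [mem_union, mem_preimage, mem_ofPred_eq, not_or, not_lt] at hcon hq
      obtain ⟨⟨h1, h2⟩, h3⟩ := hcon
      have hLL : L ≤ L ^ 2 := by nlinarith
      have hid : inner ℝ (F q).1 (T (F q).1) - LinearMap.trace ℝ E T - √(2 * v) * (F q).2 =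
          D q.1 / m + (q.1.2.2 - m * LinearMap.trace ℝ E T) / m -
            √(2 * v) * (√(m : ℝ))⁻¹ * q.2 := by
        simp only [hF, hD, map_smul, inner_smul_left, inner_smul_right, Real.sqrt_mul zero_le_two]
        have h22 : √(2 : ℝ) * √2 = 2 := Real.mul_self_sqrt zero_le_two
        have h23 : (√(m : ℝ))⁻¹ * (√(m : ℝ))⁻¹ = (m : ℝ)⁻¹ := by
          rw [← mul_inv, ← sq, hsm2]
        simp only [RCLike.conj_to_real, ← mul_assoc, h23]
        field_simp
        linear_combination (-(√(m : ℝ) * √v * q.1.2.1)) * h22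
      have b1 : |D q.1 / m| ≤ 2 * L ^ 2 * b * √m * √(√N) := by
        rw [abs_div, abs_of_pos hm0, div_le_iff₀ hm0]
        linarith
      have b2 : |(q.1.2.2 - m * LinearMap.trace ℝ E T) / m| ≤ L ^ 2 * b * (√N / √m) := by
        rw [abs_div, abs_of_pos hm0, div_le_iff₀ hm0]
        refine h2.trans ?_
        rw [Real.sqrt_mul hm0.le]
        calc L * (b * (√m * √N)) ≤ L ^ 2 * (b * (√m * √N)) := by gcongr
          _ = L ^ 2 * b * (√N / √m) * √m ^ 2 := by field_simp
          _ = _ := by rw [hsm2]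
      have b3 : |√(2 * v) * (√(m : ℝ))⁻¹ * q.2| ≤ L ^ 2 * b * (2 * √N / √m) := by
        have hs : √(2 * v) ≤ 2 * b * √N := by
          apply Real.sqrt_le_iff.2
          refine ⟨by positivity, ?_⟩
          rw [mul_pow, mul_pow, Real.sq_sqrt hN0.le]
          nlinarith [mul_pos hN0 (pow_pos hb0 2)]
        rw [abs_mul, abs_mul, abs_of_nonneg (Real.sqrt_nonneg _), abs_of_pos (inv_pos.2 hsm)]
        calc √(2 * v) * (√(m : ℝ))⁻¹ * |q.2| ≤ (2 * b * √N) * (√(m : ℝ))⁻¹ * L ^ 2 := by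
              gcongr
              exact h3.trans hLL
          _ = _ := by ring
      rw [hid] at hq
      have h4 := abs_sub (D q.1 / m + (q.1.2.2 - m * LinearMap.trace ℝ E T) / m)
        (√(2 * v) * (√(m : ℝ))⁻¹ * q.2)
      have h5 := abs_add_le (D q.1 / m) ((q.1.2.2 - m * LinearMap.trace ℝ E T) / m)
      have h6 : L ^ 2 * b * (3 * √N / √m + 2 * √m * √(√N)) = L ^ 2 * b * (2 * √N / √m) +
          L ^ 2 * b * (√N / √m) + 2 * L ^ 2 * b * √m * √(√N) := by ring
      linarith
    refine (measure_mono hsub).trans ((measure_union_le _ _).trans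
      (add_le_add_left (measure_union_le _ _) _ |>.trans ?_))
    refine (add_le_add (add_le_add
      ((measurePreserving_fst.measure_preimage_le _).trans
        (coupledWalk_deviation_tail hT he hb0 hb hN le_rfl hL))
      ((measurePreserving_fst.measure_preimage_le _).trans
        (coupledWalk_trace_tail hT e hb0 hb hN hm L)))
      ((measurePreserving_snd.measure_preimage_le _).trans (gaussianReal_lt_abs_le L))).trans ?_
    rw [← ENNReal.ofReal_add (by positivity) (by positivity),
      ← ENNReal.ofReal_add (by positivity) (by positivity)]
    apply ENNReal.ofReal_le_ofReal
    have h7 : Real.exp (-L) ≤ Real.exp (-(L / 10)) := Real.exp_le_exp.2 (by linarith)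
    have h8 : (1 : ℝ) ≤ m := by exact_mod_cast hm
    nlinarith [Real.exp_pos (-(L / 10))]

end Coupling

/-! ### Realisation of couplings on an extension of the probability space -/

section Transfer

open unitInterval

/-- A coupling can be realised by a measurable function of its first component and of an
independent uniform variable. -/
lemma exists_measurable_prod_map_eq {X Y : Type*} [MeasurableSpace X] [MeasurableSpace Y]
    [StandardBorelSpace Y] [Nonempty Y] (ρ : Measure (X × Y)) [IsProbabilityMeasure ρ] :
    ∃ G : X × I → Y, Measurable G ∧
      ((ρ.map Prod.fst).prod (volume : Measure I)).map (fun q ↦ (q.1, G q)) = ρ := by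
  obtain ⟨f, hf, hfκ⟩ := Kernel.exists_measurable_map_eq_unitInterval ρ.condKernel
  refine ⟨Function.uncurry f, hf, ?_⟩
  have hmeas : Measurable fun q : X × I ↦ (q.1, Function.uncurry f q) := by fun_prop
  have hprob : IsProbabilityMeasure (ρ.map Prod.fst) :=
    Measure.isProbabilityMeasure_map (by fun_prop)
  ext s hs
  rw [Measure.map_apply hmeas hs, Measure.prod_apply (hmeas hs)]
  conv_rhs => rw [← ρ.disintegrate ρ.condKernel, Measure.compProd_apply hs]
  refine lintegral_congr fun a ↦ ?_
  rw [← hfκ a, Measure.map_apply (by fun_prop) (measurable_prodMk_left hs)]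
  rfl

/-- Given, for every `n`, independent variables `w n i` and couplings `ρ n i` of their laws with
laws on `Y`, an extension of the probability space carries, for every `n`, independent variables
`φ n i` such that `(w n i, φ n i)` has law `ρ n i`. The extension consists of one independent
uniform variable for each pair `(n, i)`. -/
theorem exists_extension_of_couplings {Ω : Type u} [MeasurableSpace Ω] (Pr : Measure Ω)
    [IsProbabilityMeasure Pr] {X : ℕ → Type*} [∀ n, MeasurableSpace (X n)] {Y : Type*}
    [MeasurableSpace Y] [StandardBorelSpace Y] [Nonempty Y] (w : (n : ℕ) → Fin n → Ω → X n)
    (hw : ∀ n i, AEMeasurable (w n i) Pr) (hind : ∀ n, iIndepFun (w n) Pr)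
    (ρ : (n : ℕ) → Fin n → Measure (X n × Y)) [∀ n i, IsProbabilityMeasure (ρ n i)]
    (hρ : ∀ n i, (ρ n i).map Prod.fst = Pr.map (w n i)) :
    ∃ (Ω' : Type u) (_ : MeasurableSpace Ω') (Pr' : Measure Ω') (π : Ω' → Ω)
      (φ : (n : ℕ) → Fin n → Ω' → Y), IsProbabilityMeasure Pr' ∧ MeasurePreserving π Pr' Pr ∧
      (∀ n i, AEMeasurable (fun ω ↦ (w n i (π ω), φ n i ω)) Pr') ∧
      (∀ n, iIndepFun (φ n) Pr') ∧
      ∀ n i, Pr'.map (fun ω ↦ (w n i (π ω), φ n i ω)) = ρ n i := by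
  choose G hG hGρ using fun n i ↦ exists_measurable_prod_map_eq (ρ n i)
  set U : (n : ℕ) → Measure (Fin n → I) := fun n ↦ Measure.pi fun _ ↦ (volume : Measure I) with hU
  set Q := Measure.infinitePi U with hQ
  have hμ : ∀ n i, IsProbabilityMeasure (Pr.map (w n i)) := fun n i ↦
    Measure.isProbabilityMeasure_map (hw n i)
  -- the pairs of a noise variable and its uniform variable are independent
  set pr : (n : ℕ) → Fin n → Ω × ((n : ℕ) → Fin n → I) → X n × I :=
    fun n i ω ↦ (w n i ω.1, ω.2 n i) with hpr
  have hprm : ∀ n i, AEMeasurable (pr n i) (Pr.prod Q) := fun n i ↦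
    ((hw n i).comp_fst).prodMk (by fun_prop)
  have hlaw : ∀ n, (Pr.prod Q).map (fun ω i ↦ pr n i ω) =
      Measure.pi fun i ↦ (Pr.map (w n i)).prod (volume : Measure I) := by
    intro n
    have h1 : (Pr.map fun ω i ↦ w n i ω) = Measure.pi fun i ↦ Pr.map (w n i) :=
      (iIndepFun_iff_map_fun_eq_pi_map (hw n)).1 (hind n)
    have h2 : Q.map (fun x ↦ x n) = U n := Measure.infinitePi_map_eval U n
    have hwm : AEMeasurable (fun ω i ↦ w n i ω) Pr := aemeasurable_pi_lambda _ (hw n)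
    have h4 : (Pr.prod Q).map (Prod.map (fun ω i ↦ w n i ω) fun x ↦ x n) =
        (Measure.pi fun i ↦ Pr.map (w n i)).prod (U n) := by
      have hae : Prod.map (fun ω i ↦ w n i ω) (fun x : (n : ℕ) → Fin n → I ↦ x n) =ᵐ[Pr.prod Q]
          Prod.map (hwm.mk _) fun x ↦ x n := by
        filter_upwards [Measure.quasiMeasurePreserving_fst.ae_eq_comp hwm.ae_eq_mk] with ω hω
        exact Prod.ext hω rfl
      rw [Measure.map_congr hae, ← Measure.map_prod_map _ _ hwm.measurable_mk (by fun_prop),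
        ← Measure.map_congr hwm.ae_eq_mk, h1, h2]
    have h5 := (measurePreserving_arrowProdEquivProdArrow (X n) I (Fin n)
      (fun i ↦ Pr.map (w n i)) (fun _ ↦ (volume : Measure I))).symm
    rw [← h5.map_eq]
    change _ = Measure.map _ ((Measure.pi fun i ↦ Pr.map (w n i)).prod (U n))
    rw [← h4, AEMeasurable.map_map_of_aemeasurable (by fun_prop)]
    · rfl
    · exact (hwm.comp_fst).prodMk (by fun_prop)
  have hlaw1 : ∀ n i, (Pr.prod Q).map (pr n i) = (Pr.map (w n i)).prod (volume : Measure I) := by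
    intro n i
    rw [← (measurePreserving_eval (fun i ↦ (Pr.map (w n i)).prod (volume : Measure I)) i).map_eq,
      ← hlaw n, AEMeasurable.map_map_of_aemeasurable (measurable_pi_apply i).aemeasurable
        (aemeasurable_pi_lambda _ (hprm n))]
    rfl
  refine ⟨Ω × ((n : ℕ) → Fin n → I), inferInstance, Pr.prod Q, Prod.fst,
    fun n i ω ↦ G n i (pr n i ω), inferInstance, measurePreserving_fst, ?_, ?_, ?_⟩
  · intro n i
    exact ((hw n i).comp_fst).prodMk ((hG n i).comp_aemeasurable (hprm n i))
  · intro n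
    have : iIndepFun (pr n) (Pr.prod Q) := by
      rw [iIndepFun_iff_map_fun_eq_pi_map (hprm n), hlaw]
      simp_rw [hlaw1]
    exact this.comp (fun i ↦ G n i) (fun i ↦ hG n i)
  · intro n i
    have h := hGρ n i
    rw [hρ, ← hlaw1, AEMeasurable.map_map_of_aemeasurable
      (measurable_fst.prodMk (hG n i)).aemeasurable (hprm n i)] at h
    exact h

end Transfer

/-! ### Multivariate Gaussian vectors -/

section MultivariateGaussian

open Matrix
open scoped MatrixOrder

variable {p : ℕ} {S : Matrix (Fin p) (Fin p) ℝ}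

lemma Matrix.PosSemidef.isSymmetric_toEuclideanCLM (hS : S.PosSemidef) :
    ((toEuclideanCLM (n := Fin p) (𝕜 := ℝ) S :
      EuclideanSpace ℝ (Fin p) →L[ℝ] EuclideanSpace ℝ (Fin p)) :
      EuclideanSpace ℝ (Fin p) →ₗ[ℝ] EuclideanSpace ℝ (Fin p)).IsSymmetric :=
  (Matrix.isSymmetric_toEuclideanLin_iff).2 hS.1

lemma trace_toEuclideanCLM (S : Matrix (Fin p) (Fin p) ℝ) :
    LinearMap.trace ℝ (EuclideanSpace ℝ (Fin p)) (toEuclideanCLM (n := Fin p) (𝕜 := ℝ) S) =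
      S.trace := by
  have := LinearMap.trace_eq_matrix_trace ℝ (EuclideanSpace.basisFun (Fin p) ℝ).toBasis
    (toEuclideanCLM (n := Fin p) (𝕜 := ℝ) S)
  rw [this]
  congr 1
  ext i j
  simp [LinearMap.toMatrix_apply]

lemma trace_toEuclideanCLM_comp_self (S : Matrix (Fin p) (Fin p) ℝ) :
    LinearMap.trace ℝ (EuclideanSpace ℝ (Fin p))
      ((toEuclideanCLM (n := Fin p) (𝕜 := ℝ) S ∘L toEuclideanCLM (n := Fin p) (𝕜 := ℝ) S :
        EuclideanSpace ℝ (Fin p) →L[ℝ] EuclideanSpace ℝ (Fin p))) = (S * S).trace := by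
  rw [← trace_toEuclideanCLM, map_mul]
  rfl

lemma norm_sq_toEuclideanCLM_sqrt (hS : S.PosSemidef) (g : EuclideanSpace ℝ (Fin p)) :
    ‖toEuclideanCLM (n := Fin p) (𝕜 := ℝ) (CFC.sqrt S) g‖ ^ 2 =
      inner ℝ g (toEuclideanCLM (n := Fin p) (𝕜 := ℝ) S g) := by
  have h0 : (CFC.sqrt S).PosSemidef := CFC.sqrt_nonneg S |>.posSemidef
  have h1 := inner_apply_comp_self h0.isSymmetric_toEuclideanCLM g
  rw [← h1]
  congr 1
  have : CFC.sqrt S * CFC.sqrt S = S := CFC.sqrt_mul_sqrt_self S hS.nonneg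
  conv_rhs => rw [← this, map_mul]
  rfl

end MultivariateGaussian

section MultivariateGaussian

open Matrix
open scoped MatrixOrder

variable {p : ℕ} {S : Matrix (Fin p) (Fin p) ℝ}

lemma multivariateGaussian_zero_eq_map (S : Matrix (Fin p) (Fin p) ℝ) :
    multivariateGaussian 0 S = (stdGaussian (EuclideanSpace ℝ (Fin p))).map
      (toEuclideanCLM (n := Fin p) (𝕜 := ℝ) (CFC.sqrt S)) := by
  rw [multivariateGaussian]
  congr 1
  ext1 x
  rw [zero_add]

lemma integral_norm_sq_multivariateGaussian (hS : S.PosSemidef) :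
    ∫ x, ‖x‖ ^ 2 ∂(multivariateGaussian 0 S) = S.trace := by
  have hmem : ∀ i, MemLp (fun x : EuclideanSpace ℝ (Fin p) ↦ x i) 2 (multivariateGaussian 0 S) := by
    intro i
    have := (measurePreserving_eval_multivariateGaussian (μ := 0) hS (i := i))
    exact (memLp_id_gaussianReal' 2 (by simp)).comp_measurePreserving this
  simp_rw [EuclideanSpace.real_norm_sq_eq]
  rw [integral_finsetSum _ fun i _ ↦ (hmem i).integrable_sq, Matrix.trace]
  refine Finset.sum_congr rfl fun i _ ↦ ?_
  have hv := variance_eval_multivariateGaussian (μ := 0) hS i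
  have hmean : ∫ x, x i ∂(multivariateGaussian 0 S) = 0 := by
    have := (measurePreserving_eval_multivariateGaussian (μ := 0) hS (i := i)).map_eq
    rw [← integral_map (φ := fun x : EuclideanSpace ℝ (Fin p) ↦ x i) (f := fun y ↦ y)
      (by fun_prop) (by fun_prop), this, integral_id_gaussianReal]
    rfl
  rw [variance_of_integral_eq_zero (hmem i).aestronglyMeasurable.aemeasurable hmean] at hv
  rw [hv, diag_apply]

lemma lintegral_exp_norm_sq_multivariateGaussian_le (hS : S.PosSemidef) {b s : ℝ}
    (hb : ‖toEuclideanCLM (n := Fin p) (𝕜 := ℝ) S‖ ≤ b) (hs : |s| * b ≤ 1 / 10) :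
    ∫⁻ x, ENNReal.ofReal (Real.exp (s * (‖x‖ ^ 2 - S.trace))) ∂(multivariateGaussian 0 S) ≤
      ENNReal.ofReal (Real.exp (4 * s ^ 2 * b ^ 2 * p)) := by
  rw [multivariateGaussian_zero_eq_map, lintegral_map (by fun_prop) (by fun_prop)]
  simp_rw [norm_sq_toEuclideanCLM_sqrt hS]
  have := lintegral_exp_quadraticForm_le hS.isSymmetric_toEuclideanCLM hb hs
  rwa [trace_toEuclideanCLM, finrank_euclideanSpace_fin] at this

lemma trace_le_of_norm_toEuclideanCLM_le (hS : S.PosSemidef) {b : ℝ}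
    (hb : ‖toEuclideanCLM (n := Fin p) (𝕜 := ℝ) S‖ ≤ b) : S.trace ≤ p * b := by
  have := abs_trace_le_finrank_mul_norm hS.isSymmetric_toEuclideanCLM
  rw [trace_toEuclideanCLM, finrank_euclideanSpace_fin] at this
  exact (le_abs_self _).trans (this.trans (by gcongr))

lemma lintegral_exp_inner_multivariateGaussian_le (hS : S.PosSemidef) {b : ℝ}
    (hb : ‖toEuclideanCLM (n := Fin p) (𝕜 := ℝ) S‖ ≤ b) (r : ℝ) (u : EuclideanSpace ℝ (Fin p)) :
    ∫⁻ x, ENNReal.ofReal (Real.exp (r * inner ℝ u x)) ∂(multivariateGaussian 0 S) ≤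
      ENNReal.ofReal (Real.exp (r ^ 2 * b * ‖u‖ ^ 2 / 2)) := by
  set A := toEuclideanCLM (n := Fin p) (𝕜 := ℝ) (CFC.sqrt S) with hA
  have h0 : (CFC.sqrt S).PosSemidef := (CFC.sqrt_nonneg S).posSemidef
  have hAu : ‖A u‖ ^ 2 ≤ b * ‖u‖ ^ 2 := by
    rw [hA, norm_sq_toEuclideanCLM_sqrt hS]
    calc _ ≤ ‖u‖ * ‖toEuclideanCLM (n := Fin p) (𝕜 := ℝ) S u‖ := real_inner_le_norm _ _
      _ ≤ ‖u‖ * (b * ‖u‖) := by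
          gcongr
          exact ContinuousLinearMap.le_of_opNorm_le _ hb _
      _ = _ := by ring
  have h1 : ∀ g, inner ℝ u (A g) = 1 * inner ℝ (A u) g := fun g ↦ by
    rw [one_mul]; exact (h0.isSymmetric_toEuclideanCLM u g).symm
  rw [multivariateGaussian_zero_eq_map, lintegral_map (by fun_prop) (by fun_prop)]
  simp_rw [← hA, h1]
  have h2 := lintegral_map (μ := stdGaussian (EuclideanSpace ℝ (Fin p)))
    (f := fun y : ℝ ↦ ENNReal.ofReal (Real.exp (r * y))) (g := fun g ↦ 1 * inner ℝ (A u) g)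
    (by fun_prop) (by fun_prop)
  rw [← h2, stdGaussian_map_mul_inner, one_mul,
    ← ofReal_integral_eq_lintegral_ofReal (integrable_exp_mul_gaussianReal r)
      (ae_of_all _ fun x ↦ by positivity)]
  apply ENNReal.ofReal_le_ofReal
  have h3 := congrFun (mgf_id_gaussianReal (μ := 0) (v := (‖A u‖ ^ 2).toNNReal)) r
  simp only [mgf, id] at h3
  rw [h3, Real.exp_le_exp, Real.coe_toNNReal _ (by positivity)]
  nlinarith [mul_le_mul_of_nonneg_left hAu (sq_nonneg r)]

/-- The quadratic form coupling, for the noise vectors: `√p (‖w‖² - tr C / p)` against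
`√((2 / p) tr C²) φ`. -/
theorem exists_coupling_norm_sq {C : Matrix (Fin p) (Fin p) ℝ} (hC : C.PosSemidef) (hp : 0 < p)
    {B : ℝ} (hB0 : 0 < B) (hB : ‖toEuclideanCLM (n := Fin p) (𝕜 := ℝ) C‖ ≤ B)
    {m : ℕ} (hm : 0 < m) :
    ∃ ρ : Measure (EuclideanSpace ℝ (Fin p) × ℝ),
      ρ.map Prod.fst = multivariateGaussian 0 ((p : ℝ)⁻¹ • C) ∧
      ρ.map Prod.snd = gaussianReal 0 1 ∧
      ∀ L : ℝ, 1 ≤ L → ρ {x | L ^ 2 * B * (3 / √m + 2 * √m / √(√p)) <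
        |√p * (‖x.1‖ ^ 2 - ((p : ℝ)⁻¹ • C).trace) - √(2 / p * (C * C).trace) * x.2|} ≤
        ENNReal.ofReal (16 * m * Real.exp (-(L / 10))) := by
  have hp0 : (0 : ℝ) < p := by exact_mod_cast hp
  have hsp : 0 < √(p : ℝ) := Real.sqrt_pos.2 hp0
  have hssp : 0 < √(√(p : ℝ)) := Real.sqrt_pos.2 hsp
  have hsp2 : √(p : ℝ) ^ 2 = p := Real.sq_sqrt hp0.le
  have hssp2 : √(√(p : ℝ)) ^ 2 = √p := Real.sq_sqrt hsp.le
  set S := (p : ℝ)⁻¹ • C with hS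
  have hSp : S.PosSemidef := hC.smul (inv_nonneg.2 hp0.le)
  have hSB : ‖toEuclideanCLM (n := Fin p) (𝕜 := ℝ) S‖ ≤ B / p := by
    rw [hS, map_smul, norm_smul, norm_inv, Real.norm_eq_abs, abs_of_pos hp0, div_eq_inv_mul]
    gcongr
  obtain ⟨ρ, h1, h2, h3⟩ := exists_coupling_quadraticForm hSp.isSymmetric_toEuclideanCLM
    (b := B / p) (by positivity) hSB (by rwa [finrank_euclideanSpace_fin]) hm
  rw [trace_toEuclideanCLM, trace_toEuclideanCLM_comp_self, finrank_euclideanSpace_fin] at h3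
  set A := toEuclideanCLM (n := Fin p) (𝕜 := ℝ) (CFC.sqrt S) with hA
  set F : EuclideanSpace ℝ (Fin p) × ℝ → EuclideanSpace ℝ (Fin p) × ℝ := fun x ↦ (A x.1, x.2)
    with hF
  have hFm : Measurable F := by fun_prop
  refine ⟨ρ.map F, ?_, ?_, fun L hL ↦ ?_⟩
  · rw [Measure.map_map (by fun_prop) hFm, multivariateGaussian_zero_eq_map, ← h1,
      Measure.map_map (by fun_prop) (by fun_prop)]
    rfl
  · rw [Measure.map_map (by fun_prop) hFm, ← h2]
    rfl
  · rw [Measure.map_apply hFm (measurableSet_lt (by fun_prop) (by fun_prop))]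
    refine (measure_mono ?_).trans (h3 L hL)
    intro x hx
    simp only [mem_preimage, mem_ofPred_eq, hF] at hx ⊢
    rw [hA, norm_sq_toEuclideanCLM_sqrt hSp] at hx
    have e1 : √(2 / p * (C * C).trace) = √p * √(2 * (S * S).trace) := by
      rw [← Real.sqrt_mul hp0.le, hS]
      congr 1
      simp only [smul_mul_smul_comm, trace_smul, smul_eq_mul]
      field_simp
    rw [e1, mul_assoc (√(p : ℝ)), ← mul_sub, abs_mul, abs_of_pos hsp] at hx
    have e2 : L ^ 2 * B * (3 / √m + 2 * √m / √(√p)) =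
        √p * (L ^ 2 * (B / p) * (3 * √p / √m + 2 * √m * √(√p))) := by
      rw [← hsp2]
      have : √(√(√(p : ℝ) ^ 2)) = √(√(p : ℝ)) := by rw [Real.sqrt_sq hsp.le]
      rw [this, Real.sqrt_sq hsp.le]
      have hsm : 0 < √(m : ℝ) := Real.sqrt_pos.2 (by exact_mod_cast hm)
      generalize √(√(p : ℝ)) = r at *
      rw [← hssp2]
      field_simp
    rw [e2] at hx
    exact lt_of_mul_lt_mul_left hx hsp.le

end MultivariateGaussian

/-! ### Tail bounds for independent Gaussian vectors -/

section ProductTails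

open Matrix

variable {p n : ℕ} {S : Fin n → Matrix (Fin p) (Fin p) ℝ} {b : ℝ}

lemma measurePreserving_eval_pi_multivariateGaussian (i : Fin n) :
    MeasurePreserving (fun x : Fin n → EuclideanSpace ℝ (Fin p) ↦ x i)
      (Measure.pi fun i ↦ multivariateGaussian 0 (S i)) (multivariateGaussian 0 (S i)) :=
  measurePreserving_eval (fun i ↦ multivariateGaussian 0 (S i)) i

lemma pi_norm_sq_tail (hS : ∀ i, (S i).PosSemidef) (hb0 : 0 < b) (hp : 0 < p)
    (hb : ∀ i, ‖toEuclideanCLM (n := Fin p) (𝕜 := ℝ) (S i)‖ ≤ b) (i : Fin n) (L : ℝ) :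
    (Measure.pi fun i ↦ multivariateGaussian 0 (S i))
      {x | L * (b * √p) < |‖x i‖ ^ 2 - (S i).trace|} ≤
      ENNReal.ofReal (4 * Real.exp (-(L / 10))) :=
  ((measurePreserving_eval_pi_multivariateGaussian (S := S) i).measure_preimage_le
    {y | L * (b * √p) < |‖y‖ ^ 2 - (S i).trace|}).trans
    (measure_lt_abs_le_of_subexponential (by fun_prop) hb0 (by exact_mod_cast hp)
      (fun _ hs ↦ lintegral_exp_norm_sq_multivariateGaussian_le (hS i) (hb i) hs) L)

lemma pi_inner_const_tail (hS : ∀ i, (S i).PosSemidef) (hb0 : 0 < b)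
    (hb : ∀ i, ‖toEuclideanCLM (n := Fin p) (𝕜 := ℝ) (S i)‖ ≤ b) (i : Fin n)
    {u : EuclideanSpace ℝ (Fin p)} {R : ℝ} (hR : 0 < R) (hu : ‖u‖ ≤ R) {L : ℝ} (hL : 0 ≤ L) :
    (Measure.pi fun i ↦ multivariateGaussian 0 (S i)) {x | L * (√b * R) < |inner ℝ u (x i)|} ≤
      ENNReal.ofReal (4 * Real.exp (-(L / 10))) := by
  have hsb : 0 < √b := Real.sqrt_pos.2 hb0
  have hsb2 : √b ^ 2 = b := Real.sq_sqrt hb0.le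
  have h : ∀ r : ℝ, r ^ 2 = (1 / (√b * R)) ^ 2 →
      ∫⁻ x, ENNReal.ofReal (Real.exp (r * inner ℝ u x)) ∂(multivariateGaussian 0 (S i)) ≤
        ENNReal.ofReal 2 := by
    intro r hr
    refine (lintegral_exp_inner_multivariateGaussian_le (hS i) (hb i) r u).trans
      (ENNReal.ofReal_le_ofReal (Real.exp_le_two_of_le ?_))
    have : r ^ 2 * b = 1 / R ^ 2 := by rw [hr, div_pow, mul_pow, hsb2]; field_simp
    rw [this]
    have : ‖u‖ ^ 2 ≤ R ^ 2 := by gcongr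
    have h2 : 1 / R ^ 2 * ‖u‖ ^ 2 ≤ 1 := by
      rw [div_mul_eq_mul_div, one_mul]
      exact div_le_one_of_le₀ this (by positivity)
    linarith
  have h1 := measure_lt_abs_le_of_lintegral_exp_le (μ := multivariateGaussian 0 (S i))
    (X := fun x ↦ inner ℝ u x) (by fun_prop) (s := 1 / (√b * R)) (by positivity) zero_le_two
    (h _ rfl) (h _ (neg_sq _)) (L * (√b * R))
  refine ((measurePreserving_eval_pi_multivariateGaussian (S := S) i).measure_preimage_le
    {y | L * (√b * R) < |inner ℝ u y|}).trans (h1.trans (ENNReal.ofReal_le_ofReal ?_))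
  have : 1 / (√b * R) * (L * (√b * R)) = L := by field_simp
  rw [this]
  have : Real.exp (-L) ≤ Real.exp (-(L / 10)) := Real.exp_le_exp.2 (by linarith)
  linarith

lemma pi_sum_norm_sq_tail (hS : ∀ i, (S i).PosSemidef) (hb0 : 0 < b) (hp : 0 < p) (hn : 0 < n)
    (hb : ∀ i, ‖toEuclideanCLM (n := Fin p) (𝕜 := ℝ) (S i)‖ ≤ b) (L : ℝ) :
    (Measure.pi fun i ↦ multivariateGaussian 0 (S i))
      {x | L * (b * √(n * p)) < |∑ i, (‖x i‖ ^ 2 - (S i).trace)|} ≤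
      ENNReal.ofReal (4 * Real.exp (-(L / 10))) := by
  refine measure_lt_abs_le_of_subexponential (N := n * p)
    (Finset.measurable_sum _ fun i _ ↦ by fun_prop).aemeasurable hb0
    (by exact_mod_cast Nat.mul_pos hn hp) (fun s hs ↦ ?_) L
  have h1 : ∀ x : Fin n → EuclideanSpace ℝ (Fin p),
      ENNReal.ofReal (Real.exp (s * ∑ i, (‖x i‖ ^ 2 - (S i).trace))) =
      ∏ i, ENNReal.ofReal (Real.exp (s * (‖x i‖ ^ 2 - (S i).trace))) := by
    intro x
    rw [← ENNReal.ofReal_prod_of_nonneg (fun i _ ↦ by positivity), ← Real.exp_sum, Finset.mul_sum]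
  simp_rw [h1]
  have hind : iIndepFun (fun (i : Fin n) (x : Fin n → EuclideanSpace ℝ (Fin p)) ↦
      ENNReal.ofReal (Real.exp (s * (‖x i‖ ^ 2 - (S i).trace))))
      (Measure.pi fun i ↦ multivariateGaussian 0 (S i)) :=
    iIndepFun_pi (X := fun (i : Fin n) (x : EuclideanSpace ℝ (Fin p)) ↦
      ENNReal.ofReal (Real.exp (s * (‖x‖ ^ 2 - (S i).trace)))) (fun i ↦ by fun_prop)
  have h2 := lintegral_prod_eq_prod_lintegral_of_indepFun Finset.univ _ hind (fun i ↦ by fun_prop)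
  rw [h2]
  have h3 : ∀ i, ∫⁻ x : Fin n → EuclideanSpace ℝ (Fin p),
      ENNReal.ofReal (Real.exp (s * (‖x i‖ ^ 2 - (S i).trace)))
      ∂(Measure.pi fun i ↦ multivariateGaussian 0 (S i)) ≤
      ENNReal.ofReal (Real.exp (4 * s ^ 2 * b ^ 2 * p)) := by
    intro i
    have h4 := (measurePreserving_eval_pi_multivariateGaussian (S := S) i).lintegral_comp
      (f := fun x ↦ ENNReal.ofReal (Real.exp (s * (‖x‖ ^ 2 - (S i).trace)))) (by fun_prop)
    rw [h4]
    exact lintegral_exp_norm_sq_multivariateGaussian_le (hS i) (hb i) hs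
  refine (Finset.prod_le_prod' fun i _ ↦ h3 i).trans ?_
  rw [Finset.prod_const, ← ENNReal.ofReal_pow (by positivity), ← Real.exp_nat_mul]
  apply ENNReal.ofReal_le_ofReal
  apply Real.exp_le_exp.2
  rw [Finset.card_univ, Fintype.card_fin]
  apply le_of_eq; ring

lemma lintegral_exp_inner_sum_le (hS : ∀ i, (S i).PosSemidef)
    (hb : ∀ i, ‖toEuclideanCLM (n := Fin p) (𝕜 := ℝ) (S i)‖ ≤ b) (s : Finset (Fin n)) (r : ℝ)
    (u : EuclideanSpace ℝ (Fin p)) :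
    ∫⁻ x : Fin n → EuclideanSpace ℝ (Fin p),
      ENNReal.ofReal (Real.exp (r * inner ℝ u (∑ j ∈ s, x j)))
      ∂(Measure.pi fun i ↦ multivariateGaussian 0 (S i)) ≤
      ENNReal.ofReal (Real.exp (s.card * (r ^ 2 * b * ‖u‖ ^ 2 / 2))) := by
  have h1 : ∀ x : Fin n → EuclideanSpace ℝ (Fin p),
      ENNReal.ofReal (Real.exp (r * inner ℝ u (∑ j ∈ s, x j))) =
      ∏ j ∈ s, ENNReal.ofReal (Real.exp (r * inner ℝ u (x j))) := by
    intro x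
    rw [← ENNReal.ofReal_prod_of_nonneg (fun i _ ↦ by positivity), ← Real.exp_sum, inner_sum,
      Finset.mul_sum]
  simp_rw [h1]
  have hind : iIndepFun (fun (i : Fin n) (x : Fin n → EuclideanSpace ℝ (Fin p)) ↦
      ENNReal.ofReal (Real.exp (r * inner ℝ u (x i))))
      (Measure.pi fun i ↦ multivariateGaussian 0 (S i)) :=
    iIndepFun_pi (X := fun (i : Fin n) (x : EuclideanSpace ℝ (Fin p)) ↦
      ENNReal.ofReal (Real.exp (r * inner ℝ u x))) (fun i ↦ by fun_prop)
  have h2 := lintegral_prod_eq_prod_lintegral_of_indepFun s _ hind (fun i ↦ by fun_prop)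
  rw [h2]
  have h3 : ∀ i ∈ s, ∫⁻ x : Fin n → EuclideanSpace ℝ (Fin p),
      ENNReal.ofReal (Real.exp (r * inner ℝ u (x i)))
      ∂(Measure.pi fun i ↦ multivariateGaussian 0 (S i)) ≤
      ENNReal.ofReal (Real.exp (r ^ 2 * b * ‖u‖ ^ 2 / 2)) := by
    intro i _
    have h4 := (measurePreserving_eval_pi_multivariateGaussian (S := S) i).lintegral_comp
      (f := fun x ↦ ENNReal.ofReal (Real.exp (r * inner ℝ u x))) (by fun_prop)
    rw [h4]
    exact lintegral_exp_inner_multivariateGaussian_le (hS i) (hb i) r u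
  refine (Finset.prod_le_prod' h3).trans ?_
  rw [Finset.prod_const, ← ENNReal.ofReal_pow (by positivity), ← Real.exp_nat_mul]

/-- Conditionally on `x i`, the inner product is Gaussian with variance at most `b |s| ‖x i‖²`, so
that its exponential moments are bounded by those of `‖x i‖²`. -/
lemma pi_inner_sum_tail (hS : ∀ i, (S i).PosSemidef) (hb0 : 0 < b) (hp : 0 < p)
    (hb : ∀ i, ‖toEuclideanCLM (n := Fin p) (𝕜 := ℝ) (S i)‖ ≤ b) {i : Fin n}
    {s : Finset (Fin n)} (hi : i ∉ s) (hs : s.Nonempty) {L : ℝ} (hL : 0 ≤ L) :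
    (Measure.pi fun i ↦ multivariateGaussian 0 (S i))
      {x | L * (b * √(s.card * p)) < |inner ℝ (x i) (∑ j ∈ s, x j)|} ≤
      ENNReal.ofReal (4 * Real.exp (-(L / 10))) := by
  set P := Measure.pi fun i ↦ multivariateGaussian 0 (S i) with hP
  have hp0 : (0 : ℝ) < p := by exact_mod_cast hp
  have hc0 : (0 : ℝ) < s.card := by exact_mod_cast hs.card_pos
  set q := b * √(s.card * p) with hq
  have hq0 : 0 < q := by positivity
  have hq2 : q ^ 2 = b ^ 2 * (s.card * p) := by
    rw [hq, mul_pow, Real.sq_sqrt (by positivity)]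
  have hind : iIndepFun (fun (i : Fin n) (x : Fin n → EuclideanSpace ℝ (Fin p)) ↦ x i) P :=
    iIndepFun_pi (X := fun (i : Fin n) (x : EuclideanSpace ℝ (Fin p)) ↦ x) (fun i ↦ by fun_prop)
  have h2 := (hind.indepFun_finsetSum_of_notMem (fun i ↦ measurable_pi_apply i) hi).symm
  have hsum : Measurable (∑ j ∈ s, fun x : Fin n → EuclideanSpace ℝ (Fin p) ↦ x j) := by
    rw [show (∑ j ∈ s, fun x : Fin n → EuclideanSpace ℝ (Fin p) ↦ x j) = fun x ↦ ∑ j ∈ s, x j from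
      funext fun x ↦ Finset.sum_apply ..]
    exact Finset.measurable_sum _ fun j _ ↦ measurable_pi_apply j
  have h3 := (indepFun_iff_map_prod_eq_prod_map_map (measurable_pi_apply i).aemeasurable
    hsum.aemeasurable).1 h2
  have h : ∀ r : ℝ, r ^ 2 = (2 / (5 * q)) ^ 2 →
      ∫⁻ x, ENNReal.ofReal (Real.exp (r * inner ℝ (x i) (∑ j ∈ s, x j))) ∂P ≤
        ENNReal.ofReal 2 := by
    intro r hr
    -- `θ ‖x i‖²` is the exponent that is left after integrating out the `x j`
    set θ := s.card * (r ^ 2 * b) / 2 with hθ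
    have hθb : θ * b = 2 / (25 * p) := by
      have : θ * b = s.card * (r ^ 2 * b ^ 2) / 2 := by rw [hθ]; ring
      rw [this, hr, div_pow, mul_pow, hq2]
      field_simp; norm_num
    have hp1 : (1 : ℝ) ≤ p := by exact_mod_cast hp
    have hθb' : θ * b ≤ 2 / 25 := by
      rw [hθb, div_le_div_iff₀ (by positivity) (by norm_num)]
      linarith
    have hθ0 : 0 ≤ θ := by positivity
    have e1 : ∫⁻ x, ENNReal.ofReal (Real.exp (r * inner ℝ (x i) (∑ j ∈ s, x j))) ∂P =
        ∫⁻ z, ENNReal.ofReal (Real.exp (r * inner ℝ z.1 z.2))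
          ∂((P.map fun x ↦ x i).prod (P.map (∑ j ∈ s, fun x ↦ x j))) := by
      rw [← h3, lintegral_map (by fun_prop) (by fun_prop)]
      simp
    rw [e1, lintegral_prod _ (by fun_prop),
      (measurePreserving_eval_pi_multivariateGaussian (S := S) i).map_eq]
    have e2 : ∀ u, ∫⁻ y, ENNReal.ofReal (Real.exp (r * inner ℝ u y))
        ∂(P.map (∑ j ∈ s, fun x ↦ x j)) ≤
        ENNReal.ofReal (Real.exp (θ * (S i).trace)) *
          ENNReal.ofReal (Real.exp (θ * (‖u‖ ^ 2 - (S i).trace))) := by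
      intro u
      rw [lintegral_map (by fun_prop) (by fun_prop), ← ENNReal.ofReal_mul (by positivity),
        ← Real.exp_add]
      simp only [Finset.sum_apply]
      refine (lintegral_exp_inner_sum_le hS hb s r u).trans (le_of_eq ?_)
      congr 2
      rw [hθ]; ring
    refine (lintegral_mono e2).trans ?_
    rw [lintegral_const_mul _ (by fun_prop)]
    refine (mul_le_mul_right (lintegral_exp_norm_sq_multivariateGaussian_le (hS i) (hb i)
      (s := θ) (by rw [abs_of_nonneg hθ0]; linarith)) _).trans ?_
    rw [← ENNReal.ofReal_mul (by positivity), ← Real.exp_add]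
    refine ENNReal.ofReal_le_ofReal (Real.exp_le_two_of_le ?_)
    have f1 : θ * (S i).trace ≤ 2 / 25 := by
      calc θ * (S i).trace ≤ θ * (p * b) := by
            gcongr; exact trace_le_of_norm_toEuclideanCLM_le (hS i) (hb i)
        _ = (θ * b) * p := by ring
        _ = 2 / 25 := by rw [hθb]; field_simp
    have f2 : 4 * θ ^ 2 * b ^ 2 * p ≤ 4 * (2 / 25) * (2 / 25) := by
      calc 4 * θ ^ 2 * b ^ 2 * p = 4 * (θ * b) * ((θ * b) * p) := by ring
        _ = 4 * (θ * b) * (2 / 25) := by congr 1; rw [hθb]; field_simp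
        _ ≤ _ := by gcongr
    norm_num at f2
    linarith
  have h1 := measure_lt_abs_le_of_lintegral_exp_le (μ := P)
    (X := fun x ↦ inner ℝ (x i) (∑ j ∈ s, x j)) (by fun_prop) (s := 2 / (5 * q)) (by positivity)
    zero_le_two (h _ rfl) (h _ (neg_sq _)) (L * q)
  refine h1.trans (ENNReal.ofReal_le_ofReal ?_)
  have : 2 / (5 * q) * (L * q) = 2 / 5 * L := by field_simp
  rw [this]
  have : Real.exp (-(2 / 5 * L)) ≤ Real.exp (-(L / 10)) := Real.exp_le_exp.2 (by linarith)
  linarith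

end ProductTails

/-! ### Taylor expansion of the kernel function -/

section KernelFunction

/-- Taylor bound of order one, uniform along a bounded sequence `τ`, with the constants that
control `f` and its derivative there. -/
lemma KernelAssumption.exists_taylor_bound {f : ℝ → ℝ} {τ : ℕ → ℝ} (hf : KernelAssumption f τ)
    {B : ℝ} (hτ : ∀ᶠ n in atTop, 0 ≤ τ n ∧ τ n ≤ B) :
    ∃ δ > 0, ∃ r > 0, ∃ M ≥ 1, ∀ᶠ n in atTop, δ ≤ f (τ n) ∧ f (τ n) ≤ M ∧
      |derivWithin f (Ici 0) (τ n)| ≤ M ∧ ∀ x, 0 ≤ x → |x - τ n| ≤ r →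
        |f x - f (τ n) - derivWithin f (Ici 0) (τ n) * (x - τ n)| ≤ M * (x - τ n) ^ 2 := by
  obtain ⟨δ, hδ, hlow⟩ := hf.lower
  obtain ⟨ε, hε, N, hsm⟩ := hf.smooth
  obtain ⟨N₁, hN₁⟩ := eventually_atTop.1 hτ
  set O := Metric.thickening ε (τ '' Ici N) with hO
  set U := Ici (0 : ℝ) ∩ O with hU
  have hOo : IsOpen O := Metric.isOpen_thickening
  have hUu : UniqueDiffOn ℝ U := (uniqueDiffOn_Ici 0).inter hOo
  set N₂ := max N N₁
  -- the derivatives up to order two are bounded on a compact neighbourhood of the values of `τ`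
  set K := Ici (0 : ℝ) ∩ Metric.cthickening (ε / 2) (τ '' Ici N₂) with hK
  have hbdd : Bornology.IsBounded (τ '' Ici N₂) := by
    refine (Metric.isBounded_Icc 0 B).subset ?_
    rintro _ ⟨n, hn, rfl⟩
    exact hN₁ n (le_trans (le_max_right _ _) hn)
  have hKc : IsCompact K :=
    (Metric.isCompact_of_isClosed_isBounded Metric.isClosed_cthickening
      hbdd.cthickening).inter_left isClosed_Ici
  have hKU : K ⊆ U := by
    refine inter_subset_inter_right _ ((Metric.cthickening_subset_thickening' hε (by linarith)
      _).trans (Metric.thickening_subset_of_subset _ (image_mono ?_)))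
    exact Ici_subset_Ici.2 (le_max_left _ _)
  set g := derivWithin f U with hg
  set h := derivWithin g U with hh
  have hgC : ContDiffOn ℝ 2 g U := hsm.derivWithin hUu (by norm_num)
  have hhC : ContDiffOn ℝ 1 h U := hgC.derivWithin hUu (by norm_num)
  obtain ⟨M₀, hM₀⟩ := hKc.exists_bound_of_continuousOn (hsm.continuousOn.mono hKU)
  obtain ⟨M₁, hM₁⟩ := hKc.exists_bound_of_continuousOn (hgC.continuousOn.mono hKU)
  obtain ⟨M₂, hM₂⟩ := hKc.exists_bound_of_continuousOn (hhC.continuousOn.mono hKU)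
  have hgd : ∀ y ∈ U, g y = derivWithin f (Ici 0) y := fun y hy ↦
    derivWithin_inter (hOo.mem_nhds hy.2)
  refine ⟨δ, hδ, ε / 2, by positivity, max 1 (max M₀ (max M₁ M₂)), le_max_left _ _, ?_⟩
  filter_upwards [hlow, eventually_ge_atTop N₂] with n hn1 hn2
  have hτ0 : 0 ≤ τ n := (hN₁ n ((le_max_right _ _).trans hn2)).1
  have hτK : τ n ∈ K :=
    ⟨hτ0, Metric.self_subset_cthickening _ (mem_image_of_mem _ hn2)⟩
  refine ⟨hn1, ?_, ?_, fun x hx0 hx ↦ ?_⟩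
  · exact (le_abs_self _).trans ((hM₀ _ hτK).trans ((le_max_left _ _).trans (le_max_right _ _)))
  · rw [← hgd _ (hKU hτK)]
    exact (hM₁ _ hτK).trans ((le_max_left _ _).trans ((le_max_right _ _).trans (le_max_right _ _)))
  · rw [← hgd _ (hKU hτK)]
    have hJ : uIcc (τ n) x ⊆ K := by
      intro y hy
      refine ⟨(le_min hτ0 hx0).trans hy.1, ?_⟩
      refine Metric.mem_cthickening_of_dist_le y (τ n) _ _ (mem_image_of_mem _ hn2) ?_
      rw [Real.dist_eq]
      exact (abs_sub_left_of_mem_uIcc hy).trans hx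
    have hM2 : ∀ y ∈ uIcc (τ n) x, ‖h y‖ ≤ M₂ := fun y hy ↦ hM₂ y (hJ hy)
    have hlip : ∀ y ∈ uIcc (τ n) x, ‖g y - g (τ n)‖ ≤ M₂ * |x - τ n| := by
      intro y hy
      have h1 := Convex.norm_image_sub_le_of_norm_hasDerivWithin_le (f := g) (f' := h)
        (s := uIcc (τ n) x) (x := τ n) (y := y) (C := M₂)
        (fun z hz ↦ ((hgC.differentiableOn (by norm_num) z
          (hKU (hJ hz))).hasDerivWithinAt).mono (hJ.trans hKU)) hM2 (convex_uIcc _ _)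
        left_mem_uIcc hy
      refine h1.trans (mul_le_mul_of_nonneg_left (abs_sub_left_of_mem_uIcc hy)
        ((norm_nonneg _).trans (hM2 _ left_mem_uIcc)))
    have h2 := Convex.norm_image_sub_le_of_norm_hasDerivWithin_le
      (f := fun y ↦ f y - g (τ n) * y) (f' := fun y ↦ g y - g (τ n))
      (s := uIcc (τ n) x) (x := τ n) (y := x) (C := M₂ * |x - τ n|)
      (fun z hz ↦ by
        have h3 := ((hsm.differentiableOn (by norm_num) z
          (hKU (hJ hz))).hasDerivWithinAt).mono (hJ.trans hKU)
        have h4 := ((hasDerivWithinAt_id z (uIcc (τ n) x)).const_mul (g (τ n)))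
        have h5 := h3.sub h4
        rw [mul_one] at h5
        exact h5) hlip (convex_uIcc _ _) left_mem_uIcc right_mem_uIcc
    have h5 : f x - g (τ n) * x - (f (τ n) - g (τ n) * τ n) =
        f x - f (τ n) - g (τ n) * (x - τ n) := by ring
    rw [h5, Real.norm_eq_abs, Real.norm_eq_abs, mul_assoc, ← sq, sq_abs] at h2
    refine h2.trans (mul_le_mul_of_nonneg_right ?_ (sq_nonneg _))
    exact (le_max_right _ _).trans ((le_max_right _ _).trans (le_max_right _ _))

end KernelFunction

/-! ### Deterministic expansion of the normalised degrees -/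

section RealExpansion

lemma abs_sqrt_one_add_sub_le {z : ℝ} (hz : -1 ≤ z) : |√(1 + z) - 1 - z / 2| ≤ z ^ 2 / 2 := by
  have h1 : √(1 + z) ^ 2 = 1 + z := Real.sq_sqrt (by linarith)
  have h0 := Real.sqrt_nonneg (1 + z)
  have h2 : √(1 + z) - 1 - z / 2 = -(√(1 + z) - 1) ^ 2 / 2 := by nlinarith
  have h3 : (√(1 + z) - 1) ^ 2 ≤ z ^ 2 := by
    have : z = (√(1 + z) - 1) * (√(1 + z) + 1) := by nlinarith
    calc (√(1 + z) - 1) ^ 2 = (√(1 + z) - 1) ^ 2 * 1 := by ring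
      _ ≤ (√(1 + z) - 1) ^ 2 * (√(1 + z) + 1) ^ 2 := by gcongr; nlinarith
      _ = ((√(1 + z) - 1) * (√(1 + z) + 1)) ^ 2 := by ring
      _ = z ^ 2 := by rw [← this]
  rw [h2, abs_div, abs_neg, abs_of_nonneg (sq_nonneg _), abs_two]
  linarith

/-- In `√((1 + y + e) / (1 + e'))`, with `e` and `e'` of second order, only `y` contributes at first
order. -/
lemma abs_sqrt_ratio_sub_le {y e e' Q : ℝ} (hQ : Q ≤ 1 / 4) (hy : |y| ≤ Q) (he : |e| ≤ Q ^ 2)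
    (he' : |e'| ≤ Q ^ 2) : |√((1 + y + e) / (1 + e')) - 1 - y / 2| ≤ 11 * Q ^ 2 := by
  have hQ0 : 0 ≤ Q := (abs_nonneg y).trans hy
  obtain ⟨a1, a2⟩ := abs_le.1 hy
  obtain ⟨b1, b2⟩ := abs_le.1 he
  obtain ⟨c1, c2⟩ := abs_le.1 he'
  have hQQ : Q ^ 2 ≤ Q / 4 := by nlinarith
  have hden : 1 / 2 ≤ 1 + e' := by nlinarith
  have hden0 : 0 < 1 + e' := by linarith
  set z := (y + e - e') / (1 + e') with hz
  have hr : (1 + y + e) / (1 + e') = 1 + z := by rw [hz]; field_simp; ring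
  have hinv : ∀ x : ℝ, |x / (1 + e')| ≤ 2 * |x| := by
    intro x
    rw [abs_div, abs_of_pos hden0, div_le_iff₀ hden0]
    nlinarith [abs_nonneg x]
  have hz1 : |z| ≤ 3 * Q := by
    refine (hinv _).trans ?_
    have : |y + e - e'| ≤ 3 / 2 * Q := by rw [abs_le]; constructor <;> linarith
    linarith
  have hz2 : |z - y| ≤ 5 * Q ^ 2 := by
    have : z - y = (e - e' - y * e') / (1 + e') := by rw [hz]; field_simp; ring
    rw [this]
    refine (hinv _).trans ?_
    have h1 : |y * e'| ≤ Q ^ 2 / 4 := by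
      rw [abs_mul]
      calc |y| * |e'| ≤ (1 / 4) * Q ^ 2 := by
            gcongr
            exact hy.trans hQ
        _ = _ := by ring
    obtain ⟨d1, d2⟩ := abs_le.1 h1
    have : |e - e' - y * e'| ≤ 5 / 2 * Q ^ 2 := by rw [abs_le]; constructor <;> nlinarith
    linarith
  have hz3 : -1 ≤ z := by have := (abs_le.1 hz1).1; linarith
  have h4 := abs_sqrt_one_add_sub_le hz3
  have h5 : z ^ 2 ≤ 9 * Q ^ 2 := by
    rw [← sq_abs]
    nlinarith [abs_nonneg z]
  rw [hr]
  have h6 : √(1 + z) - 1 - y / 2 = (√(1 + z) - 1 - z / 2) + (z - y) / 2 := by ring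
  rw [h6]
  refine (abs_add_le _ _).trans ?_
  rw [abs_div, abs_two]
  nlinarith

/-- The row sums of `f (d i j)`, when `d i j = τ + s i + s j - 2 G i j + h i j` off the diagonal:
after the constant `n f(τ)`, only `s i` contributes at order `√n`, because the sums of `s j` and
`G i j` over `j` are of order one. -/
lemma abs_row_sum_sub_le {n : ℕ} (hn : 0 < n) {f : ℝ → ℝ} {τ f' M r A H f₀ : ℝ} (hM : 1 ≤ M)
    (hf0 : 0 ≤ f τ) (hfM : f τ ≤ M) (hf'M : |f'| ≤ M)
    (htaylor : ∀ x, 0 ≤ x → |x - τ| ≤ r → |f x - f τ - f' * (x - τ)| ≤ M * (x - τ) ^ 2)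
    (hA : 1 ≤ A) (hH : 1 ≤ H) (hr : (3 * H + 2) * (A / √n) ≤ r)
    {d G h : Fin n → Fin n → ℝ} {s : Fin n → ℝ} (hd0 : ∀ i j, 0 ≤ d i j)
    (hf₀ : ∀ i, |f (d i i)| ≤ f₀)
    (hd : ∀ i j, i ≠ j → d i j = τ + s i + s j - 2 * G i j + h i j)
    (hs : ∀ i, |s i| ≤ H * (A / √n)) (hsum : |∑ i, s i| ≤ A)
    (hG : ∀ i j, i ≠ j → |G i j| ≤ A / √n) (hGsum : ∀ i, |∑ j ∈ Finset.univ.erase i, G i j| ≤ A)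
    (hh : ∀ i j, |h i j| ≤ H * (A / n)) (i : Fin n) :
    |∑ j, f (d i j) - n * f τ - n * (f' * s i)| ≤
      (f₀ + M + M * (3 * H + 3) + M * (3 * H + 2) ^ 2) * A ^ 2 := by
  have hn0 : (0 : ℝ) < n := by exact_mod_cast hn
  have hn1 : (1 : ℝ) ≤ n := by exact_mod_cast hn
  have hsn : 1 ≤ √(n : ℝ) := Real.one_le_sqrt.2 hn1
  have hsn0 : 0 < √(n : ℝ) := by linarith
  have hsn2 : √(n : ℝ) ^ 2 = n := Real.sq_sqrt hn0.le
  have hAn : A / n ≤ A / √n := by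
    apply div_le_div_of_nonneg_left (by linarith) hsn0
    nlinarith
  have hAs : A / √n ≤ A := div_le_self (by linarith) hsn
  have hf₀0 : 0 ≤ f₀ := (abs_nonneg _).trans (hf₀ i)
  have hAA : A ≤ A ^ 2 := by nlinarith
  have hM0 : 0 < M := by linarith
  set R : Fin n → ℝ := fun j ↦ f (d i j) - f τ - f' * (d i j - τ) with hR
  have hΔ : ∀ j, j ≠ i → |d i j - τ| ≤ (3 * H + 2) * (A / √n) := by
    intro j hj
    rw [hd i j hj.symm]
    have e : τ + s i + s j - 2 * G i j + h i j - τ = s i + s j - 2 * G i j + h i j := by ring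
    obtain ⟨a1, a2⟩ := abs_le.1 (hs i)
    obtain ⟨b1, b2⟩ := abs_le.1 (hs j)
    obtain ⟨c1, c2⟩ := abs_le.1 (hG i j hj.symm)
    obtain ⟨d1, d2⟩ := abs_le.1 (hh i j)
    have : H * (A / n) ≤ H * (A / √n) := by gcongr
    rw [e, abs_le]
    constructor <;> linarith
  have hRb : ∀ j ∈ Finset.univ.erase i, |R j| ≤ M * (3 * H + 2) ^ 2 * A ^ 2 / n := by
    intro j hj
    have hj' := Finset.ne_of_mem_erase hj
    refine (htaylor _ (hd0 i j) ((hΔ j hj').trans hr)).trans ?_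
    have : (d i j - τ) ^ 2 ≤ ((3 * H + 2) * (A / √n)) ^ 2 := by
      rw [← sq_abs]
      gcongr
      exact hΔ j hj'
    calc M * (d i j - τ) ^ 2 ≤ M * ((3 * H + 2) * (A / √n)) ^ 2 := by gcongr
      _ = M * (3 * H + 2) ^ 2 * A ^ 2 / √n ^ 2 := by field_simp
      _ = _ := by rw [hsn2]
  have hcard : ((Finset.univ.erase i).card : ℝ) = n - 1 := by
    rw [Finset.card_erase_of_mem (Finset.mem_univ i), Finset.card_univ, Fintype.card_fin,
      Nat.cast_sub hn, Nat.cast_one]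
  have hsumb : ∀ (g : Fin n → ℝ) (c : ℝ), (∀ j ∈ Finset.univ.erase i, |g j| ≤ c / n) → 0 ≤ c →
      |∑ j ∈ Finset.univ.erase i, g j| ≤ c := by
    intro g c hg hc
    refine (Finset.abs_sum_le_sum_abs _ _).trans ((Finset.sum_le_sum hg).trans ?_)
    rw [Finset.sum_const, nsmul_eq_mul, hcard, mul_div_assoc', div_le_iff₀ hn0]
    nlinarith
  have hRs := hsumb R (M * (3 * H + 2) ^ 2 * A ^ 2) hRb (by positivity)
  have hhs := hsumb (fun j ↦ h i j) (H * A) (fun j _ ↦ by rw [mul_div_assoc]; exact hh i j)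
    (by positivity)
  have key : ∑ j, f (d i j) - n * f τ - n * (f' * s i) = f (d i i) - f τ +
      f' * (-2 * s i + ∑ j, s j - 2 * ∑ j ∈ Finset.univ.erase i, G i j +
        ∑ j ∈ Finset.univ.erase i, h i j) + ∑ j ∈ Finset.univ.erase i, R j := by
    rw [← Finset.add_sum_erase _ _ (Finset.mem_univ i),
      ← Finset.add_sum_erase _ s (Finset.mem_univ i)]
    have e1 : ∑ j ∈ Finset.univ.erase i, f (d i j) = ∑ j ∈ Finset.univ.erase i,
        (f τ + f' * (s i + s j - 2 * G i j + h i j) + R j) := by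
      refine Finset.sum_congr rfl fun j hj ↦ ?_
      rw [hR]
      simp only
      rw [hd i j (Finset.ne_of_mem_erase hj).symm]
      ring
    rw [e1]
    simp only [Finset.sum_add_distrib, Finset.sum_sub_distrib, ← Finset.mul_sum, Finset.sum_const,
      nsmul_eq_mul, hcard]
    ring
  rw [key]
  have i1 : |f (d i i) - f τ| ≤ (f₀ + M) * A ^ 2 := by
    have h1 := abs_sub (f (d i i)) (f τ)
    rw [abs_of_nonneg hf0] at h1
    have h2 := hf₀ i
    nlinarith
  have i2 : |f' * (-2 * s i + ∑ j, s j - 2 * ∑ j ∈ Finset.univ.erase i, G i j +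
        ∑ j ∈ Finset.univ.erase i, h i j)| ≤ M * (3 * H + 3) * A ^ 2 := by
    rw [abs_mul]
    have h3 : |-2 * s i + ∑ j, s j - 2 * ∑ j ∈ Finset.univ.erase i, G i j +
        ∑ j ∈ Finset.univ.erase i, h i j| ≤ (3 * H + 3) * A := by
      have h4 : |s i| ≤ H * A := (hs i).trans (by gcongr)
      obtain ⟨a1, a2⟩ := abs_le.1 h4
      obtain ⟨b1, b2⟩ := abs_le.1 hsum
      obtain ⟨c1, c2⟩ := abs_le.1 (hGsum i)
      obtain ⟨d1, d2⟩ := abs_le.1 hhs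
      rw [abs_le]
      constructor <;> linarith
    calc _ ≤ M * ((3 * H + 3) * A) := by gcongr
      _ ≤ M * ((3 * H + 3) * A ^ 2) := by gcongr
      _ = _ := by ring
  refine (abs_add_le _ _).trans ?_
  have := abs_add_le (f (d i i) - f τ) (f' * (-2 * s i + ∑ j, s j -
    2 * ∑ j ∈ Finset.univ.erase i, G i j + ∑ j ∈ Finset.univ.erase i, h i j))
  nlinarith

/-- From the row sums `D i = n F + n F' s i + O(A²)` to the normalised square roots. The
normalisation `∑ D j = n² F (1 + O(A² / n))` does not contribute at first order, because
`∑ s i` is of order one. -/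
lemma abs_normalized_sqrt_sub_le {n : ℕ} (hn : 0 < n) {D s : Fin n → ℝ} {F F' δ M A H C : ℝ}
    (hδ : 0 < δ) (hF : δ ≤ F) (hF' : |F'| ≤ M) (hA : 1 ≤ A) (hH : 1 ≤ H) (hC : 1 ≤ C)
    (hM : 1 ≤ M) (hs : ∀ i, |s i| ≤ H * (A / √n)) (hsum : |∑ i, s i| ≤ A)
    (hD : ∀ i, |D i - n * F - n * (F' * s i)| ≤ C * A ^ 2)
    (hsmall : (M / δ * H + C / δ + 1) * (A / √n) ≤ 1 / 4) (i : Fin n) :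
    |(√(∑ j, D j))⁻¹ * √(D i) - (1 / √n) * (1 + F' / (2 * F) * s i)| ≤
      11 * (M / δ * H + C / δ + 1) ^ 2 * A ^ 2 / (n * √n) := by
  have hn0 : (0 : ℝ) < n := by exact_mod_cast hn
  have hsn0 : 0 < √(n : ℝ) := Real.sqrt_pos.2 hn0
  have hsn2 : √(n : ℝ) ^ 2 = n := Real.sq_sqrt hn0.le
  have hF0 : 0 < F := by linarith
  set κ := M / δ * H + C / δ + 1 with hκ
  set Q := κ * (A / √n) with hQ
  have hMδ : 0 < M / δ := by positivity
  have hCδ : 0 < C / δ := by positivity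
  have hκ1 : 1 ≤ κ := by
    have : 0 < M / δ * H := by positivity
    linarith
  have hFF : |F' / F| ≤ M / δ := by
    rw [abs_div, abs_of_pos hF0]
    gcongr
  set y : Fin n → ℝ := fun i ↦ F' / F * s i with hy
  set e : Fin n → ℝ := fun i ↦ D i / (n * F) - 1 - y i with he
  set e' := (∑ i, D i) / (n ^ 2 * F) - 1 with he'
  have hQ2 : Q ^ 2 = κ ^ 2 * A ^ 2 / n := by
    rw [hQ, mul_pow, div_pow, hsn2]; ring
  have hDe : ∀ i, D i = n * F * (1 + y i + e i) := by
    intro i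
    simp only [he]
    field_simp
    ring
  have hyb : ∀ i, |y i| ≤ Q := by
    intro i
    simp only [hy]
    rw [abs_mul]
    calc |F' / F| * |s i| ≤ M / δ * (H * (A / √n)) := by
          gcongr
          exact hs i
      _ = (M / δ * H) * (A / √n) := by ring
      _ ≤ κ * (A / √n) := by
          gcongr
          linarith
  have heb : ∀ i, |e i| ≤ C / δ * A ^ 2 / n := by
    intro i
    have : e i = (D i - n * F - n * (F' * s i)) / (n * F) := by
      simp only [he, hy]
      field_simp
    rw [this, abs_div, abs_of_pos (by positivity : (0 : ℝ) < n * F), div_le_iff₀ (by positivity)]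
    refine (hD i).trans ?_
    calc C * A ^ 2 = C / δ * A ^ 2 / n * (n * δ) := by field_simp
      _ ≤ _ := by gcongr
  have hebQ : ∀ i, |e i| ≤ Q ^ 2 := by
    intro i
    refine (heb i).trans ?_
    rw [hQ2]
    gcongr
    have : 0 < M / δ * H := by positivity
    nlinarith
  have he'b : |e'| ≤ Q ^ 2 := by
    have h1 : e' = (F' / F * ∑ i, s i + ∑ i, e i) / n := by
      have hys : F' / F * ∑ i, s i = ∑ i, y i := Finset.mul_sum ..
      rw [he', hys, Finset.sum_congr rfl fun i _ ↦ hDe i, ← Finset.mul_sum,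
        Finset.sum_add_distrib, Finset.sum_add_distrib, Finset.sum_const,
        Finset.card_univ, Fintype.card_fin, nsmul_eq_mul]
      field_simp
      ring
    rw [h1, abs_div, abs_of_pos hn0, hQ2]
    gcongr
    have h2 : |F' / F * ∑ i, s i| ≤ M / δ * A := by
      rw [abs_mul]
      gcongr
    have h3 : |∑ i, e i| ≤ C / δ * A ^ 2 := by
      refine (Finset.abs_sum_le_sum_abs _ _).trans ((Finset.sum_le_sum fun i _ ↦ heb i).trans ?_)
      rw [Finset.sum_const, Finset.card_univ, Fintype.card_fin, nsmul_eq_mul]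
      apply le_of_eq; field_simp
    have h4 : M / δ * A ≤ M / δ * H * A ^ 2 := by
      rw [mul_assoc]
      gcongr
      nlinarith
    have h5 : κ * A ^ 2 ≤ κ ^ 2 * A ^ 2 := by
      gcongr
      nlinarith
    refine (abs_add_le _ _).trans ?_
    have h6 : κ * A ^ 2 = M / δ * H * A ^ 2 + C / δ * A ^ 2 + A ^ 2 := by rw [hκ]; ring
    have : 0 ≤ A ^ 2 := by positivity
    linarith
  have hQ0 : 0 ≤ Q := by positivity
  have hmain := abs_sqrt_ratio_sub_le hsmall (hyb i) (hebQ i) he'b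
  have hden : 0 < 1 + e' := by
    have := (abs_le.1 he'b).1
    nlinarith
  have hSD : ∑ j, D j = n ^ 2 * F * (1 + e') := by
    rw [he']; field_simp; ring
  have hrat : (√(∑ j, D j))⁻¹ * √(D i) = (1 / √n) * √((1 + y i + e i) / (1 + e')) := by
    rw [one_div, ← Real.sqrt_inv, ← Real.sqrt_inv, ← Real.sqrt_mul (by
      rw [hSD]; positivity), ← Real.sqrt_mul (by positivity), hSD, hDe]
    congr 1
    field_simp
  rw [hrat, ← mul_sub, abs_mul, abs_of_pos (by positivity : 0 < 1 / √(n : ℝ))]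
  have h7 : 1 + F' / (2 * F) * s i = 1 + y i / 2 := by simp only [hy]; field_simp
  rw [h7, ← sub_sub]
  calc 1 / √n * |√((1 + y i + e i) / (1 + e')) - 1 - y i / 2| ≤ 1 / √n * (11 * Q ^ 2) := by gcongr
    _ = _ := by rw [hQ2]; field_simp

end RealExpansion

/-! ### Bounds on the model and on the noise -/

lemma measure_iUnion_le_card_mul {α ι : Type*} {mα : MeasurableSpace α} [Fintype ι] {P : Measure α}
    {f : ι → Set α} {K : ENNReal} (hf : ∀ i, P (f i) ≤ K) :
    P (⋃ i, f i) ≤ Fintype.card ι * K := by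
  refine (measure_iUnion_fintype_le _ _).trans ((Finset.sum_le_sum fun i _ ↦ hf i).trans ?_)
  simp

namespace MixtureModel

variable {k : ℕ} (m : MixtureModel k)

lemma sum_comp_cls (n : ℕ) (g : Fin k → ℝ) :
    ∑ i, g (m.cls n i) = ∑ a, (m.classSize n a : ℝ) * g a := by
  rw [← Finset.sum_fiberwise Finset.univ (m.cls n)]
  refine Finset.sum_congr rfl fun a _ ↦ ?_
  rw [classSize, ← nsmul_eq_mul, ← Finset.sum_const]
  exact Finset.sum_congr rfl fun i hi ↦ by rw [(Finset.mem_filter.1 hi).2]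

lemma sum_classSize (n : ℕ) : ∑ a, (m.classSize n a : ℝ) = n := by
  have := m.sum_comp_cls n fun _ ↦ 1
  simpa using this.symm

lemma trace_covAvg (n : ℕ) : (m.covAvg n).trace = ∑ a, m.c n a * (m.cov n a).trace := by
  simp [covAvg, Matrix.trace_sum, Matrix.trace_smul]

lemma trace_covCentered (n : ℕ) (a : Fin k) :
    (m.covCentered n a).trace = (m.cov n a).trace - (m.covAvg n).trace := by
  simp [covCentered, Matrix.trace_sub]

lemma c_nonneg (n : ℕ) (a : Fin k) : 0 ≤ m.c n a := by unfold c; positivity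

lemma sum_c {n : ℕ} (hn : 0 < n) : ∑ a, m.c n a = 1 := by
  simp only [c]
  rw [← Finset.sum_div, sum_classSize, div_self (by exact_mod_cast hn.ne')]

lemma sum_c_mul_trace_covCentered {n : ℕ} (hn : 0 < n) :
    ∑ a, m.c n a * (m.covCentered n a).trace = 0 := by
  simp_rw [trace_covCentered, mul_sub, Finset.sum_sub_distrib, ← Finset.sum_mul]
  rw [m.sum_c hn, one_mul, trace_covAvg, sub_self]

lemma sum_t {n : ℕ} (hn : 0 < n) : ∑ i, m.t n (m.cls n i) = 0 := by
  have hn0 : (n : ℝ) ≠ 0 := by exact_mod_cast hn.ne'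
  rw [m.sum_comp_cls n (m.t n)]
  have h := m.sum_c_mul_trace_covCentered hn
  have : ∀ a, (m.classSize n a : ℝ) * m.t n a =
      n * (1 / √(m.p n : ℝ)) * (m.c n a * (m.covCentered n a).trace) := by
    intro a
    simp only [t, c]
    field_simp
  simp_rw [this]
  rw [← Finset.mul_sum, h, mul_zero]

/-- `E ‖w_i‖² = τ / 2 + t_a / √p`. -/
lemma trace_cov_div {n : ℕ} (hp : 0 < m.p n) (a : Fin k) :
    ((m.p n : ℝ)⁻¹ • m.cov n a).trace = m.τ n / 2 + m.t n a / √(m.p n : ℝ) := by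
  have hp0 : (0 : ℝ) < m.p n := by exact_mod_cast hp
  have hsp : 0 < √(m.p n : ℝ) := Real.sqrt_pos.2 hp0
  have hsp2 : √(m.p n : ℝ) * √(m.p n : ℝ) = m.p n := Real.mul_self_sqrt hp0.le
  rw [Matrix.trace_smul, τ, t, trace_covCentered, one_div_mul_eq_div, div_div, hsp2, smul_eq_mul]
  field_simp
  ring

/-- The bounds, for one sample size, that follow from the growth rate assumption. -/
structure BoundedBy (n : ℕ) (B : ℝ) : Prop where
  n_pos : 0 < n
  p_pos : 0 < m.p n
  n_le : (n : ℝ) ≤ B * m.p n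
  p_le : (m.p n : ℝ) ≤ B * n
  mean_le : ∀ a b, ‖m.mean n a - m.mean n b‖ ≤ B
  cov_le : ∀ a, ‖Matrix.toEuclideanCLM (n := Fin (m.p n)) (𝕜 := ℝ) (m.cov n a)‖ ≤ B
  t_le : ∀ a, |m.t n a| ≤ B
  τ_nonneg : 0 ≤ m.τ n
  τ_le : m.τ n ≤ B

variable {m}

/-- The trace assumption is one-sided; the other side holds because the centred traces average to
zero with weights bounded below. -/
lemma abs_trace_covCentered_le {n : ℕ} (hn : 0 < n) {l T : ℝ} (hl : 0 < l) (hT : 0 ≤ T)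
    (hc : ∀ a, l ≤ m.c n a) (ht : ∀ a, (m.covCentered n a).trace ≤ T) (a : Fin k) :
    |(m.covCentered n a).trace| ≤ T + T / l := by
  have h0 := m.sum_c_mul_trace_covCentered hn
  rw [← Finset.add_sum_erase _ _ (Finset.mem_univ a)] at h0
  have h1 : ∑ b ∈ Finset.univ.erase a, m.c n b * (m.covCentered n b).trace ≤ T := by
    calc ∑ b ∈ Finset.univ.erase a, m.c n b * (m.covCentered n b).trace
        ≤ ∑ b ∈ Finset.univ.erase a, m.c n b * T :=
          Finset.sum_le_sum fun b _ ↦ mul_le_mul_of_nonneg_left (ht b) (m.c_nonneg n b)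
      _ ≤ ∑ b, m.c n b * T := Finset.sum_le_sum_of_subset_of_nonneg (Finset.erase_subset _ _)
          fun b _ _ ↦ mul_nonneg (m.c_nonneg n b) hT
      _ = T := by rw [← Finset.sum_mul, m.sum_c hn, one_mul]
  have h2 : 0 ≤ T / l := by positivity
  rw [abs_le]
  refine ⟨?_, (ht a).trans (by linarith)⟩
  by_contra hcon
  push Not at hcon
  have h3 : (m.covCentered n a).trace < -(T / l) := by linarith
  have h4 : m.c n a * (m.covCentered n a).trace < -T := by
    have h5 : m.c n a * (m.covCentered n a).trace ≤ l * (m.covCentered n a).trace := by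
      nlinarith [hc a]
    have h6 : l * (m.covCentered n a).trace < l * -(T / l) := by gcongr
    have h7 : l * -(T / l) = -T := by field_simp
    linarith
  linarith

theorem GrowthRate.exists_boundedBy (hm : m.GrowthRate) :
    ∃ B, 1 ≤ B ∧ ∀ᶠ n in atTop, m.BoundedBy n B := by
  obtain ⟨l₀, hl₀, u₀, h₀⟩ := hm.data_scaling
  choose l hl hc using hm.class_scaling
  obtain ⟨Bm, hBm⟩ := hm.mean_scaling
  obtain ⟨Bc, hBc⟩ := hm.cov_norm_scaling
  obtain ⟨Bt, hBt⟩ := hm.cov_trace_scaling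
  obtain ⟨l', hl', hl'l⟩ : ∃ l' > 0, ∀ a, l' ≤ l a := by
    rcases isEmpty_or_nonempty (Fin k) with h | h
    · exact ⟨1, one_pos, fun a ↦ (h.false a).elim⟩
    · obtain ⟨a, ha⟩ := Finite.exists_min l
      exact ⟨l a, hl a, ha⟩
  set Bt' := max Bt 0 with hBt'
  set X := (Bt' + Bt' / l') with hX
  have hX0 : 0 ≤ X := by positivity
  set B := max 1 (max (1 / l₀) (max u₀ (max (2 * Bm) (max (2 * Bc) (X * (1 / l₀ + 1)))))) with hB
  have b0 : 1 ≤ B := le_max_left _ _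
  have b1 : 1 / l₀ ≤ B := (le_max_left _ _).trans (le_max_right _ _)
  have b2 : u₀ ≤ B := (le_max_left _ _).trans ((le_max_right _ _).trans (le_max_right _ _))
  have b3 : 2 * Bm ≤ B :=
    (le_max_left _ _).trans ((le_max_right _ _).trans ((le_max_right _ _).trans (le_max_right _ _)))
  have b4 : 2 * Bc ≤ B := (le_max_left _ _).trans ((le_max_right _ _).trans
    ((le_max_right _ _).trans ((le_max_right _ _).trans (le_max_right _ _))))
  have b5 : X * (1 / l₀ + 1) ≤ B := (le_max_right _ _).trans ((le_max_right _ _).trans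
    ((le_max_right _ _).trans ((le_max_right _ _).trans (le_max_right _ _))))
  refine ⟨B, b0, ?_⟩
  filter_upwards [h₀, eventually_all.2 hc, hBm, hBc, hBt, eventually_gt_atTop 0]
    with n e0 ec em ecn et hn
  have hn0 : (0 : ℝ) < n := by exact_mod_cast hn
  have hsn : 0 < √(n : ℝ) := Real.sqrt_pos.2 hn0
  rw [c₀, le_div_iff₀ hn0, div_le_iff₀ hn0] at e0
  have hp0 : (0 : ℝ) < m.p n := by
    have : 0 < l₀ * n := by positivity
    linarith [e0.1]
  have hsp : 0 < √(m.p n : ℝ) := Real.sqrt_pos.2 hp0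
  have hn_le : (n : ℝ) ≤ 1 / l₀ * m.p n := by
    rw [one_div_mul_eq_div, le_div_iff₀ hl₀]
    linarith [e0.1]
  have hPSD := fun a ↦ m.posSemidef_cov n a
  have htr : ∀ a, (m.cov n a).trace ≤ m.p n * Bc := fun a ↦
    trace_le_of_norm_toEuclideanCLM_le (hPSD a) (ecn a)
  have hav : (m.covAvg n).trace ≤ m.p n * Bc := by
    rw [trace_covAvg]
    calc _ ≤ ∑ a, m.c n a * (m.p n * Bc) :=
          Finset.sum_le_sum fun a _ ↦ mul_le_mul_of_nonneg_left (htr a) (m.c_nonneg n a)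
      _ = _ := by rw [← Finset.sum_mul, m.sum_c hn, one_mul]
  have hav0 : 0 ≤ (m.covAvg n).trace := by
    rw [trace_covAvg]
    exact Finset.sum_nonneg fun a _ ↦ mul_nonneg (m.c_nonneg n a) (hPSD a).trace_nonneg
  refine ⟨hn, by exact_mod_cast hp0, hn_le.trans (by gcongr), e0.2.trans (by gcongr), ?_, ?_, ?_,
    ?_, ?_⟩
  · intro a b
    have : m.mean n a - m.mean n b = m.meanCentered n a - m.meanCentered n b := by
      simp [meanCentered]
    rw [this]
    refine (norm_sub_le _ _).trans ?_
    linarith [em a, em b]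
  · intro a
    refine (ecn a).trans ?_
    have := (norm_nonneg _).trans (ecn a)
    linarith
  · intro a
    have h1 : ∀ a, (m.covCentered n a).trace ≤ √n * Bt' := by
      intro a
      have := et a
      rw [one_div_mul_eq_div, div_le_iff₀ hsn] at this
      rw [mul_comm]
      exact this.trans (by gcongr; exact le_max_left _ _)
    have h2 := abs_trace_covCentered_le hn hl' (by positivity)
      (fun a ↦ (hl'l a).trans (ec a)) h1 a
    rw [t, abs_mul, abs_of_pos (by positivity : 0 < 1 / √(m.p n : ℝ)), one_div_mul_eq_div,
      div_le_iff₀ hsp]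
    have h3 : √(n : ℝ) ≤ (1 / l₀ + 1) * √(m.p n : ℝ) := by
      apply Real.sqrt_le_iff.2
      refine ⟨by positivity, ?_⟩
      rw [mul_pow, Real.sq_sqrt hp0.le]
      have : 0 < 1 / l₀ := by positivity
      refine hn_le.trans (mul_le_mul_of_nonneg_right ?_ hp0.le)
      nlinarith
    calc _ ≤ √n * Bt' + √n * Bt' / l' := h2
      _ = X * √n := by rw [hX]; ring
      _ ≤ X * ((1 / l₀ + 1) * √(m.p n : ℝ)) := by gcongr
      _ = X * (1 / l₀ + 1) * √(m.p n : ℝ) := by ring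
      _ ≤ _ := by gcongr
  · rw [τ]; positivity
  · rw [τ]
    calc 2 / (m.p n : ℝ) * (m.covAvg n).trace ≤ 2 / (m.p n : ℝ) * (m.p n * Bc) := by gcongr
      _ = 2 * Bc := by field_simp
      _ ≤ B := b4

variable (m) in
/-- The event, for one sample size, on which the noise `x` satisfies all the bounds that the
expansion uses, with constant `A`. The sums in the last two bounds have `n` terms of order
`n^{-1/2}`; they are of order one by independence. -/
structure NoiseBounds (n : ℕ) (A : ℝ) (x : Fin n → EuclideanSpace ℝ (Fin (m.p n))) : Prop where
  norm_sq_le : ∀ i, |‖x i‖ ^ 2 - ((m.p n : ℝ)⁻¹ • m.cov n (m.cls n i)).trace| ≤ A / √n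
  inner_le : ∀ i j, i ≠ j → |inner ℝ (x i) (x j)| ≤ A / √n
  mean_le : ∀ a b i, |inner ℝ (m.mean n a - m.mean n b) (x i)| ≤ A / √n
  sum_le : |∑ i, (‖x i‖ ^ 2 - ((m.p n : ℝ)⁻¹ • m.cov n (m.cls n i)).trace)| ≤ A
  inner_sum_le : ∀ i, |inner ℝ (x i) (∑ j ∈ Finset.univ.erase i, x j)| ≤ A

lemma BoundedBy.norm_inv_smul_cov_le {n : ℕ} {B : ℝ} (h : m.BoundedBy n B) (a : Fin k) :
    ‖Matrix.toEuclideanCLM (n := Fin (m.p n)) (𝕜 := ℝ) ((m.p n : ℝ)⁻¹ • m.cov n a)‖ ≤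
      B / m.p n := by
  rw [map_smul, norm_smul, norm_inv, Real.norm_eq_abs, abs_of_nonneg (Nat.cast_nonneg _),
    div_eq_inv_mul]
  have := h.cov_le a
  gcongr

lemma BoundedBy.sqrt_n_le {n : ℕ} {B : ℝ} (h : m.BoundedBy n B) (hB : 1 ≤ B) :
    √(n : ℝ) ≤ B * √(m.p n : ℝ) := by
  apply Real.sqrt_le_iff.2
  refine ⟨by positivity, h.n_le.trans ?_⟩
  rw [mul_pow, Real.sq_sqrt (Nat.cast_nonneg _)]
  gcongr
  nlinarith

/-- Each of the bounds of `NoiseBounds`, with constant `B³ L`, fails with probability at most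
`4 e^{-L / 10}`. -/
lemma BoundedBy.noise_tails {n : ℕ} {B : ℝ} (h : m.BoundedBy n B) (hB : 1 ≤ B)
    {L : ℝ} (hL : 0 ≤ L) :
    let P := Measure.pi fun i ↦ multivariateGaussian 0 ((m.p n : ℝ)⁻¹ • m.cov n (m.cls n i))
    let K := ENNReal.ofReal (4 * Real.exp (-(L / 10)))
    (∀ i, P {x | B ^ 3 * L / √n <
      |‖x i‖ ^ 2 - ((m.p n : ℝ)⁻¹ • m.cov n (m.cls n i)).trace|} ≤ K) ∧
    (∀ i j, i ≠ j → P {x | B ^ 3 * L / √n < |inner ℝ (x i) (x j)|} ≤ K) ∧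
    (∀ a a' i, P {x | B ^ 3 * L / √n < |inner ℝ (m.mean n a - m.mean n a') (x i)|} ≤ K) ∧
    P {x | B ^ 3 * L <
      |∑ i, (‖x i‖ ^ 2 - ((m.p n : ℝ)⁻¹ • m.cov n (m.cls n i)).trace)|} ≤ K ∧
    ∀ i, P {x | B ^ 3 * L < |inner ℝ (x i) (∑ j ∈ Finset.univ.erase i, x j)|} ≤ K := by
  intro P K
  have hn0 : (0 : ℝ) < n := by exact_mod_cast h.n_pos
  have hp0 : (0 : ℝ) < m.p n := by exact_mod_cast h.p_pos
  have hsn : 0 < √(n : ℝ) := Real.sqrt_pos.2 hn0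
  have hsp : 0 < √(m.p n : ℝ) := Real.sqrt_pos.2 hp0
  have hsn2 : √(n : ℝ) ^ 2 = n := Real.sq_sqrt hn0.le
  have hsp2 : √(m.p n : ℝ) ^ 2 = m.p n := Real.sq_sqrt hp0.le
  have hsnp := h.sqrt_n_le hB
  set b := B / m.p n with hb
  have hb0 : 0 < b := by positivity
  have hS : ∀ i, ((m.p n : ℝ)⁻¹ • m.cov n (m.cls n i)).PosSemidef := fun i ↦
    (m.posSemidef_cov n _).smul (inv_nonneg.2 hp0.le)
  have hSb := fun i ↦ h.norm_inv_smul_cov_le (m.cls n i)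
  have hB3 : B ^ 2 ≤ B ^ 3 := pow_le_pow_right₀ hB (by norm_num)
  have hB2 : B ≤ B ^ 2 := by nlinarith
  have hinv : 1 / √(m.p n : ℝ) ≤ B / √n := by
    rw [div_le_div_iff₀ hsp hsn]; linarith
  have c1 : b * √(m.p n : ℝ) ≤ B ^ 3 / √n := by
    have : b * √(m.p n : ℝ) = B * (1 / √(m.p n : ℝ)) := by
      rw [hb]
      nth_rewrite 1 [← hsp2]
      field_simp
    rw [this]
    calc B * (1 / √(m.p n : ℝ)) ≤ B * (B / √n) := by gcongr
      _ = B ^ 2 / √n := by ring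
      _ ≤ _ := by gcongr
  have c2 : √b * B ≤ B ^ 3 / √n := by
    have : √b ≤ B * (1 / √(m.p n : ℝ)) := by
      rw [hb, Real.sqrt_div (by linarith), mul_one_div]
      gcongr
      exact Real.sqrt_le_iff.2 ⟨by linarith, hB2⟩
    calc √b * B ≤ B * (B / √n) * B := by
          gcongr
          exact this.trans (by gcongr)
      _ = _ := by ring
  have c3 : b * √(n * m.p n) ≤ B ^ 3 := by
    rw [Real.sqrt_mul hn0.le]
    calc b * (√n * √(m.p n : ℝ)) ≤ b * (B * √(m.p n : ℝ) * √(m.p n : ℝ)) := by gcongr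
      _ = b * B * √(m.p n : ℝ) ^ 2 := by ring
      _ = B ^ 2 := by rw [hsp2, hb]; field_simp
      _ ≤ _ := hB3
  have c1' : L * (b * √(m.p n : ℝ)) ≤ B ^ 3 * L / √n := by
    rw [mul_comm (B ^ 3), mul_div_assoc]; gcongr
  have c2' : L * (√b * B) ≤ B ^ 3 * L / √n := by
    rw [mul_comm (B ^ 3), mul_div_assoc]; gcongr
  have c3' : L * (b * √(n * m.p n)) ≤ B ^ 3 * L := by
    rw [mul_comm (B ^ 3)]; gcongr
  have t1 : ∀ i, P {x | B ^ 3 * L / √n <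
      |‖x i‖ ^ 2 - ((m.p n : ℝ)⁻¹ • m.cov n (m.cls n i)).trace|} ≤ K := fun i ↦
    (measure_mono fun x hx ↦ lt_of_le_of_lt c1' hx).trans (pi_norm_sq_tail hS hb0 h.p_pos hSb i L)
  have t2 : ∀ i j, i ≠ j → P {x | B ^ 3 * L / √n < |inner ℝ (x i) (x j)|} ≤ K := fun i j hij ↦
    (measure_mono fun x hx ↦ by
      simp only [mem_ofPred_eq, Finset.sum_singleton, Finset.card_singleton, Nat.cast_one, one_mul]
      exact lt_of_le_of_lt c1' hx).trans (pi_inner_sum_tail hS hb0 h.p_pos hSb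
            (Finset.notMem_singleton.2 hij) (Finset.singleton_nonempty j) hL)
  have t3 : ∀ a a' i, P {x | B ^ 3 * L / √n < |inner ℝ (m.mean n a - m.mean n a') (x i)|} ≤ K :=
    fun a a' i ↦ (measure_mono fun x hx ↦ lt_of_le_of_lt c2' hx).trans
          (pi_inner_const_tail hS hb0 hSb i (by linarith) (h.mean_le a a') hL)
  have t4 : P {x | B ^ 3 * L <
      |∑ i, (‖x i‖ ^ 2 - ((m.p n : ℝ)⁻¹ • m.cov n (m.cls n i)).trace)|} ≤ K :=
    (measure_mono fun x hx ↦ lt_of_le_of_lt c3' hx).trans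
      (pi_sum_norm_sq_tail hS hb0 h.p_pos h.n_pos hSb L)
  have t5 : ∀ i, P {x | B ^ 3 * L < |inner ℝ (x i) (∑ j ∈ Finset.univ.erase i, x j)|} ≤ K := by
    intro i
    rcases (Finset.univ.erase i).eq_empty_or_nonempty with he | he
    · rw [he]
      have : {x : Fin n → EuclideanSpace ℝ (Fin (m.p n)) |
          B ^ 3 * L < |inner ℝ (x i) (∑ j ∈ ∅, x j)|} = ∅ := by
        ext x
        simp only [Finset.sum_empty, inner_zero_right, abs_zero, mem_ofPred_eq, mem_empty_iff_false,
          iff_false, not_lt]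
        positivity
      rw [this, measure_empty]
      exact zero_le
    · refine le_trans (measure_mono ?_)
        (pi_inner_sum_tail hS hb0 h.p_pos hSb (Finset.notMem_erase i _) he hL)
      intro x hx
      simp only [mem_ofPred_eq] at hx ⊢
      refine lt_of_le_of_lt ?_ hx
      have hcard : ((Finset.univ.erase i).card : ℝ) ≤ n := by
        have := Finset.card_le_univ (Finset.univ.erase i)
        rw [Fintype.card_fin] at this
        exact_mod_cast this
      calc L * (b * √((Finset.univ.erase i).card * m.p n)) ≤ L * (b * √(n * m.p n)) := by gcongr
        _ ≤ _ := c3'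
  exact ⟨t1, t2, t3, t4, t5⟩

theorem BoundedBy.measure_not_noiseBounds_le {n : ℕ} {B : ℝ} (h : m.BoundedBy n B) (hB : 1 ≤ B)
    {L : ℝ} (hL : 0 ≤ L) :
    (Measure.pi fun i ↦ multivariateGaussian 0 ((m.p n : ℝ)⁻¹ • m.cov n (m.cls n i)))
      {x | ¬ m.NoiseBounds n (B ^ 3 * L) x} ≤
      ENNReal.ofReal (4 * (k + 3) ^ 2 * n ^ 2 * Real.exp (-(L / 10))) := by
  obtain ⟨t1, t2, t3, t4, t5⟩ := h.noise_tails hB hL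
  set P := Measure.pi fun i ↦ multivariateGaussian 0 ((m.p n : ℝ)⁻¹ • m.cov n (m.cls n i)) with hP
  set K := ENNReal.ofReal (4 * Real.exp (-(L / 10))) with hK
  have u1 := measure_iUnion_le_card_mul t1
  have u2 := measure_iUnion_le_card_mul fun q : {q : Fin n × Fin n // q.1 ≠ q.2} ↦
    t2 q.1.1 q.1.2 q.2
  have u3 := measure_iUnion_le_card_mul fun q : Fin k × Fin k × Fin n ↦ t3 q.1 q.2.1 q.2.2
  have u5 := measure_iUnion_le_card_mul t5
  have hsub : {x | ¬ m.NoiseBounds n (B ^ 3 * L) x} ⊆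
      ((((⋃ i, {x | B ^ 3 * L / √n <
        |‖x i‖ ^ 2 - ((m.p n : ℝ)⁻¹ • m.cov n (m.cls n i)).trace|}) ∪
      (⋃ q : {q : Fin n × Fin n // q.1 ≠ q.2},
        {x | B ^ 3 * L / √n < |inner ℝ (x q.1.1) (x q.1.2)|})) ∪
      (⋃ q : Fin k × Fin k × Fin n,
        {x | B ^ 3 * L / √n < |inner ℝ (m.mean n q.1 - m.mean n q.2.1) (x q.2.2)|})) ∪
      {x | B ^ 3 * L < |∑ i, (‖x i‖ ^ 2 - ((m.p n : ℝ)⁻¹ • m.cov n (m.cls n i)).trace)|}) ∪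
      (⋃ i, {x | B ^ 3 * L < |inner ℝ (x i) (∑ j ∈ Finset.univ.erase i, x j)|}) := by
    intro x hx
    by_contra hcon
    simp only [mem_union, mem_iUnion, mem_ofPred_eq, not_or, not_exists, not_lt] at hcon hx
    exact hx ⟨hcon.1.1.1.1, fun i j hij ↦ hcon.1.1.1.2 ⟨(i, j), hij⟩,
      fun a a' i ↦ hcon.1.1.2 (a, a', i), hcon.1.2, hcon.2⟩
  refine (measure_mono hsub).trans ?_
  refine (measure_union_le _ _).trans ((add_le_add ((measure_union_le _ _).trans
    (add_le_add ((measure_union_le _ _).trans (add_le_add ((measure_union_le _ _).trans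
      (add_le_add u1 u2)) u3)) t4)) u5).trans ?_)
  have hcard2 : Fintype.card {q : Fin n × Fin n // q.1 ≠ q.2} ≤ n * n := by
    refine (Fintype.card_subtype_le _).trans ?_
    simp
  have hn1 : 1 ≤ n := h.n_pos
  have htot : Fintype.card (Fin n) + Fintype.card {q : Fin n × Fin n // q.1 ≠ q.2} +
      Fintype.card (Fin k × Fin k × Fin n) + 1 + Fintype.card (Fin n) ≤ (k + 3) ^ 2 * n ^ 2 := by
    simp only [Fintype.card_prod, Fintype.card_fin]
    nlinarith [Nat.mul_le_mul_left (k * k) (Nat.mul_le_mul_left n hn1), Nat.mul_le_mul_left n hn1,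
      Nat.zero_le (k * n ^ 2)]
  calc _ = ((Fintype.card (Fin n) + Fintype.card {q : Fin n × Fin n // q.1 ≠ q.2} +
      Fintype.card (Fin k × Fin k × Fin n) + 1 + Fintype.card (Fin n) : ℕ) : ENNReal) * K := by
        push_cast; ring
    _ ≤ (((k + 3) ^ 2 * n ^ 2 : ℕ) : ENNReal) * K := by gcongr
    _ = _ := by
        rw [hK, ← ENNReal.ofReal_natCast, ← ENNReal.ofReal_mul (by positivity)]
        congr 1
        push_cast; ring

end MixtureModel

/-! ### The expansion on the event that the noise is bounded -/

namespace MixtureModel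

variable {k : ℕ} {m : MixtureModel k}

lemma degree_apply (f : ℝ → ℝ) (n : ℕ) (x : Fin n → EuclideanSpace ℝ (Fin (m.p n))) (i : Fin n) :
    m.degree f n x i = ∑ j, f (1 / (m.p n : ℝ) * ‖m.sample n x i - m.sample n x j‖ ^ 2) := by
  simp [degree, K, Matrix.mulVec, dotProduct]

lemma eigvec_apply (f : ℝ → ℝ) (n : ℕ) (x : Fin n → EuclideanSpace ℝ (Fin (m.p n))) (i : Fin n) :
    m.eigvec f n x i = (√(∑ j, m.degree f n x j))⁻¹ * √(m.degree f n x i) := by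
  simp [eigvec, Matrix.mulVec_diagonal, dotProduct]

/-- The squared distances, split as in `abs_row_sum_sub_le`; the last bracket is of order
`1 / n`. -/
lemma dist_sq_sample {n : ℕ} (hp : 0 < m.p n) (x : Fin n → EuclideanSpace ℝ (Fin (m.p n)))
    (i j : Fin n) :
    1 / (m.p n : ℝ) * ‖m.sample n x i - m.sample n x j‖ ^ 2 =
      m.τ n + (‖x i‖ ^ 2 - m.τ n / 2) + (‖x j‖ ^ 2 - m.τ n / 2) - 2 * inner ℝ (x i) (x j) +
      (‖m.mean n (m.cls n i) - m.mean n (m.cls n j)‖ ^ 2 / m.p n +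
        2 / √(m.p n : ℝ) * (inner ℝ (m.mean n (m.cls n i) - m.mean n (m.cls n j)) (x i) -
          inner ℝ (m.mean n (m.cls n i) - m.mean n (m.cls n j)) (x j))) := by
  have hp0 : (0 : ℝ) < m.p n := by exact_mod_cast hp
  have hsp : 0 < √(m.p n : ℝ) := Real.sqrt_pos.2 hp0
  have hsp2 : (m.p n : ℝ) = √(m.p n : ℝ) ^ 2 := (Real.sq_sqrt hp0.le).symm
  set u := m.mean n (m.cls n i) - m.mean n (m.cls n j) with hu
  have h1 : m.sample n x i - m.sample n x j = u + √(m.p n : ℝ) • (x i - x j) := by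
    simp only [sample, hu, smul_sub]; abel
  rw [h1, norm_add_sq_real, norm_smul, inner_smul_right, inner_sub_right, mul_pow,
    Real.norm_eq_abs, abs_of_pos hsp, norm_sub_sq_real (x i) (x j)]
  generalize √(m.p n : ℝ) = q at *
  rw [hsp2]
  field_simp
  ring

/-- The deterministic part of the argument: on the event `NoiseBounds`, the expansion holds with
an error of order `n⁻³ᐟ²`. -/
theorem BoundedBy.norm_eigvec_sub_expansion_le {n : ℕ} {B : ℝ} (h : m.BoundedBy n B) (hB : 1 ≤ B)
    {f : ℝ → ℝ} {δ r M A : ℝ} (hδ : 0 < δ) (hM : 1 ≤ M) (hfδ : δ ≤ f (m.τ n))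
    (hfM : f (m.τ n) ≤ M) (hf'M : |derivWithin f (Ici 0) (m.τ n)| ≤ M)
    (htaylor : ∀ x, 0 ≤ x → |x - m.τ n| ≤ r →
      |f x - f (m.τ n) - derivWithin f (Ici 0) (m.τ n) * (x - m.τ n)| ≤ M * (x - m.τ n) ^ 2)
    (hA : 1 ≤ A) {H C κ : ℝ} (hH : H = 5 * B ^ 3 + 1)
    (hC : C = |f 0| + M + M * (3 * H + 3) + M * (3 * H + 2) ^ 2)
    (hκ : κ = M / δ * H + C / δ + 1) (hr : (3 * H + 2) * (A / √n) ≤ r)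
    (hsmall : κ * (A / √n) ≤ 1 / 4) {x : Fin n → EuclideanSpace ℝ (Fin (m.p n))}
    (hx : m.NoiseBounds n A x) :
    ‖m.eigvec f n x - m.expansion f n (fun i ↦ √(m.p n : ℝ) *
      (‖x i‖ ^ 2 - ((m.p n : ℝ)⁻¹ • m.cov n (m.cls n i)).trace))‖ ≤
      11 * κ ^ 2 * A ^ 2 / (n * √n) := by
  have hn0 : (0 : ℝ) < n := by exact_mod_cast h.n_pos
  have hp0 : (0 : ℝ) < m.p n := by exact_mod_cast h.p_pos
  have hsn : 0 < √(n : ℝ) := Real.sqrt_pos.2 hn0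
  have hsp : 0 < √(m.p n : ℝ) := Real.sqrt_pos.2 hp0
  have hsn2 : √(n : ℝ) ^ 2 = n := Real.sq_sqrt hn0.le
  have hB2 : B ≤ B ^ 2 := by nlinarith
  have hB3 : B ^ 2 ≤ B ^ 3 := pow_le_pow_right₀ hB (by norm_num)
  have hH1 : 1 ≤ H := by rw [hH]; nlinarith
  have hinv : 1 / √(m.p n : ℝ) ≤ B / √n := by
    rw [div_le_div_iff₀ hsp hsn]; linarith [h.sqrt_n_le hB]
  have hinv2 : 1 / (m.p n : ℝ) ≤ B / n := by
    rw [div_le_div_iff₀ hp0 hn0]; linarith [h.n_le]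
  have hC1 : 1 ≤ C := by
    rw [hC]
    have : 0 ≤ |f 0| := abs_nonneg _
    have : 0 ≤ M * (3 * H + 3) := by positivity
    have : 0 ≤ M * (3 * H + 2) ^ 2 := by positivity
    linarith
  set s : Fin n → ℝ := fun i ↦ ‖x i‖ ^ 2 - m.τ n / 2 with hs
  set ψ' : Fin n → ℝ := fun i ↦ ‖x i‖ ^ 2 - ((m.p n : ℝ)⁻¹ • m.cov n (m.cls n i)).trace with hψ'
  have hsψ : ∀ i, s i = m.t n (m.cls n i) / √(m.p n : ℝ) + ψ' i := by
    intro i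
    simp only [hs, hψ', m.trace_cov_div h.p_pos]
    ring
  have hsum : ∑ i, s i = ∑ i, ψ' i := by
    simp_rw [hsψ]
    rw [Finset.sum_add_distrib, ← Finset.sum_div, m.sum_t h.n_pos, zero_div, zero_add]
  have hsb : ∀ i, |s i| ≤ H * (A / √n) := by
    intro i
    rw [hsψ]
    refine (abs_add_le _ _).trans ?_
    have h1 : |m.t n (m.cls n i) / √(m.p n : ℝ)| ≤ B ^ 3 * (A / √n) := by
      rw [abs_div, abs_of_pos hsp]
      calc |m.t n (m.cls n i)| / √(m.p n : ℝ) = |m.t n (m.cls n i)| * (1 / √(m.p n : ℝ)) := by ring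
        _ ≤ B * (B / √n) := by gcongr; exact h.t_le _
        _ = B ^ 2 * (1 / √n) := by ring
        _ ≤ B ^ 3 * (A / √n) := by gcongr
    have h2 := hx.norm_sq_le i
    have h3 : 0 ≤ B ^ 3 * (A / √n) := by positivity
    calc _ ≤ B ^ 3 * (A / √n) + A / √n := add_le_add h1 h2
      _ ≤ _ := by rw [hH]; linarith
  set hh : Fin n → Fin n → ℝ := fun i j ↦
    ‖m.mean n (m.cls n i) - m.mean n (m.cls n j)‖ ^ 2 / m.p n +
        2 / √(m.p n : ℝ) * (inner ℝ (m.mean n (m.cls n i) - m.mean n (m.cls n j)) (x i) -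
          inner ℝ (m.mean n (m.cls n i) - m.mean n (m.cls n j)) (x j)) with hhdef
  have hhb : ∀ i j, |hh i j| ≤ H * (A / n) := by
    intro i j
    simp only [hhdef]
    refine (abs_add_le _ _).trans ?_
    have h1 : |‖m.mean n (m.cls n i) - m.mean n (m.cls n j)‖ ^ 2 / (m.p n : ℝ)| ≤
        B ^ 3 * (A / n) := by
      rw [abs_of_nonneg (by positivity)]
      calc ‖m.mean n (m.cls n i) - m.mean n (m.cls n j)‖ ^ 2 / (m.p n : ℝ) =
            ‖m.mean n (m.cls n i) - m.mean n (m.cls n j)‖ ^ 2 * (1 / (m.p n : ℝ)) := by ring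
        _ ≤ B ^ 2 * (B / n) := by gcongr; exact h.mean_le _ _
        _ = B ^ 3 * (1 / n) := by ring
        _ ≤ B ^ 3 * (A / n) := by gcongr
    have h2 : |2 / √(m.p n : ℝ) * (inner ℝ (m.mean n (m.cls n i) - m.mean n (m.cls n j)) (x i) -
          inner ℝ (m.mean n (m.cls n i) - m.mean n (m.cls n j)) (x j))| ≤ 4 * B ^ 3 * (A / n) := by
      rw [abs_mul, abs_of_pos (by positivity)]
      have h3 := abs_sub (inner ℝ (m.mean n (m.cls n i) - m.mean n (m.cls n j)) (x i))
        (inner ℝ (m.mean n (m.cls n i) - m.mean n (m.cls n j)) (x j))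
      have h4 := hx.mean_le (m.cls n i) (m.cls n j) i
      have h5 := hx.mean_le (m.cls n i) (m.cls n j) j
      calc _ ≤ 2 * (1 / √(m.p n : ℝ)) * (2 * (A / √n)) := by
            rw [mul_one_div]
            gcongr
            linarith
        _ ≤ 2 * (B / √n) * (2 * (A / √n)) := by gcongr
        _ = 4 * B * (A / √n ^ 2) := by ring
        _ = 4 * B * (A / n) := by rw [hsn2]
        _ ≤ _ := by gcongr; linarith
    have h6 : 0 ≤ A / n := by positivity
    rw [hH]
    linarith
  have hD := abs_row_sum_sub_le h.n_pos hM (hδ.le.trans hfδ) hfM hf'M htaylor hA hH1 hr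
    (d := fun i j ↦ 1 / (m.p n : ℝ) * ‖m.sample n x i - m.sample n x j‖ ^ 2)
    (G := fun i j ↦ inner ℝ (x i) (x j)) (h := hh) (s := s) (f₀ := |f 0|)
    (fun i j ↦ by positivity) (fun i ↦ by simp) (fun i j _ ↦ m.dist_sq_sample h.p_pos x i j)
    hsb (hsum ▸ hx.sum_le) hx.inner_le (fun i ↦ by rw [← inner_sum]; exact hx.inner_sum_le i) hhb
  simp only [← degree_apply, ← hC] at hD
  have hmain := abs_normalized_sqrt_sub_le h.n_pos hδ hfδ hf'M hA hH1 hC1 hM hsb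
    (hsum ▸ hx.sum_le) hD (by rw [← hκ]; exact hsmall)
  refine (pi_norm_le_iff_of_nonneg (by positivity)).2 fun i ↦ ?_
  rw [Pi.sub_apply, Real.norm_eq_abs, eigvec_apply]
  have hexp : m.expansion f n (fun i ↦ √(m.p n : ℝ) * ψ' i) i =
      1 / √n * (1 + derivWithin f (Ici 0) (m.τ n) / (2 * f (m.τ n)) * s i) := by
    have hc : (n : ℝ) * √(m.c₀ n) = √n * √(m.p n : ℝ) := by
      rw [c₀, Real.sqrt_div hp0.le]
      nth_rewrite 1 [← hsn2]
      field_simp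
    simp only [expansion]
    rw [hc, hsψ]
    field_simp
  rw [hexp, hκ]
  exact hmain i

end MixtureModel

/-! ### Negligible events -/

section Negligible

variable {Ω : Type*} [MeasurableSpace Ω] {Pr : Measure Ω}

/-- Events whose probability decays faster than every power of `n`. -/
def IsNegligible (Pr : Measure Ω) (S : ℕ → Set Ω) : Prop :=
  ∀ d > (0 : ℝ), Tendsto (fun n : ℕ ↦ (n : ℝ) ^ d * Pr.real (S n)) atTop (𝓝 0)

lemma eventually_mul_rpow_lt_rpow {a b : ℝ} (h : a < b) (c : ℝ) :
    ∀ᶠ n : ℕ in atTop, c * (n : ℝ) ^ a < (n : ℝ) ^ b := by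
  have h1 : Tendsto (fun n : ℕ ↦ (n : ℝ) ^ (b - a)) atTop atTop :=
    (tendsto_rpow_atTop (sub_pos.2 h)).comp tendsto_natCast_atTop_atTop
  filter_upwards [h1.eventually_gt_atTop c, eventually_gt_atTop 0] with n hn hn0
  have hn0' : (0 : ℝ) < n := by exact_mod_cast hn0
  calc c * (n : ℝ) ^ a < (n : ℝ) ^ (b - a) * (n : ℝ) ^ a := by gcongr
    _ = (n : ℝ) ^ b := by rw [← Real.rpow_add hn0']; ring_nf

lemma isNegligible_of_le_exp {S : ℕ → Set Ω} {K q c η : ℝ} (hc : 0 < c) (hη : 0 < η)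
    (hK : 0 ≤ K) (h : ∀ᶠ n : ℕ in atTop,
      Pr (S n) ≤ ENNReal.ofReal (K * (n : ℝ) ^ q * Real.exp (-(c * (n : ℝ) ^ η)))) :
    IsNegligible Pr S := by
  intro d hd
  have h1 : Tendsto (fun n : ℕ ↦ (n : ℝ) ^ η) atTop atTop :=
    (tendsto_rpow_atTop hη).comp tendsto_natCast_atTop_atTop
  have h2 := ((tendsto_rpow_mul_exp_neg_mul_atTop_nhds_zero ((d + q) / η) c hc).comp h1).const_mul K
  rw [mul_zero] at h2
  refine squeeze_zero' (Eventually.of_forall fun n ↦ by positivity) ?_ h2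
  filter_upwards [h, eventually_gt_atTop 0] with n hn hn0
  have hn0' : (0 : ℝ) < n := by exact_mod_cast hn0
  have h3 : Pr.real (S n) ≤ K * (n : ℝ) ^ q * Real.exp (-(c * (n : ℝ) ^ η)) :=
    ENNReal.toReal_le_of_le_ofReal (by positivity) hn
  calc (n : ℝ) ^ d * Pr.real (S n)
      ≤ (n : ℝ) ^ d * (K * (n : ℝ) ^ q * Real.exp (-(c * (n : ℝ) ^ η))) := by gcongr
    _ = K * (((n : ℝ) ^ η) ^ ((d + q) / η) * Real.exp (-c * (n : ℝ) ^ η)) := by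
        rw [← Real.rpow_mul hn0'.le, mul_div_cancel₀ _ hη.ne', Real.rpow_add hn0', neg_mul]
        ring

/-- An error that is below `n^{-α-1}` off negligible events is `o(n⁻¹)` in both senses; the almost
sure one is the Borel–Cantelli lemma. -/
theorem IsNegligible.isLittleO_inv [IsFiniteMeasure Pr] {S : ℕ → Set Ω} (hS : IsNegligible Pr S)
    {v : (n : ℕ) → Ω → Fin n → ℝ} {α : ℝ} (hα : 0 < α)
    (h : ∀ᶠ n : ℕ in atTop, ∀ ω, ω ∉ S n → ‖v n ω‖ < (n : ℝ) ^ (-α - 1)) :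
    IsLittleOEntrywise Pr v (fun n ↦ (n : ℝ)⁻¹) ∧
      IsLittleOEntrywiseAS Pr v (fun n ↦ (n : ℝ)⁻¹) := by
  have hpow : ∀ n : ℕ, 0 < n → (n : ℝ) ^ (-α - 1) = (n : ℝ) ^ (-α) * (n : ℝ)⁻¹ := by
    intro n hn
    rw [Real.rpow_sub (by exact_mod_cast hn), Real.rpow_one, div_eq_mul_inv]
  constructor
  · refine ⟨α, hα, fun η hη d hd ↦ ?_⟩
    refine squeeze_zero' (Eventually.of_forall fun n ↦ by positivity) ?_ (hS d hd)
    filter_upwards [h, eventually_gt_atTop 0] with n hn hn0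
    gcongr
    · exact measure_ne_top _ _
    · intro ω hω
      by_contra hcon
      have h1 := hn ω hcon
      rw [hpow n hn0] at h1
      have h2 : (1 : ℝ) ≤ (n : ℝ) ^ η := Real.one_le_rpow (by exact_mod_cast hn0) hη.le
      have h3 : 0 ≤ (n : ℝ) ^ (-α) * (n : ℝ)⁻¹ := by positivity
      have h4 : (n : ℝ) ^ η * ((n : ℝ) ^ (-α) * (n : ℝ)⁻¹) ≤ ‖v n ω‖ := hω
      nlinarith
  · have hsum : Summable fun n ↦ Pr.real (S n) := by
      refine Summable.of_norm_bounded_eventually_nat (g := fun n : ℕ ↦ 1 / (n : ℝ) ^ 2)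
        (Real.summable_one_div_nat_pow.2 one_lt_two) ?_
      filter_upwards [(hS 2 two_pos).eventually_le_const one_pos, eventually_gt_atTop 0]
        with n hn hn0
      have hn0' : (0 : ℝ) < n := by exact_mod_cast hn0
      rw [Real.norm_eq_abs, abs_of_nonneg measureReal_nonneg, le_div_iff₀ (by positivity), mul_comm]
      simpa using hn
    have htop : ∑' n, Pr (S n) ≠ ⊤ := by
      have := hsum.tsum_ofReal_ne_top
      simpa using this
    filter_upwards [ae_eventually_notMem htop] with ω hω
    rw [Asymptotics.isLittleO_iff]
    intro c hc
    have hlim : Tendsto (fun n : ℕ ↦ (n : ℝ) ^ (-α)) atTop (𝓝 0) :=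
      (tendsto_rpow_neg_atTop hα).comp tendsto_natCast_atTop_atTop
    filter_upwards [hω, h, hlim.eventually_le_const hc, eventually_gt_atTop 0] with n h1 h2 h3 h4
    have h5 := h2 ω h1
    rw [hpow n h4] at h5
    rw [norm_norm, Real.norm_eq_abs, abs_of_nonneg (by positivity)]
    exact h5.le.trans (by gcongr)

end Negligible

namespace MixtureModel

variable {k : ℕ} {m : MixtureModel k} {Ω : Type*} [MeasurableSpace Ω] {Pr : Measure Ω}
  {w : (n : ℕ) → Fin n → Ω → EuclideanSpace ℝ (Fin (m.p n))}

lemma IsNoise.ψ_eq (hw : m.IsNoise Pr w) {n : ℕ} (ω : Ω) (i : Fin n) :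
    m.ψ Pr w n ω i = ‖w n i ω‖ ^ 2 - ((m.p n : ℝ)⁻¹ • m.cov n (m.cls n i)).trace := by
  have hS : ((m.p n : ℝ)⁻¹ • m.cov n (m.cls n i)).PosSemidef :=
    (m.posSemidef_cov n _).smul (inv_nonneg.2 (Nat.cast_nonneg _))
  have h1 := (hw.law n i).integral_comp (f := fun x ↦ ‖x‖ ^ 2) (by fun_prop)
  rw [integral_norm_sq_multivariateGaussian hS] at h1
  rw [ψ, ← h1]
  rfl

lemma IsNoise.measure_not_noiseBounds_le [IsProbabilityMeasure Pr] (hw : m.IsNoise Pr w) {n : ℕ}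
    {B : ℝ} (h : m.BoundedBy n B) (hB : 1 ≤ B) {L : ℝ} (hL : 0 ≤ L) :
    Pr {ω | ¬ m.NoiseBounds n (B ^ 3 * L) fun i ↦ w n i ω} ≤
      ENNReal.ofReal (4 * (k + 3) ^ 2 * n ^ 2 * Real.exp (-(L / 10))) := by
  have hm : ∀ i, AEMeasurable (w n i) Pr := fun i ↦ (hw.law n i).aemeasurable
  have h1 := (iIndepFun_iff_map_fun_eq_pi_map hm).1 (hw.indep n)
  have h2 := h.measure_not_noiseBounds_le hB hL
  simp_rw [fun i ↦ (hw.law n i).map_eq] at h1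
  rw [← h1] at h2
  exact (Measure.le_map_apply (aemeasurable_pi_lambda _ hm) _).trans h2

/-- The deterministic expansion on `NoiseBounds` at the level `n^{1/64}`, with the constants of the
the growth rate and kernel assumptions, chosen once for all large `n`. -/
theorem exists_norm_eigvec_sub_expansion_le (hm : m.GrowthRate) {f : ℝ → ℝ}
    (hf : KernelAssumption f m.τ) : ∃ B, 1 ≤ B ∧ ∃ c, 0 ≤ c ∧ ∀ᶠ n : ℕ in atTop, m.BoundedBy n B ∧
      |derivWithin f (Ici 0) (m.τ n) / (2 * f (m.τ n))| ≤ c ∧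
      ∀ x, m.NoiseBounds n (B ^ 3 * (n : ℝ) ^ (1 / 64 : ℝ)) x →
        ‖m.eigvec f n x - m.expansion f n (fun i ↦ √(m.p n : ℝ) *
          (‖x i‖ ^ 2 - ((m.p n : ℝ)⁻¹ • m.cov n (m.cls n i)).trace))‖ ≤
          c * (n : ℝ) ^ (1 / 32 - 3 / 2 : ℝ) := by
  obtain ⟨B, hB, hbd⟩ := hm.exists_boundedBy
  obtain ⟨δ, hδ, r, hr, M, hM, hker⟩ := hf.exists_taylor_bound (B := B)
    (hbd.mono fun n h ↦ ⟨h.τ_nonneg, h.τ_le⟩)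
  set H := 5 * B ^ 3 + 1 with hH
  set C := |f 0| + M + M * (3 * H + 3) + M * (3 * H + 2) ^ 2 with hC
  set κ := M / δ * H + C / δ + 1 with hκ
  refine ⟨B, hB, max (M / δ) (11 * κ ^ 2 * B ^ 6), le_max_of_le_right (by positivity), ?_⟩
  filter_upwards [hbd, hker, eventually_gt_atTop 0,
    eventually_mul_rpow_lt_rpow (a := 1 / 64) (b := 1 / 2) (by norm_num) ((3 * H + 2) * B ^ 3 / r),
    eventually_mul_rpow_lt_rpow (a := 1 / 64) (b := 1 / 2) (by norm_num) (κ * B ^ 3 * 4)]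
    with n h1 h2 hn h3 h4
  obtain ⟨k1, k2, k3, k4⟩ := h2
  have hn0 : (0 : ℝ) < n := by exact_mod_cast hn
  have hsn : 0 < √(n : ℝ) := Real.sqrt_pos.2 hn0
  have hB3 : 1 ≤ B ^ 3 := one_le_pow₀ hB
  have hL : 1 ≤ (n : ℝ) ^ (1 / 64 : ℝ) := Real.one_le_rpow (by exact_mod_cast hn) (by norm_num)
  rw [← Real.sqrt_eq_rpow] at h3 h4
  refine ⟨h1, ?_, fun x hx ↦ ?_⟩
  · refine le_max_of_le_left ?_
    have hf0 : 0 < f (m.τ n) := by linarith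
    rw [abs_div, abs_of_pos (by linarith : 0 < 2 * f (m.τ n))]
    exact div_le_div₀ (by linarith) k3 hδ (by linarith)
  · refine (h1.norm_eigvec_sub_expansion_le hB hδ hM k1 k2 k3 k4 (by nlinarith) hH hC hκ ?_ ?_
      hx).trans ?_
    · rw [mul_div_assoc', div_le_iff₀ hsn]
      rw [div_mul_eq_mul_div, div_lt_iff₀ hr] at h3
      linarith
    · rw [mul_div_assoc', div_le_iff₀ hsn]
      linarith
    · have e1 : 11 * κ ^ 2 * (B ^ 3 * (n : ℝ) ^ (1 / 64 : ℝ)) ^ 2 / (n * √n) =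
          11 * κ ^ 2 * B ^ 6 * (n : ℝ) ^ (1 / 32 - 3 / 2 : ℝ) := by
        have e2 : (n : ℝ) ^ (1 / 32 : ℝ) = ((n : ℝ) ^ (1 / 64 : ℝ)) ^ 2 := by
          rw [← Real.rpow_natCast, ← Real.rpow_mul hn0.le]; norm_num
        have e3 : (n : ℝ) ^ (3 / 2 : ℝ) = n * √n := by
          rw [Real.sqrt_eq_rpow]
          nth_rewrite 2 [← Real.rpow_one (n : ℝ)]
          rw [← Real.rpow_add hn0]; norm_num
        rw [Real.rpow_sub hn0, e2, e3]
        ring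
      rw [e1]
      gcongr
      exact le_max_right _ _

lemma IsNoise.isNegligible_not_noiseBounds [IsProbabilityMeasure Pr] (hw : m.IsNoise Pr w)
    {B : ℝ} (hB : 1 ≤ B) (h : ∀ᶠ n in atTop, m.BoundedBy n B) :
    IsNegligible Pr fun n ↦
      {ω | ¬ m.NoiseBounds n (B ^ 3 * (n : ℝ) ^ (1 / 64 : ℝ)) fun i ↦ w n i ω} := by
  refine isNegligible_of_le_exp (K := 4 * (k + 3) ^ 2) (q := 2) (c := 1 / 10) (η := 1 / 64)
    (by norm_num) (by norm_num) (by positivity) ?_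
  filter_upwards [h] with n hn
  refine (hw.measure_not_noiseBounds_le hn hB (by positivity)).trans (le_of_eq ?_)
  rw [Real.rpow_two]
  congr 3
  ring

end MixtureModel

/-! ### Gaussian fluctuations -/

namespace MixtureModel

variable {k : ℕ} {m : MixtureModel k}

/-- With about `n^{1/4}` steps of the coupled walk, the coupling error is of order `n^{-1/8}`. -/
lemma BoundedBy.exists_coupling {n : ℕ} {B : ℝ} (h : m.BoundedBy n B) (hB : 1 ≤ B) (a : Fin k) :
    ∃ ρ : Measure (EuclideanSpace ℝ (Fin (m.p n)) × ℝ),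
      ρ.map Prod.fst = multivariateGaussian 0 ((m.p n : ℝ)⁻¹ • m.cov n a) ∧
      ρ.map Prod.snd = gaussianReal 0 1 ∧
      ∀ L : ℝ, 1 ≤ L → ρ {x | 7 * B ^ 2 * L ^ 2 * (n : ℝ) ^ (-1 / 8 : ℝ) <
        |√(m.p n : ℝ) * (‖x.1‖ ^ 2 - ((m.p n : ℝ)⁻¹ • m.cov n a).trace) - m.stdDev n a * x.2|} ≤
        ENNReal.ofReal (32 * n * Real.exp (-(L / 10))) := by
  have hn0 : (0 : ℝ) < n := by exact_mod_cast h.n_pos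
  have hn1 : (1 : ℝ) ≤ n := by exact_mod_cast h.n_pos
  have hp0 : (0 : ℝ) < m.p n := by exact_mod_cast h.p_pos
  set q := (n : ℝ) ^ (1 / 8 : ℝ) with hq
  have hq1 : 1 ≤ q := Real.one_le_rpow hn1 (by norm_num)
  have hq0 : 0 < q := by linarith
  have hq4 : q ^ 4 = √n := by
    rw [hq, ← Real.rpow_natCast, ← Real.rpow_mul hn0.le, Real.sqrt_eq_rpow]; norm_num
  have hqinv : (n : ℝ) ^ (-1 / 8 : ℝ) = 1 / q := by
    rw [hq, one_div, ← Real.rpow_neg hn0.le]; norm_num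
  set N := ⌈q ^ 2⌉₊ with hN
  have hN1 : q ^ 2 ≤ N := Nat.le_ceil _
  have hN2 : (N : ℝ) ≤ 2 * q ^ 2 := by
    have := (Nat.ceil_lt_add_one (sq_nonneg q)).le
    nlinarith
  have hN0 : 0 < N := Nat.ceil_pos.2 (by positivity)
  have hNn : (N : ℝ) ≤ 2 * n := by
    refine hN2.trans ?_
    have h1 : q ^ 2 ≤ q ^ 8 := pow_le_pow_right₀ hq1 (by norm_num)
    have h2 : q ^ 8 = (n : ℝ) := by
      calc q ^ 8 = (q ^ 4) ^ 2 := by ring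
        _ = (n : ℝ) := by rw [hq4, Real.sq_sqrt hn0.le]
    linarith
  obtain ⟨ρ, h1, h2, h3⟩ := exists_coupling_norm_sq (m.posSemidef_cov n a) h.p_pos (B := B)
    (by linarith) (h.cov_le a) hN0
  refine ⟨ρ, h1, h2, fun L hL ↦ ?_⟩
  have hsN : q ≤ √(N : ℝ) := Real.le_sqrt_of_sq_le hN1
  have hsN2 : √(N : ℝ) ≤ 2 * q := Real.sqrt_le_iff.2 ⟨by positivity, by nlinarith⟩
  have hsp : q ^ 2 ≤ B * √(√(m.p n : ℝ)) := by
    have e : q ^ 2 = √(√n) := by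
      rw [← hq4, show q ^ 4 = (q ^ 2) ^ 2 by ring, Real.sqrt_sq (by positivity)]
    rw [e]
    apply Real.sqrt_le_iff.2
    refine ⟨by positivity, ?_⟩
    rw [mul_pow, Real.sq_sqrt (Real.sqrt_nonneg _)]
    refine (h.sqrt_n_le hB).trans ?_
    gcongr
    nlinarith
  have hssp : 0 < √(√(m.p n : ℝ)) := Real.sqrt_pos.2 (Real.sqrt_pos.2 hp0)
  have hthr : L ^ 2 * B * (3 / √N + 2 * √N / √(√(m.p n : ℝ))) ≤
      7 * B ^ 2 * L ^ 2 * (n : ℝ) ^ (-1 / 8 : ℝ) := by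
    rw [hqinv]
    have f1 : 3 / √(N : ℝ) ≤ 3 * B * (1 / q) := by
      rw [mul_one_div]
      gcongr
      linarith
    have f2 : 2 * √(N : ℝ) / √(√(m.p n : ℝ)) ≤ 4 * B * (1 / q) := by
      rw [mul_one_div, div_le_div_iff₀ hssp hq0]
      calc 2 * √(N : ℝ) * q ≤ 2 * (2 * q) * q := by gcongr
        _ = 4 * q ^ 2 := by ring
        _ ≤ 4 * (B * √(√(m.p n : ℝ))) := by gcongr
        _ = _ := by ring
    calc _ ≤ L ^ 2 * B * (3 * B * (1 / q) + 4 * B * (1 / q)) := by gcongr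
      _ = _ := by ring
  refine (measure_mono fun x hx ↦ ?_).trans ((h3 L hL).trans (ENNReal.ofReal_le_ofReal ?_))
  · exact lt_of_le_of_lt hthr hx
  · have := Real.exp_pos (-(L / 10))
    nlinarith

lemma expansion_sub (f : ℝ → ℝ) (n : ℕ) (v v' : Fin n → ℝ) (i : Fin n) :
    m.expansion f n v i - m.expansion f n v' i = 1 / (n * √(m.c₀ n)) *
      (derivWithin f (Ici 0) (m.τ n) / (2 * f (m.τ n))) * (v i - v' i) := by
  simp only [expansion]; ring

lemma BoundedBy.norm_expansion_sub_le {n : ℕ} {B : ℝ} (h : m.BoundedBy n B) (hB : 1 ≤ B)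
    {f : ℝ → ℝ} {c e : ℝ} (hf : |derivWithin f (Ici 0) (m.τ n) / (2 * f (m.τ n))| ≤ c)
    {v v' : Fin n → ℝ} (he : 0 ≤ e) (hv : ∀ i, |v i - v' i| ≤ e) :
    ‖m.expansion f n v - m.expansion f n v'‖ ≤ B * c * e * (n : ℝ)⁻¹ := by
  have hn0 : (0 : ℝ) < n := by exact_mod_cast h.n_pos
  have hp0 : (0 : ℝ) < m.p n := by exact_mod_cast h.p_pos
  have hc0 : 0 ≤ c := (abs_nonneg _).trans hf
  refine (pi_norm_le_iff_of_nonneg (by positivity)).2 fun i ↦ ?_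
  rw [Pi.sub_apply, expansion_sub, Real.norm_eq_abs, abs_mul, abs_mul]
  have h1 : |1 / (n * √(m.c₀ n))| ≤ B * (n : ℝ)⁻¹ := by
    have hc : (n : ℝ) * √(m.c₀ n) = √n * √(m.p n : ℝ) := by
      rw [c₀, Real.sqrt_div hp0.le]
      nth_rewrite 1 [← Real.sq_sqrt hn0.le]
      field_simp
    rw [hc, abs_of_nonneg (by positivity), ← div_eq_mul_inv,
      div_le_div_iff₀ (by positivity) hn0, one_mul]
    calc (n : ℝ) = √n * √n := (Real.mul_self_sqrt hn0.le).symm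
      _ ≤ √n * (B * √(m.p n : ℝ)) := by gcongr; exact h.sqrt_n_le hB
      _ = _ := by ring
  calc _ ≤ (B * (n : ℝ)⁻¹) * c * e := by gcongr; exact hv i
    _ = _ := by ring

end MixtureModel

theorem mainTheorem4 {k : ℕ} (m : MixtureModel k) (hm : m.GrowthRate)
    (f : ℝ → ℝ) (hf : KernelAssumption f m.τ)
    {Ω : Type u} [MeasurableSpace Ω] (Pr : Measure Ω) [IsProbabilityMeasure Pr]
    (w : (n : ℕ) → Fin n → Ω → EuclideanSpace ℝ (Fin (m.p n))) (hw : m.IsNoise Pr w) :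
    -- expansion with the explicit fluctuation vector `√p ψ`
    (IsLittleOEntrywise Pr
        (fun n ω => m.eigvec f n (fun i => w n i ω) -
          m.expansion f n (fun i => √(m.p n : ℝ) * m.ψ Pr w n ω i))
        (fun n => (n : ℝ)⁻¹) ∧
      IsLittleOEntrywiseAS Pr
        (fun n ω => m.eigvec f n (fun i => w n i ω) -
          m.expansion f n (fun i => √(m.p n : ℝ) * m.ψ Pr w n ω i))
        (fun n => (n : ℝ)⁻¹)) ∧
    -- expansion with Gaussian vectors `φ ∼ N(0, I_n)`, on an extension of the probability space
    ∃ (Ω' : Type u) (_ : MeasurableSpace Ω') (Pr' : Measure Ω') (π : Ω' → Ω)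
      (φ : (n : ℕ) → Ω' → EuclideanSpace ℝ (Fin n)),
      IsProbabilityMeasure Pr' ∧ MeasurePreserving π Pr' Pr ∧
      (∀ n, HasLaw (φ n) (stdGaussian (EuclideanSpace ℝ (Fin n))) Pr') ∧
      IsLittleOEntrywise Pr'
        (fun n ω => m.eigvec f n (fun i => w n i (π ω)) -
          m.expansion f n (fun i => m.stdDev n (m.cls n i) * φ n ω i))
        (fun n => (n : ℝ)⁻¹) ∧
      IsLittleOEntrywiseAS Pr'
        (fun n ω => m.eigvec f n (fun i => w n i (π ω)) -
          m.expansion f n (fun i => m.stdDev n (m.cls n i) * φ n ω i))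
        (fun n => (n : ℝ)⁻¹) := by
  -- Deviations are taken at the level `L = n^{1/64}`. The expansion then has an error of order
  -- `L² n^{-3/2}`, and the coupling one of order `L² n^{-1/8}` times `n^{-1}`; both are smaller
  -- than `n^{-1/16 - 1}`.
  obtain ⟨B, hB, c, hc, hev⟩ := m.exists_norm_eigvec_sub_expansion_le hm hf
  have hbd : ∀ᶠ n in atTop, m.BoundedBy n B := hev.mono fun n h ↦ h.1
  have hneg := hw.isNegligible_not_noiseBounds hB hbd
  set S : ℕ → Set Ω := fun n ↦
    {ω | ¬ m.NoiseBounds n (B ^ 3 * (n : ℝ) ^ (1 / 64 : ℝ)) fun i ↦ w n i ω} with hS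
  simp only [hw.ψ_eq]
  refine ⟨hneg.isLittleO_inv (α := 1 / 16) (by norm_num) ?_, ?_⟩
  · filter_upwards [hev, eventually_mul_rpow_lt_rpow (a := 1 / 32 - 3 / 2) (b := -(1 / 16) - 1)
      (by norm_num) c] with n h1 h2 ω hω
    simp only [hS, mem_ofPred_eq, not_not] at hω
    exact (h1.2.2 _ hω).trans_lt h2
  -- couplings for all sample sizes, with an arbitrary choice for the sizes that are too small
  have hcoup : ∀ n (i : Fin n), ∃ ρ : Measure (EuclideanSpace ℝ (Fin (m.p n)) × ℝ),
      ρ.map Prod.fst = Pr.map (w n i) ∧ ρ.map Prod.snd = gaussianReal 0 1 ∧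
      (m.BoundedBy n B → ∀ L : ℝ, 1 ≤ L → ρ {x | 7 * B ^ 2 * L ^ 2 * (n : ℝ) ^ (-1 / 8 : ℝ) <
        |√(m.p n : ℝ) * (‖x.1‖ ^ 2 - ((m.p n : ℝ)⁻¹ • m.cov n (m.cls n i)).trace) -
          m.stdDev n (m.cls n i) * x.2|} ≤ ENNReal.ofReal (32 * n * Real.exp (-(L / 10)))) := by
    intro n i
    rw [(hw.law n i).map_eq]
    by_cases h : m.BoundedBy n B
    · obtain ⟨ρ, h1, h2, h3⟩ := h.exists_coupling hB (m.cls n i)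
      exact ⟨ρ, h1, h2, fun _ ↦ h3⟩
    · exact ⟨(multivariateGaussian 0 ((m.p n : ℝ)⁻¹ • m.cov n (m.cls n i))).prod (gaussianReal 0 1),
        measurePreserving_fst.map_eq, measurePreserving_snd.map_eq, fun h' ↦ (h h').elim⟩
  choose ρ hρ1 hρ2 hρ3 using hcoup
  have hwm : ∀ n i, AEMeasurable (w n i) Pr := fun n i ↦ (hw.law n i).aemeasurable
  have hρp : ∀ n i, IsProbabilityMeasure (ρ n i) := by
    intro n i
    have h1 : IsProbabilityMeasure ((ρ n i).map Prod.snd) := by rw [hρ2]; infer_instance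
    exact Measure.isProbabilityMeasure_of_map Prod.snd
  obtain ⟨Ω', mΩ', Pr', π, φ, hPr', hπ, hφm, hφi, hφlaw⟩ :=
    exists_extension_of_couplings Pr w hwm hw.indep ρ hρ1
  refine ⟨Ω', mΩ', Pr', π, fun n ω ↦ WithLp.toLp 2 fun i ↦ φ n i ω, hPr', hπ, fun n ↦ ?_, ?_⟩
  · have hφm' : ∀ i, AEMeasurable (φ n i) Pr' := fun i ↦ (hφm n i).snd
    have h1 : ∀ i, Pr'.map (φ n i) = gaussianReal 0 1 := by
      intro i
      rw [← hρ2 n i, ← hφlaw n i,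
        AEMeasurable.map_map_of_aemeasurable measurable_snd.aemeasurable (hφm n i)]
      rfl
    have h2 := (iIndepFun_iff_map_fun_eq_pi_map hφm').1 (hφi n)
    simp_rw [h1] at h2
    refine ⟨by fun_prop, ?_⟩
    rw [← map_pi_eq_stdGaussian, ← h2, AEMeasurable.map_map_of_aemeasurable (by fun_prop)
      (aemeasurable_pi_lambda _ hφm')]
    rfl
  · set L : ℕ → ℝ := fun n ↦ (n : ℝ) ^ (1 / 64 : ℝ) with hL
    set e : ℕ → ℝ := fun n ↦ 7 * B ^ 2 * L n ^ 2 * (n : ℝ) ^ (-1 / 8 : ℝ) with he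
    set W : (n : ℕ) → Fin n → Set Ω' := fun n i ↦ {ω | e n <
      |√(m.p n : ℝ) * (‖w n i (π ω)‖ ^ 2 - ((m.p n : ℝ)⁻¹ • m.cov n (m.cls n i)).trace) -
        m.stdDev n (m.cls n i) * φ n i ω|} with hW
    have hWm : ∀ n i, m.BoundedBy n B →
        Pr' (W n i) ≤ ENNReal.ofReal (32 * n * Real.exp (-(L n / 10))) := by
      intro n i hn
      refine le_trans ?_ (hρ3 n i hn (L n) (Real.one_le_rpow (by exact_mod_cast hn.n_pos)
        (by norm_num)))
      rw [← hφlaw n i]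
      exact Measure.le_map_apply (hφm n i) _
    have hneg' : IsNegligible Pr' fun n ↦ π ⁻¹' (S n) ∪ ⋃ i, W n i := by
      refine isNegligible_of_le_exp (K := 4 * (k + 3) ^ 2 + 32) (q := 2) (c := 1 / 10)
        (η := 1 / 64) (by norm_num) (by norm_num) (by positivity) ?_
      filter_upwards [hbd] with n hn
      have h1 := (hπ.measure_preimage_le (S n)).trans
        (hw.measure_not_noiseBounds_le hn hB (L := L n) (by positivity))
      have h2 := measure_iUnion_le_card_mul fun i ↦ hWm n i hn
      refine (measure_union_le _ _).trans ((add_le_add h1 h2).trans ?_)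
      rw [Fintype.card_fin, ← ENNReal.ofReal_natCast, ← ENNReal.ofReal_mul (by positivity),
        ← ENNReal.ofReal_add (by positivity) (by positivity)]
      apply ENNReal.ofReal_le_ofReal
      apply le_of_eq
      rw [Real.rpow_two, show L n / 10 = 1 / 10 * (n : ℝ) ^ (1 / 64 : ℝ) by rw [hL]; ring]
      ring
    refine hneg'.isLittleO_inv (α := 1 / 16) (by norm_num) ?_
    filter_upwards [hev, eventually_mul_rpow_lt_rpow (a := 1 / 32 - 3 / 2) (b := -(1 / 16) - 1)
      (by norm_num) (2 * c), eventually_mul_rpow_lt_rpow (a := 1 / 32 - 1 / 8 - 1)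
        (b := -(1 / 16) - 1) (by norm_num) (2 * (B * c * (7 * B ^ 2)))] with n h1 h2 h3 ω hω
    have hn0 : (0 : ℝ) < n := by exact_mod_cast h1.1.n_pos
    simp only [hS, hW, mem_union, mem_preimage, mem_iUnion, mem_ofPred_eq, not_or, not_exists,
      not_not, not_lt] at hω
    have h4 := h1.2.2 _ hω.1
    have h5 := h1.1.norm_expansion_sub_le hB h1.2.1 (e := e n) (by positivity) hω.2
    have h6 : B * c * e n * (n : ℝ)⁻¹ =
        B * c * (7 * B ^ 2) * (n : ℝ) ^ (1 / 32 - 1 / 8 - 1 : ℝ) := by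
      have e1 : (n : ℝ) ^ (1 / 32 - 1 / 8 - 1 : ℝ) =
          L n ^ 2 * (n : ℝ) ^ (-1 / 8 : ℝ) * (n : ℝ)⁻¹ := by
        rw [hL, ← Real.rpow_natCast, ← Real.rpow_mul hn0.le, ← Real.rpow_add hn0,
          ← Real.rpow_neg_one, ← Real.rpow_add hn0]
        norm_num
      rw [e1, he]
      ring
    rw [h6] at h5
    refine (norm_sub_le_norm_sub_add_norm_sub _ (m.expansion f n fun i ↦ √(m.p n : ℝ) *
      (‖w n i (π ω)‖ ^ 2 - ((m.p n : ℝ)⁻¹ • m.cov n (m.cls n i)).trace)) _).trans_lt ?_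
    linarith
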